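/- In the Budgeted Coloring Problem (BCP) an instance $I$ consists of a finite simple undirected graph $G$, a number $c\ge 0$ of colors and a list of integer budgets $b_1,\dots,b_c$. The question is whether there is a proper coloring $\varphi:V(G)\to\{1,\dots,c\}$ such that $|\varphi^{-1}(i)|\le b_i$ for every $1\le i\le c$. Let $k$ be the minimum size of a vertex cover of $G$, and let $|I|$ be the size of $I$ in bits, where $G$ is given by its number of vertices and its adjacency matrix, and $c$ and the budgets are given in binary. **Theorem.** BCP parameterized by the vertex cover size $k$ is fixed-parameter tractable, that is, it can be decided in time $O(f(k)\cdot|I|^{O(1)})$ for some computable function $f:\mathbb N\to\mathbb N$. More precisely, it can be solved in $O^*(2^{2k\log_2 k})$ time: there are an algorithm and constants $C,d\in\mathbb N$ such that on every instance $I$ the algorithm halts with the correct answer to the question after time at most $$C\cdot 2^{2k\log_2 k}\cdot |I|^{d}$$ (where $2^{2k\log_2 k}=1$ for $k=0$). No vertex cover, nor its size, is part of the input. Time is measured on a random access machine with integer registers and arrays under the logarithmic cost criterion. -/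

import Mathlib

/-!  Random access machine with logarithmic cost, parameterized problems, and the
Budgeted Coloring Problem. -/

namespace RAM

/-- Number of bits of an integer: binary digits of the absolute value plus one for the sign.
It is at least `1`. -/
def bitLen (z : ℤ) : ℕ := Nat.size z.natAbs + 1

/-- A memory of integer registers and integer arrays. The registers and arrays are named in the
text of a program, so that each program uses finitely many of them; `reg r` is the content of register
`r`, and `arr a i` is cell `i` of the array `a`. -/
structure Mem where
  reg : ℕ → ℤ
  arr : ℕ → ℕ → ℤ

/-- Binary machine operations; comparisons return `1` (true) or `0` (false). -/
inductive Op where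
  | add
  | sub
  | mul
  | lt
  | eq

def Op.eval : Op → ℤ → ℤ → ℤ
  | .add, x, y => x + y
  | .sub, x, y => x - y
  | .mul, x, y => x * y
  | .lt, x, y => if x < y then 1 else 0
  | .eq, x, y => if x = y then 1 else 0

/-- Expressions: integer constants, registers, indirect access `a[e]`, binary operations. -/
inductive Expr where
  | const (z : ℤ)
  | reg (r : ℕ)
  | load (a : ℕ) (e : Expr)
  | op (o : Op) (e₁ e₂ : Expr)

/-- Value of an expression. A negative index addresses cell `0`. -/
def Expr.eval (m : Mem) : Expr → ℤ
  | .const z => z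
  | .reg r => m.reg r
  | .load a e => m.arr a (e.eval m).toNat
  | .op o e₁ e₂ => o.eval (e₁.eval m) (e₂.eval m)

/-- Logarithmic cost of evaluating an expression: every constant, every register read, every
address, every array read and every intermediate result is charged its bit length. -/
def Expr.cost (m : Mem) : Expr → ℕ
  | .const z => bitLen z
  | .reg r => bitLen (m.reg r)
  | .load a e => e.cost m + bitLen ((Expr.load a e).eval m)
  | .op o e₁ e₂ => e₁.cost m + e₂.cost m + bitLen ((Expr.op o e₁ e₂).eval m)

/-- Programs. A test succeeds if its expression is nonzero. -/
inductive Prog where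
  | skip
  | set (r : ℕ) (e : Expr)
  | store (a : ℕ) (i e : Expr)
  | seq (p q : Prog)
  | ite (e : Expr) (p q : Prog)
  | while (e : Expr) (p : Prog)

/-- Write to a register. -/
def Mem.setReg (m : Mem) (r : ℕ) (z : ℤ) : Mem :=
  { m with reg := Function.update m.reg r z }

/-- Write to a cell of an array. -/
def Mem.setArr (m : Mem) (a i : ℕ) (z : ℤ) : Mem :=
  { m with arr := Function.update m.arr a (Function.update (m.arr a) i z) }

/-- `Exec p m m' t`: started on the memory `m`, the program `p` halts with memory `m'`, and
the run costs exactly `t`. Every executed command and every test costs `1` plus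
the cost of the expressions that it evaluates. -/
inductive Exec : Prog → Mem → Mem → ℕ → Prop where
  | skip (m : Mem) : Exec .skip m m 1
  | set (m : Mem) (r : ℕ) (e : Expr) :
      Exec (.set r e) m (m.setReg r (e.eval m)) (e.cost m + 1)
  | store (m : Mem) (a : ℕ) (i e : Expr) :
      Exec (.store a i e) m (m.setArr a (i.eval m).toNat (e.eval m)) (i.cost m + e.cost m + 1)
  | seq {p q : Prog} {m₁ m₂ m₃ : Mem} {t₁ t₂ : ℕ} :
      Exec p m₁ m₂ t₁ → Exec q m₂ m₃ t₂ → Exec (.seq p q) m₁ m₃ (t₁ + t₂)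
  | iteTrue {e : Expr} {p q : Prog} {m m' : Mem} {t : ℕ} :
      e.eval m ≠ 0 → Exec p m m' t → Exec (.ite e p q) m m' (e.cost m + 1 + t)
  | iteFalse {e : Expr} {p q : Prog} {m m' : Mem} {t : ℕ} :
      e.eval m = 0 → Exec q m m' t → Exec (.ite e p q) m m' (e.cost m + 1 + t)
  | whileTrue {e : Expr} {p : Prog} {m₁ m₂ m₃ : Mem} {t₁ t₂ : ℕ} :
      e.eval m₁ ≠ 0 → Exec p m₁ m₂ t₁ → Exec (.while e p) m₂ m₃ t₂ →
      Exec (.while e p) m₁ m₃ (e.cost m₁ + 1 + t₁ + t₂)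
  | whileFalse {e : Expr} {p : Prog} {m : Mem} :
      e.eval m = 0 → Exec (.while e p) m m (e.cost m + 1)

/-- Initial memory: the input word stands in array `0`, everything else is `0`. -/
def init (w : List ℤ) : Mem where
  reg _ := 0
  arr a i := if a = 0 then w.getD i 0 else 0

/-- Size of an input in bits. -/
def inputSize (w : List ℤ) : ℕ := (w.map bitLen).sum

end RAM

/-- A parameterized decision problem, with the encoding of its instances as machine inputs. -/
structure ParamProblem where
  Inst : Type
  encode : Inst → List ℤ
  yes : Inst → Prop
  param : Inst → ℕ

/-- The problem is decided in time `O*(f(k))`: a single program decides every instance `I`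
(the answer, `1` or `0`, is left in register `0`) at cost at most `C * f(k) * |I| ^ d`,
where `k` is the parameter and `|I|` is the size of `I`, for constants `C` and `d`. -/
def ParamProblem.SolvableInOStar (P : ParamProblem) (f : ℕ → ℝ) : Prop :=
  ∃ (p : RAM.Prog) (C d : ℕ), ∀ I : P.Inst, ∃ (m : RAM.Mem) (t : ℕ),
    RAM.Exec p (RAM.init (P.encode I)) m t ∧
    (P.yes I → m.reg 0 = 1) ∧ (¬ P.yes I → m.reg 0 = 0) ∧
    (t : ℝ) ≤ C * f (P.param I) * (RAM.inputSize (P.encode I) : ℝ) ^ d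

/-- Fixed-parameter tractability, with a computable dependence on the parameter. -/
def ParamProblem.IsFPT (P : ParamProblem) : Prop :=
  ∃ f : ℕ → ℕ, Computable f ∧ P.SolvableInOStar (fun k => (f k : ℝ))

/-- An instance of the Budgeted Coloring Problem: a finite simple graph, a number of colors,
and a list of one integer budget for each color. -/
structure BCPInstance where
  n : ℕ
  G : SimpleGraph (Fin n)
  c : ℕ
  b : Fin c → ℤ

/-- Some proper coloring with colors `Fin c` uses each color `i` on at most `b i` vertices. -/
def BCPInstance.HasBudgetedColoring (I : BCPInstance) : Prop :=
  ∃ φ : I.G.Coloring (Fin I.c), ∀ i : Fin I.c, ((φ.colorClass i).ncard : ℤ) ≤ I.b i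

open Classical in
/-- The word `n, c`, followed by the adjacency matrix row by row and by the list of budgets. -/
noncomputable def BCPInstance.encode (I : BCPInstance) : List ℤ :=
  [(I.n : ℤ), (I.c : ℤ)] ++
    ((List.finRange I.n).flatMap fun u =>
      (List.finRange I.n).map fun v => if I.G.Adj u v then 1 else 0) ++
    List.ofFn I.b

/-- The minimum size of a vertex cover. -/
noncomputable def BCPInstance.vertexCoverSize (I : BCPInstance) : ℕ :=
  I.G.vertexCoverNum.toNat

/-- The Budgeted Coloring Problem parameterized by the vertex cover size. The input holds
neither a vertex cover nor its size. -/
noncomputable def BCPByVertexCover : ParamProblem where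
  Inst := BCPInstance
  encode := BCPInstance.encode
  yes := BCPInstance.HasBudgetedColoring
  param := BCPInstance.vertexCoverSize

/-! Fix a smallest vertex cover, listed as `s 0, …, s (K-1)`. A coloring splits the cover into at
most `K` color classes; number them by increasing budget of their colors and record the partition as
a map `g` from positions to class numbers below `K`. For a given `g` no colors have to be guessed:
class after class takes an unused color of least budget among those large enough for the class
(`Greedy`). By an exchange argument, if `g` comes from a budgeted coloring, then each class gets a
color of budget at most that of its original color, since the original color is still free when the
class has its turn (`IsBudgetedColoring.exists_good`).

The vertices outside the cover form an independent set, so extending the coloring of the cover is a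
bipartite matching of these vertices with the free slots of the colors. A color is forbidden for a
vertex only if it belongs to a class containing a neighbor. Hence a set of colors unavailable to a
whole set of vertices corresponds to a set `Z` of classes, and Hall's condition reduces to one
inequality `Fits` for each of the `2 ^ K` sets `Z` (`Good.exists_coloring`). Together the two lemmas
say that, for nonnegative budgets, a coloring exists if and only if some `g` passes the checks
`Good` with the greedy colors.

The cover is found by trying sizes `k = 0, 1, …` and, for each, all `2 ^ k` bit strings, where bit
`t` tells which endpoint of the first uncovered edge to take at step `t` (`exists_branch`). The
first success has minimum size.

The machine has no division, so the digits of a counter `x` are extracted by counting, at a cost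
linear in `x`. One round of the class search thus costs about `K ^ K` for the digits of `g` and `4 ^
K` for the masks `Z`, and `4 ^ K ≤ 4 * K ^ K`. The `K ^ K` rounds give `K ^ (2 * K) = 2 ^ (2 * K *
log₂ K)` up to polynomial factors, which also dominates the cover search.

For the machine model, all expressions are written in a language with bounded sums, compiled once
and for all with a generic cost bound (`SExpr.code_exec`). Programs are then verified by rules for
`Runs`, which carry correctness, cost and a bound on all stored values at the same time. -/

namespace RAM

/-! ### A small language of expressions with bounded sums, compiled to the machine -/

/-- Names of the program variables. -/
inductive Var where
  | vans | vn | vc | vn1 | vK | vkk | vfnd | vtwo | vp | vp2 | vdv | vy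
  | vt | vw | vx | vz | vok | vfu | vfv | vi | vj | va | vb
deriving DecidableEq

/-- The register that holds a variable. -/
def Var.idx : Var → ℕ
  | .vans => 0 | .vn => 1 | .vc => 2 | .vn1 => 3 | .vK => 4 | .vkk => 5 | .vfnd => 6 | .vtwo => 7
  | .vp => 8 | .vp2 => 9 | .vdv => 10 | .vy => 11 | .vt => 12 | .vw => 13 | .vx => 14 | .vz => 15
  | .vok => 16 | .vfu => 17 | .vfv => 18 | .vi => 19 | .vj => 20 | .va => 21 | .vb => 22

theorem Var.idx_injective : Function.Injective Var.idx := by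
  intro x y h
  cases x <;> cases y <;> first | rfl | exact absurd h (by decide)

theorem Var.idx_lt (x : Var) : x.idx < 32 := by cases x <;> decide

/-- Expressions with bounded sums; `sum x y e` is the sum of `e` over `0 ≤ x < y`. -/
inductive SExpr where
  | const (z : ℤ)
  | var (x : Var)
  | load (a : ℕ) (e : SExpr)
  | op (o : Op) (e₁ e₂ : SExpr)
  | sum (x y : Var) (e : SExpr)

namespace SExpr

def eval (α : ℕ → ℕ → ℤ) : (Var → ℤ) → SExpr → ℤ
  | _, const z => z
  | ρ, var x => ρ x
  | ρ, load a e => α a (e.eval α ρ).toNat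
  | ρ, op o e₁ e₂ => o.eval (e₁.eval α ρ) (e₂.eval α ρ)
  | ρ, sum x y e => ∑ i ∈ Finset.range (ρ y).toNat, e.eval α (Function.update ρ x (i : ℤ))

/-- The variables that bound a sum. -/
def bds : SExpr → List Var
  | const _ => []
  | var _ => []
  | load _ e => e.bds
  | op _ e₁ e₂ => e₁.bds ++ e₂.bds
  | sum _ y e => y :: e.bds

/-- If all variables and array cells are at most `M`, the value is at most `M ^ e.deg`. -/
def deg : SExpr → ℕ
  | const z => z.natAbs + 1
  | var _ => 1
  | load _ _ => 1
  | op _ e₁ e₂ => e₁.deg + e₂.deg + 1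
  | sum _ _ e => e.deg + 1

/-- The nesting depth of sums. -/
def dep : SExpr → ℕ
  | const _ => 0
  | var _ => 0
  | load _ e => e.dep
  | op _ e₁ e₂ => max e₁.dep e₂.dep
  | sum _ _ e => e.dep + 1

/-- The weight is the cost, in units of `l`, when every sum has a bounded number of terms. The
multiples of `deg` pay for the bit lengths of intermediate results, which may exceed `2 ^ l` but
have at most `(deg + 2) * l` bits; the constants are slack. -/
def wt : SExpr → ℕ
  | const z => z.natAbs + 5
  | var _ => 5
  | load _ e => e.wt + e.deg + 6
  | op _ e₁ e₂ => e₁.wt + e₂.wt + 2 * e₁.deg + 2 * e₂.deg + 10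
  | sum _ _ e => e.wt + 3 * e.deg + 50

/-- Upper bound for the running time, if all sums have at most `N` terms. -/
def tm (e : SExpr) (N : ℕ) : ℕ := e.wt * (N + 1) ^ e.dep

/-- Code that leaves the value in register `d` and changes no register below `d`; the variable `x`
is read from register `γ x`. -/
def code : (Var → ℕ) → ℕ → SExpr → Prog
  | _, d, const z => .set d (.const z)
  | γ, d, var x => .set d (.reg (γ x))
  | γ, d, load a e => .seq (e.code γ d) (.set d (.load a (.reg d)))
  | γ, d, op o e₁ e₂ =>
      .seq (e₁.code γ d) (.seq (e₂.code γ (d + 1)) (.set d (.op o (.reg d) (.reg (d + 1)))))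
  | γ, d, sum x y e =>
      .seq (.set d (.const 0)) (.seq (.set (d + 1) (.const 0))
        (.while (.op .lt (.reg (d + 1)) (.reg (γ y)))
          (.seq (e.code (Function.update γ x (d + 1)) (d + 2))
            (.seq (.set d (.op .add (.reg d) (.reg (d + 2))))
              (.set (d + 1) (.op .add (.reg (d + 1)) (.const 1)))))))

end SExpr

theorem bitLen_le {l w : ℕ} (hl : 1 ≤ l) {z : ℤ} (h : |z| ≤ (2 ^ l) ^ w) :
    bitLen z ≤ (w + 2) * l := by
  have h1 : z.natAbs ≤ 2 ^ (l * w) := by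
    rw [pow_mul]; zify; exact h
  have h2 : Nat.size z.natAbs ≤ l * w + 1 := by
    rw [Nat.size_le]
    calc z.natAbs ≤ 2 ^ (l * w) := h1
      _ < 2 ^ (l * w + 1) := Nat.pow_lt_pow_right (by norm_num) (by omega)
  unfold bitLen
  nlinarith

/-- A sum of two powers of `M` is at most twice their product, and the extra factor `M ≥ 2` absorbs
the two. -/
theorem Op.abs_eval_le {M : ℤ} (hM : 2 ≤ M) (o : Op) {x y : ℤ} {v w : ℕ} (hx : |x| ≤ M ^ v)
    (hy : |y| ≤ M ^ w) : |o.eval x y| ≤ M ^ (v + w + 1) := by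
  have hv : 1 ≤ M ^ v := one_le_pow₀ (by omega)
  have hw : 1 ≤ M ^ w := one_le_pow₀ (by omega)
  have key : M ^ v * M ^ w * 2 ≤ M ^ (v + w + 1) := by
    rw [pow_succ, pow_add]
    exact mul_le_mul_of_nonneg_left hM (by positivity)
  cases o with
  | add => exact (abs_add_le x y).trans (by nlinarith)
  | sub => exact (abs_sub x y).trans (by nlinarith)
  | mul =>
    simp only [Op.eval, abs_mul]
    have := mul_le_mul hx hy (abs_nonneg y) (by positivity)
    nlinarith
  | lt => simp only [Op.eval]; split_ifs <;> simp <;> nlinarith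
  | eq => simp only [Op.eval]; split_ifs <;> simp <;> nlinarith

namespace SExpr

theorem abs_eval_le {M : ℤ} (hM : 2 ≤ M) {α : ℕ → ℕ → ℤ} (hα : ∀ a i, |α a i| ≤ M) (e : SExpr) :
    ∀ {ρ : Var → ℤ}, (∀ x, |ρ x| ≤ M) → |e.eval α ρ| ≤ M ^ e.deg := by
  induction e with
  | const z =>
    intro ρ hρ
    have h1 : (z.natAbs : ℤ) < 2 ^ z.natAbs := by exact_mod_cast Nat.lt_two_pow_self
    have h2 : (2 : ℤ) ^ z.natAbs ≤ M ^ z.natAbs := pow_le_pow_left₀ (by norm_num) hM _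
    have h3 : (M : ℤ) ^ z.natAbs ≤ M ^ (z.natAbs + 1) := pow_le_pow_right₀ (by omega) (by omega)
    simp only [eval, deg]
    rw [Int.abs_eq_natAbs]; omega
  | var x => intro ρ hρ; simpa [eval, deg] using hρ x
  | load a e ih => intro ρ hρ; simpa [eval, deg] using hα a _
  | op o e₁ e₂ ih₁ ih₂ => intro ρ hρ; exact o.abs_eval_le hM (ih₁ hρ) (ih₂ hρ)
  | sum x y e ih =>
    intro ρ hρ
    simp only [eval, deg]
    have hy := hρ y
    refine (Finset.abs_sum_le_sum_abs _ _).trans ?_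
    refine (Finset.sum_le_card_nsmul _ _ (M ^ e.deg) ?_).trans ?_
    · intro i hi
      refine ih fun v => ?_
      by_cases hv : v = x
      · subst hv
        rw [Finset.mem_range] at hi
        rw [abs_le] at hy
        simp only [Function.update_self]
        rw [abs_of_nonneg (by omega)]; omega
      · rw [Function.update_of_ne hv]; exact hρ v
    · rw [Finset.card_range, nsmul_eq_mul, pow_succ, mul_comm]
      refine mul_le_mul_of_nonneg_left ?_ (by positivity)
      rw [abs_le] at hy; omega


/-- Registers from `d` on are scratch space and all variables live below `d`. A sum keeps its
accumulator in `d` and its counter in `d + 1`, and reads its bound variable from the counter by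
changing `γ`; no register of a variable is overwritten. The induction must therefore range over all
`γ`, `d` and `ρ`. -/
theorem code_exec {l N : ℕ} (hl : 1 ≤ l) (e : SExpr) :
    ∀ {γ : Var → ℕ} {d : ℕ} {ρ : Var → ℤ} {m : Mem}, (∀ x, γ x < d) → (∀ x, m.reg (γ x) = ρ x) →
      (∀ x, |ρ x| ≤ 2 ^ l) → (∀ a i, |m.arr a i| ≤ 2 ^ l) → (∀ y ∈ e.bds, (ρ y).toNat ≤ N) →
      ∃ m' t, Exec (e.code γ d) m m' t ∧ m'.reg d = e.eval m.arr ρ ∧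
        (∀ r < d, m'.reg r = m.reg r) ∧ m'.arr = m.arr ∧ t ≤ e.tm N * l := by
  have hM : (2 : ℤ) ≤ 2 ^ l := by
    calc (2 : ℤ) = 2 ^ 1 := by norm_num
      _ ≤ 2 ^ l := pow_le_pow_right₀ (by norm_num) hl
  induction e with
  | const z =>
    intro γ d ρ m hγ hm hρ hα hN
    refine ⟨_, _, Exec.set m d (.const z), by simp [Mem.setReg, Expr.eval, eval], ?_, rfl, ?_⟩
    · intro r hr; simp [Mem.setReg, hr.ne]
    · have := bitLen_le hl (abs_eval_le hM hα (const z) hρ)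
      simp only [eval, deg] at this
      simp only [Expr.cost, tm, wt, dep, pow_zero, mul_one]
      nlinarith
  | var x =>
    intro γ d ρ m hγ hm hρ hα hN
    refine ⟨_, _, Exec.set m d (.reg (γ x)), by simp [Mem.setReg, Expr.eval, eval, hm], ?_, rfl, ?_⟩
    · intro r hr; simp [Mem.setReg, hr.ne]
    · have := bitLen_le hl (abs_eval_le hM hα (var x) hρ)
      simp only [eval, deg] at this
      simp only [Expr.cost, tm, wt, dep, pow_zero, mul_one, hm]
      nlinarith
  | load a e ih =>
    intro γ d ρ m hγ hm hρ hα hN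
    obtain ⟨m₁, t₁, h₁, hd, hr, ha, ht⟩ := ih hγ hm hρ hα hN
    refine ⟨_, _, h₁.seq (Exec.set m₁ d (.load a (.reg d))), ?_, ?_, ha, ?_⟩
    · simp [Mem.setReg, Expr.eval, eval, hd, ha]
    · intro r hr'; simp [Mem.setReg, hr'.ne, hr r hr']
    · have h1 := bitLen_le hl (abs_eval_le hM hα e hρ)
      have h2 := bitLen_le hl (abs_eval_le hM hα (load a e) hρ)
      simp only [eval, deg] at h2
      simp only [Expr.cost, Expr.eval, tm, wt, dep, hd, ha] at ht ⊢
      have hp : 1 ≤ (N + 1) ^ e.dep := Nat.one_le_pow _ _ (by omega)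
      have : (e.deg + 6) * l ≤ (e.deg + 6) * (N + 1) ^ e.dep * l :=
        Nat.mul_le_mul_right _ (Nat.le_mul_of_pos_right _ hp)
      nlinarith
  | op o e₁ e₂ ih₁ ih₂ =>
    intro γ d ρ m hγ hm hρ hα hN
    have hN₁ : ∀ y ∈ e₁.bds, (ρ y).toNat ≤ N := fun y hy => hN y (by simp [bds, hy])
    have hN₂ : ∀ y ∈ e₂.bds, (ρ y).toNat ≤ N := fun y hy => hN y (by simp [bds, hy])
    obtain ⟨m₁, t₁, h₁, hd₁, hr₁, ha₁, ht₁⟩ := ih₁ hγ hm hρ hα hN₁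
    obtain ⟨m₂, t₂, h₂, hd₂, hr₂, ha₂, ht₂⟩ := ih₂ (γ := γ) (d := d + 1) (ρ := ρ) (m := m₁)
      (fun x => (hγ x).trans (by omega)) (fun x => by rw [hr₁ _ (hγ x), hm]) hρ
      (by rw [ha₁]; exact hα) hN₂
    have hd₁' : m₂.reg d = e₁.eval m.arr ρ := by rw [hr₂ d (by omega), hd₁]
    rw [ha₁] at hd₂
    refine ⟨_, _, h₁.seq (h₂.seq (Exec.set m₂ d (.op o (.reg d) (.reg (d + 1))))), ?_, ?_,
      ha₂.trans ha₁, ?_⟩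
    · simp [Mem.setReg, Expr.eval, eval, hd₁', hd₂]
    · intro r hr'; simp [Mem.setReg, hr'.ne, hr₁ r hr', hr₂ r (by omega)]
    · have b1 := bitLen_le hl (abs_eval_le hM hα e₁ hρ)
      have b2 := bitLen_le hl (abs_eval_le hM hα e₂ hρ)
      have b3 := bitLen_le hl (abs_eval_le hM hα (op o e₁ e₂) hρ)
      simp only [eval, deg] at b3
      simp only [Expr.cost, Expr.eval, tm, wt, dep, hd₁', hd₂] at ht₁ ht₂ ⊢
      have hp₁ : (N + 1) ^ e₁.dep ≤ (N + 1) ^ max e₁.dep e₂.dep :=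
        Nat.pow_le_pow_right (by omega) (le_max_left _ _)
      have hp₂ : (N + 1) ^ e₂.dep ≤ (N + 1) ^ max e₁.dep e₂.dep :=
        Nat.pow_le_pow_right (by omega) (le_max_right _ _)
      generalize (N + 1) ^ max e₁.dep e₂.dep = P at *
      have hp : 1 ≤ P := (Nat.one_le_pow _ _ (by omega)).trans hp₁
      have q₁ : e₁.wt * (N + 1) ^ e₁.dep * l ≤ e₁.wt * P * l := by gcongr
      have q₂ : e₂.wt * (N + 1) ^ e₂.dep * l ≤ e₂.wt * P * l := by gcongr
      have : (2 * e₁.deg + 2 * e₂.deg + 10) * l ≤ (2 * e₁.deg + 2 * e₂.deg + 10) * P * l :=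
        Nat.mul_le_mul_right _ (Nat.le_mul_of_pos_right _ hp)
      nlinarith
  | sum x y e ih =>
    intro γ d ρ m hγ hm hρ hα hN
    have hy := hρ y
    rw [abs_le] at hy
    set Y := (ρ y).toNat with hY
    have hYN : Y ≤ N := hN y (by simp [bds])
    have hYM : (Y : ℤ) ≤ 2 ^ l := by omega
    set f : ℕ → ℤ := fun i => e.eval m.arr (Function.update ρ x (i : ℤ)) with hf
    have hupd : ∀ i < Y, ∀ v, |Function.update ρ x (i : ℤ) v| ≤ 2 ^ l := by
      intro i hi v
      by_cases hv : v = x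
      · subst hv; simp only [Function.update_self]; rw [abs_of_nonneg (by omega)]; omega
      · rw [Function.update_of_ne hv]; exact hρ v
    have hfb : ∀ i < Y, |f i| ≤ (2 ^ l) ^ e.deg := fun i hi => abs_eval_le hM hα e (hupd i hi)
    have hacc : ∀ i ≤ Y, |∑ k ∈ Finset.range i, f k| ≤ (2 ^ l) ^ (e.deg + 1) := by
      intro i hi
      refine (Finset.abs_sum_le_sum_abs _ _).trans ?_
      refine (Finset.sum_le_card_nsmul _ _ ((2 ^ l) ^ e.deg) ?_).trans ?_
      · intro k hk; exact hfb k (by have := Finset.mem_range.1 hk; omega)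
      · rw [Finset.card_range, nsmul_eq_mul, pow_succ, mul_comm]
        exact mul_le_mul_of_nonneg_left (by omega) (by positivity)
    have bY : ∀ i ≤ Y, bitLen (i : ℤ) ≤ 3 * l := by
      intro i hi
      refine (bitLen_le hl (w := 1) ?_).trans (by omega)
      rw [abs_of_nonneg (by omega), pow_one]; omega
    have by' : bitLen (ρ y) ≤ 3 * l := bitLen_le hl (w := 1) (by rw [pow_one]; exact hρ y)
    have b0 : bitLen 0 = 1 := rfl
    have b1 : bitLen 1 = 2 := rfl
    set body : Prog := .seq (e.code (Function.update γ x (d + 1)) (d + 2))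
            (.seq (.set d (.op .add (.reg d) (.reg (d + 2))))
              (.set (d + 1) (.op .add (.reg (d + 1)) (.const 1)))) with hbody
    set test : Expr := .op .lt (.reg (d + 1)) (.reg (γ y)) with htest
    -- Induction on the number `k` of remaining rounds: after `i` rounds the accumulator holds the
    -- `i`-th partial sum.
    have loop : ∀ k i, i + k = Y → ∀ m₁ : Mem, m₁.reg d = ∑ k ∈ Finset.range i, f k →
        m₁.reg (d + 1) = i → (∀ r < d, m₁.reg r = m.reg r) → m₁.arr = m.arr →
        ∃ m' t, Exec (.while test body) m₁ m' t ∧ m'.reg d = ∑ k ∈ Finset.range Y, f k ∧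
          (∀ r < d, m'.reg r = m.reg r) ∧ m'.arr = m.arr ∧
          t ≤ (k * (e.tm N + 3 * e.deg + 32) + 9) * l := by
      intro k
      induction k with
      | zero =>
        intro i hi m₁ h1 h2 h3 h4
        obtain rfl : i = Y := by omega
        have ev : test.eval m₁ = 0 := by
          simp only [htest, Expr.eval, h2, h3 _ (hγ y), hm, Op.eval]
          rw [if_neg (by omega)]
        refine ⟨_, _, Exec.whileFalse ev, h1, h3, h4, ?_⟩
        have hc : test.cost m₁ = bitLen (Y : ℤ) + bitLen (ρ y) + bitLen 0 := by
          rw [← ev]; simp only [htest, Expr.cost, h2, h3 _ (hγ y), hm]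
        have := bY Y le_rfl
        rw [hc]; omega
      | succ k ihk =>
        intro i hi m₁ h1 h2 h3 h4
        have ev : test.eval m₁ = 1 := by
          simp only [htest, Expr.eval, h2, h3 _ (hγ y), hm, Op.eval]
          rw [if_pos (by omega)]
        obtain ⟨m₂, t₂, e₂, g1, g2, g3, g4⟩ := ih (γ := Function.update γ x (d + 1)) (d := d + 2)
          (ρ := Function.update ρ x (i : ℤ)) (m := m₁) (by
            intro v
            by_cases hv : v = x
            · subst hv; simp
            · rw [Function.update_of_ne hv]; exact (hγ v).trans (by omega)) (by
            intro v
            by_cases hv : v = x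
            · subst hv; simp [h2]
            · rw [Function.update_of_ne hv, Function.update_of_ne hv, h3 _ (hγ v), hm])
          (hupd i (by omega)) (by rw [h4]; exact hα) (by
            intro v hv
            by_cases hvx : v = x
            · subst hvx; simp; omega
            · rw [Function.update_of_ne hvx]; exact hN v (by simp [bds, hv]))
        rw [h4] at g1
        set m₃ := m₂.setReg d (∑ k ∈ Finset.range (i + 1), f k) with hm₃
        have e₃ : Exec (.set d (.op .add (.reg d) (.reg (d + 2)))) m₂ m₃
            ((Expr.op .add (.reg d) (.reg (d + 2))).cost m₂ + 1) := by
          have : m₃ = m₂.setReg d ((Expr.op .add (.reg d) (.reg (d + 2))).eval m₂) := by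
            simp only [hm₃, Expr.eval, Op.eval, g1, g2 d (by omega), h1, Finset.sum_range_succ]; rfl
          rw [this]; exact Exec.set _ _ _
        set m₄ := m₃.setReg (d + 1) ((i + 1 : ℕ) : ℤ) with hm₄
        have e₄ : Exec (.set (d + 1) (.op .add (.reg (d + 1)) (.const 1))) m₃ m₄
            ((Expr.op .add (.reg (d + 1)) (.const 1)).cost m₃ + 1) := by
          have : m₄ = m₃.setReg (d + 1) ((Expr.op .add (.reg (d + 1)) (.const 1)).eval m₃) := by
            simp only [hm₄, Expr.eval, Op.eval]
            congr 1
            simp [hm₃, Mem.setReg, g2, h2]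
          rw [this]; exact Exec.set _ _ _
        obtain ⟨m₅, t₅, e₅, k1, k2, k3, k4⟩ := ihk (i + 1) (by omega) m₄
          (by simp [hm₄, hm₃, Mem.setReg]) (by simp [hm₄, Mem.setReg])
          (by
            intro r hr
            have : r ≠ d + 1 := by omega
            simp [hm₄, hm₃, Mem.setReg, this, hr.ne, g2 r (by omega), h3 r hr])
          (by simp [hm₄, hm₃, Mem.setReg, g3, h4])
        refine ⟨m₅, _, Exec.whileTrue (by rw [ev]; norm_num) (e₂.seq (e₃.seq e₄)) e₅, k1, k2, k3, ?_⟩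
        have hc : test.cost m₁ = bitLen (i : ℤ) + bitLen (ρ y) + bitLen 1 := by
          rw [← ev]; simp only [htest, Expr.cost, h2, h3 _ (hγ y), hm]
        have c3 : (Expr.op .add (.reg d) (.reg (d + 2))).cost m₂ =
            bitLen (∑ k ∈ Finset.range i, f k) + bitLen (f i) +
              bitLen (∑ k ∈ Finset.range (i + 1), f k) := by
          simp only [Expr.cost, Expr.eval, Op.eval, g1, g2 d (by omega), h1, Finset.sum_range_succ]
          rfl
        have c4 : (Expr.op .add (.reg (d + 1)) (.const 1)).cost m₃ =
            bitLen (i : ℤ) + bitLen 1 + bitLen ((i + 1 : ℕ) : ℤ) := by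
          have : m₃.reg (d + 1) = i := by simp [hm₃, Mem.setReg, g2, h2]
          simp only [Expr.cost, Expr.eval, Op.eval, this]
          push_cast; rfl
        rw [hc, c3, c4]
        have := bY i (by omega)
        have := bY (i + 1) (by omega)
        have := bitLen_le hl (hacc i (by omega))
        have := bitLen_le hl (hacc (i + 1) (by omega))
        have := bitLen_le hl (hfb i (by omega))
        rw [b1]
        nlinarith
    have s1 : Exec (.set d (.const 0)) m (m.setReg d 0) _ := Exec.set _ _ _
    have s2 : Exec (.set (d + 1) (.const 0)) (m.setReg d 0) ((m.setReg d 0).setReg (d + 1) 0) _ :=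
      Exec.set _ _ _
    obtain ⟨m', t', ex, k1, k2, k3, k4⟩ := loop Y 0 (by omega) ((m.setReg d 0).setReg (d + 1) 0)
      (by simp [Mem.setReg]) (by simp [Mem.setReg])
      (by
        intro r hr
        have : r ≠ d + 1 := by omega
        simp [Mem.setReg, this, hr.ne]) rfl
    refine ⟨m', _, s1.seq (s2.seq ex), k1, k2, k3, ?_⟩
    simp only [Expr.cost, b0]
    have hp : 1 ≤ (N + 1) ^ e.dep := Nat.one_le_pow _ _ (by omega)
    have h1 : (e.tm N + 3 * e.deg + 32) ≤ (e.wt + 3 * e.deg + 32) * (N + 1) ^ e.dep := by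
      unfold tm; nlinarith
    have h2 : Y * (e.tm N + 3 * e.deg + 32) ≤ N * ((e.wt + 3 * e.deg + 32) * (N + 1) ^ e.dep) :=
      Nat.mul_le_mul hYN h1
    have h3 : Y * (e.tm N + 3 * e.deg + 32) + 13 ≤ (sum x y e).tm N := by
      change _ ≤ (e.wt + 3 * e.deg + 50) * (N + 1) ^ (e.dep + 1)
      rw [pow_succ]; nlinarith
    nlinarith

end SExpr
end RAM

namespace RAM

/-! ### States, commands, and rules for running them -/

/-- Values of the program variables and contents of the arrays. -/
structure St where
  ρ : Var → ℤ
  α : ℕ → ℕ → ℤ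

namespace St

def set (σ : St) (x : Var) (z : ℤ) : St := ⟨Function.update σ.ρ x z, σ.α⟩

def store (σ : St) (a i : ℕ) (z : ℤ) : St :=
  ⟨σ.ρ, Function.update σ.α a (Function.update (σ.α a) i z)⟩

def Bdd (M : ℤ) (σ : St) : Prop := (∀ x, |σ.ρ x| ≤ M) ∧ ∀ a i, |σ.α a i| ≤ M

/-- The memory `m` represents the state. -/
def Rel (σ : St) (m : Mem) : Prop := (∀ x : Var, m.reg x.idx = σ.ρ x) ∧ m.arr = σ.α

theorem Bdd.set {M : ℤ} {σ : St} (h : σ.Bdd M) {x : Var} {z : ℤ} (hz : |z| ≤ M) :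
    (σ.set x z).Bdd M := by
  refine ⟨fun y => ?_, h.2⟩
  by_cases hy : y = x
  · subst hy; simpa [St.set] using hz
  · simpa [St.set, hy] using h.1 y

theorem Bdd.store {M : ℤ} {σ : St} (h : σ.Bdd M) {a i : ℕ} {z : ℤ} (hz : |z| ≤ M) :
    (σ.store a i z).Bdd M := by
  refine ⟨h.1, fun b j => ?_⟩
  by_cases hb : b = a
  · subst hb
    by_cases hj : j = i
    · subst hj; simpa [St.store] using hz
    · simpa [St.store, hj] using h.2 b j
  · simpa [St.store, hb] using h.2 b j

theorem Rel.setReg {σ : St} {m : Mem} (h : σ.Rel m) (x : Var) (z : ℤ) :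
    (σ.set x z).Rel (m.setReg x.idx z) := by
  refine ⟨fun y => ?_, h.2⟩
  by_cases hy : y = x
  · subst hy; simp [St.set, Mem.setReg]
  · have : y.idx ≠ x.idx := fun e => hy (Var.idx_injective e)
    simpa [St.set, Mem.setReg, hy, this] using h.1 y

theorem Rel.of_temp {σ : St} {m m' : Mem} (h : σ.Rel m) (hr : ∀ r < 32, m'.reg r = m.reg r)
    (ha : m'.arr = m.arr) : σ.Rel m' :=
  ⟨fun x => by rw [hr _ x.idx_lt, h.1], ha.trans h.2⟩

/-- The two states differ at most in the variables `X` and the arrays `A`. -/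
def Same (X : List Var) (A : List ℕ) (σ σ' : St) : Prop :=
  (∀ x ∉ X, σ'.ρ x = σ.ρ x) ∧ ∀ a ∉ A, σ'.α a = σ.α a

theorem Same.refl (X : List Var) (A : List ℕ) (σ : St) : Same X A σ σ :=
  ⟨fun _ _ => rfl, fun _ _ => rfl⟩

theorem Same.trans {X : List Var} {A : List ℕ} {σ σ' σ'' : St} (h : Same X A σ σ')
    (h' : Same X A σ' σ'') : Same X A σ σ'' :=
  ⟨fun x hx => (h'.1 x hx).trans (h.1 x hx), fun a ha => (h'.2 a ha).trans (h.2 a ha)⟩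

theorem Same.mono {X Y : List Var} {A B : List ℕ} {σ σ' : St} (h : Same X A σ σ')
    (hX : ∀ x ∈ X, x ∈ Y) (hA : ∀ a ∈ A, a ∈ B) : Same Y B σ σ' :=
  ⟨fun x hx => h.1 x fun k => hx (hX x k), fun a ha => h.2 a fun k => ha (hA a k)⟩

theorem Same.set {X : List Var} {A : List ℕ} {σ σ' : St} (h : Same X A σ σ') {x : Var} (z : ℤ)
    (hx : x ∈ X) : Same X A σ (σ'.set x z) := by
  refine ⟨fun y hy => ?_, h.2⟩
  have : y ≠ x := fun e => hy (e ▸ hx)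
  simpa [St.set, this] using h.1 y hy

theorem Same.store {X : List Var} {A : List ℕ} {σ σ' : St} (h : Same X A σ σ') {a : ℕ} (i : ℕ)
    (z : ℤ) (ha : a ∈ A) : Same X A σ (σ'.store a i z) := by
  refine ⟨h.1, fun b hb => ?_⟩
  have : b ≠ a := fun e => hb (e ▸ ha)
  simpa [St.store, this] using h.2 b hb

@[simp] theorem set_ρ (σ : St) (x y : Var) (z : ℤ) :
    (σ.set x z).ρ y = if y = x then z else σ.ρ y := by
  simp [St.set, Function.update_apply]

@[simp] theorem set_α (σ : St) (x : Var) (z : ℤ) : (σ.set x z).α = σ.α := rfl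

@[simp] theorem store_ρ (σ : St) (a i : ℕ) (z : ℤ) : (σ.store a i z).ρ = σ.ρ := rfl

@[simp] theorem store_α (σ : St) (a i b j : ℕ) (z : ℤ) :
    (σ.store a i z).α b j = if b = a ∧ j = i then z else σ.α b j := by
  by_cases hb : b = a
  · subst hb; simp [St.store, Function.update_apply]
  · simp [St.store, hb]

end St

/-- Started on the state `σ`, with all values at most `2 ^ l`, the program halts at cost at most
`T * l` on a state with property `Q`, and again all values are at most `2 ^ l`. -/
def Runs (l : ℕ) (p : Prog) (σ : St) (T : ℕ) (Q : St → Prop) : Prop :=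
  σ.Bdd (2 ^ l) → ∀ m, σ.Rel m →
    ∃ m' σ' t, Exec p m m' t ∧ σ'.Rel m' ∧ σ'.Bdd (2 ^ l) ∧ Q σ' ∧ t ≤ T * l

def cset (x : Var) (e : SExpr) : Prog := .seq (e.code Var.idx 32) (.set x.idx (.reg 32))

def cstore (a : ℕ) (i e : SExpr) : Prog :=
  .seq (i.code Var.idx 32) (.seq (e.code Var.idx 33) (.store a (.reg 32) (.reg 33)))

def cif (e : SExpr) (p q : Prog) : Prog := .seq (e.code Var.idx 32) (.ite (.reg 32) p q)

/-- For `x` from `0` up to, but excluding, `y`. -/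
def cfor (x y : Var) (p : Prog) : Prog :=
  .seq (.set x.idx (.const 0)) (.while (.op .lt (.reg x.idx) (.reg y.idx))
    (.seq p (.set x.idx (.op .add (.reg x.idx) (.const 1)))))

theorem SExpr.deg_le_wt (e : SExpr) : e.deg + 4 ≤ e.wt := by
  induction e <;> simp only [deg, wt] <;> omega

theorem SExpr.wt_le_tm (e : SExpr) (N : ℕ) : e.wt ≤ e.tm N :=
  Nat.le_mul_of_pos_right _ (Nat.pow_pos (by omega))

theorem SExpr.tm_le (e : SExpr) {A B : ℕ} (N : ℕ) (hA : e.wt ≤ A) (hB : e.dep ≤ B) :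
    e.tm N ≤ A * (N + 1) ^ B :=
  Nat.mul_le_mul hA (Nat.pow_le_pow_right (by omega) hB)

section Rules

variable {l N T T' : ℕ} {σ : St} {Q Q' : St → Prop} {p q : Prog}

theorem bitLen_le_three (hl : 1 ≤ l) {z : ℤ} (h : |z| ≤ 2 ^ l) : bitLen z ≤ 3 * l :=
  bitLen_le hl (w := 1) (by rwa [pow_one])

theorem Runs.mono (h : Runs l p σ T Q) (hT : T ≤ T') (hQ : ∀ σ', Q σ' → Q' σ') :
    Runs l p σ T' Q' := by
  intro hb m hm
  obtain ⟨m', σ', t, h1, h2, h3, h4, h5⟩ := h hb m hm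
  exact ⟨m', σ', t, h1, h2, h3, hQ _ h4, h5.trans (Nat.mul_le_mul_right _ hT)⟩

/-- In continuation style, the postcondition of the first program is that the second one runs.
Proofs about programs then follow the text of the program. -/
theorem Runs.seq (h : Runs l p σ T fun σ' => Runs l q σ' T' Q) :
    Runs l (.seq p q) σ (T + T') Q := by
  intro hb m hm
  obtain ⟨m', σ', t, h1, h2, h3, h4, h5⟩ := h hb m hm
  obtain ⟨m'', σ'', t', k1, k2, k3, k4, k5⟩ := h4 h3 m' h2
  exact ⟨m'', σ'', _, h1.seq k1, k2, k3, k4, by rw [add_mul]; omega⟩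

theorem Runs.skip (hl : 1 ≤ l) (h : Q σ) : Runs l .skip σ 1 Q := fun hb m hm =>
  ⟨m, σ, 1, Exec.skip m, hm, hb, h, by omega⟩

theorem Runs.set (hl : 1 ≤ l) {x : Var} {e : SExpr} {v : ℤ}
    (hN : ∀ y ∈ e.bds, (σ.ρ y).toNat ≤ N) (hv : e.eval σ.α σ.ρ = v) (hb : |v| ≤ 2 ^ l)
    (hQ : Q (σ.set x v)) : Runs l (cset x e) σ (e.tm N + 4) Q := by
  intro hB m hm
  obtain ⟨m₁, t, h1, h2, h3, h4, h5⟩ := e.code_exec hl (γ := Var.idx) (d := 32) (ρ := σ.ρ) (m := m)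
    Var.idx_lt hm.1 hB.1 (by rw [hm.2]; exact hB.2) hN
  rw [hm.2, hv] at h2
  have hs := Exec.set m₁ x.idx (.reg 32)
  have he : (Expr.reg 32).eval m₁ = v := h2
  rw [he] at hs
  refine ⟨_, σ.set x v, _, h1.seq hs, (hm.of_temp h3 h4).setReg x v, hB.set hb, hQ, ?_⟩
  have := bitLen_le_three hl hb
  simp only [Expr.cost, h2]
  nlinarith

theorem Runs.store (hl : 1 ≤ l) {a : ℕ} {i e : SExpr} {k : ℕ} {v : ℤ}
    (hNi : ∀ y ∈ i.bds, (σ.ρ y).toNat ≤ N) (hNe : ∀ y ∈ e.bds, (σ.ρ y).toNat ≤ N)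
    (hi : i.eval σ.α σ.ρ = k) (hk : (k : ℤ) ≤ 2 ^ l)
    (hv : e.eval σ.α σ.ρ = v) (hb : |v| ≤ 2 ^ l)
    (hQ : Q (σ.store a k v)) : Runs l (cstore a i e) σ (i.tm N + e.tm N + 7) Q := by
  intro hB m hm
  obtain ⟨m₁, t₁, h1, h2, h3, h4, h5⟩ := i.code_exec hl (γ := Var.idx) (d := 32) (ρ := σ.ρ) (m := m)
    Var.idx_lt hm.1 hB.1 (by rw [hm.2]; exact hB.2) hNi
  have hm₁ := hm.of_temp h3 h4
  obtain ⟨m₂, t₂, k1, k2, k3, k4, k5⟩ := e.code_exec hl (γ := Var.idx) (d := 33) (ρ := σ.ρ) (m := m₁)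
    (fun x => x.idx_lt.trans (by norm_num)) hm₁.1 hB.1 (by rw [hm₁.2]; exact hB.2) hNe
  have hm₂ := hm₁.of_temp (fun r hr => k3 r (by omega)) k4
  rw [hm.2, hi] at h2
  rw [hm₁.2, hv] at k2
  have e1 : m₂.reg 32 = k := by rw [k3 32 (by norm_num), h2]
  have hs := Exec.store m₂ a (.reg 32) (.reg 33)
  have he : (Expr.reg 33).eval m₂ = v := k2
  have he' : ((Expr.reg 32).eval m₂).toNat = k := by simp [Expr.eval, e1]
  rw [he, he'] at hs
  refine ⟨_, σ.store a k v, _, h1.seq (k1.seq hs), ⟨hm₂.1, ?_⟩, hB.store hb, hQ, ?_⟩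
  · simp [Mem.setArr, St.store, hm₂.2]
  · have b1 := bitLen_le_three hl hb
    have b2 := bitLen_le_three hl (z := k) (by rw [abs_of_nonneg (by omega)]; exact hk)
    simp only [Expr.cost, e1, k2]
    nlinarith

theorem Runs.cond (hl : 1 ≤ l) {e : SExpr} (hN : ∀ y ∈ e.bds, (σ.ρ y).toNat ≤ N)
    (h1 : e.eval σ.α σ.ρ ≠ 0 → Runs l p σ T Q) (h2 : e.eval σ.α σ.ρ = 0 → Runs l q σ T Q) :
    Runs l (cif e p q) σ (2 * e.tm N + T) Q := by
  intro hB m hm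
  obtain ⟨m₁, t₁, e1, r1, r2, r3, r4⟩ := e.code_exec hl (γ := Var.idx) (d := 32) (ρ := σ.ρ) (m := m)
    Var.idx_lt hm.1 hB.1 (by rw [hm.2]; exact hB.2) hN
  have hm₁ := hm.of_temp r2 r3
  rw [hm.2] at r1
  have hM : (2 : ℤ) ≤ 2 ^ l := by
    calc (2 : ℤ) = 2 ^ 1 := by norm_num
      _ ≤ 2 ^ l := pow_le_pow_right₀ (by norm_num) hl
  have hbl := bitLen_le hl (SExpr.abs_eval_le hM hB.2 e hB.1)
  have hd := e.deg_le_wt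
  have hw := e.wt_le_tm N
  have hc : (Expr.reg 32).cost m₁ + 1 ≤ e.tm N * l := by
    simp only [Expr.cost, r1]
    calc _ ≤ (e.deg + 2) * l + 1 := by omega
      _ ≤ (e.deg + 4) * l := by nlinarith
      _ ≤ _ := Nat.mul_le_mul_right _ (by omega)
  by_cases hz : e.eval σ.α σ.ρ = 0
  · obtain ⟨m', σ', t, k1, k2, k3, k4, k5⟩ := h2 hz hB m₁ hm₁
    refine ⟨m', σ', _, e1.seq (Exec.iteFalse (r1.trans hz) k1), k2, k3, k4, ?_⟩
    nlinarith
  · obtain ⟨m', σ', t, k1, k2, k3, k4, k5⟩ := h1 hz hB m₁ hm₁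
    refine ⟨m', σ', _, e1.seq (Exec.iteTrue (fun h => hz (r1.symm.trans h)) k1), k2, k3, k4, ?_⟩
    nlinarith

/-- The invariant `I i` is required of the state in which the counter has already been set to `i`,
so the body establishes `I (i + 1)` for its final state with the counter raised. -/
theorem Runs.loop (hl : 1 ≤ l) {x y : Var} (hxy : x ≠ y) {Y : ℕ} (hY : σ.ρ y = Y)
    (I : ℕ → St → Prop) (h0 : I 0 (σ.set x 0))
    (hI : ∀ i < Y, ∀ σ', I i σ' → σ'.ρ x = i → σ'.ρ y = Y → Runs l p σ' T fun σ'' =>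
      σ''.ρ x = i ∧ σ''.ρ y = Y ∧ I (i + 1) (σ''.set x ((i + 1 : ℕ) : ℤ)))
    (hQ : ∀ σ', I Y σ' → σ'.ρ x = Y → σ'.ρ y = Y → Q σ') :
    Runs l (cfor x y p) σ (Y * (T + 18) + 11) Q := by
  intro hB m hm
  have hYl : (Y : ℤ) ≤ 2 ^ l := by have := (abs_le.1 (hB.1 y)).2; omega
  have hcast : ∀ i : ℕ, i ≤ Y → |(i : ℤ)| ≤ 2 ^ l := by
    intro i hi; rw [abs_of_nonneg (by omega)]; omega
  have bi : ∀ i : ℕ, i ≤ Y → bitLen (i : ℤ) ≤ 3 * l := fun i hi => bitLen_le_three hl (hcast i hi)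
  have b0 : bitLen 0 = 1 := rfl
  have b1 : bitLen 1 = 2 := rfl
  set test : Expr := .op .lt (.reg x.idx) (.reg y.idx) with htest
  have main : ∀ k i, i + k = Y → ∀ σ₁ m₁, σ₁.Bdd (2 ^ l) → σ₁.Rel m₁ → I i σ₁ → σ₁.ρ x = i →
      σ₁.ρ y = Y → ∃ m' σ' t, Exec (.while test
        (.seq p (.set x.idx (.op .add (.reg x.idx) (.const 1))))) m₁ m' t ∧ σ'.Rel m' ∧
        σ'.Bdd (2 ^ l) ∧ Q σ' ∧ t ≤ (k * (T + 18) + 9) * l := by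
    intro k
    induction k with
    | zero =>
      intro i hi σ₁ m₁ hb₁ hm₁ hI₁ hx hy
      obtain rfl : Y = i := by omega
      have ev : test.eval m₁ = 0 := by simp [htest, Expr.eval, hm₁.1, hx, hy, Op.eval]
      have hc : test.cost m₁ = bitLen (Y : ℤ) + bitLen (Y : ℤ) + bitLen 0 := by
        rw [← ev]; simp only [htest, Expr.cost, hm₁.1, hx, hy]
      refine ⟨m₁, σ₁, _, Exec.whileFalse ev, hm₁, hb₁, hQ _ hI₁ hx hy, ?_⟩
      have := bi Y le_rfl
      rw [hc]; omega
    | succ k ih =>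
      intro i hi σ₁ m₁ hb₁ hm₁ hI₁ hx hy
      have ev : test.eval m₁ = 1 := by
        simp only [htest, Expr.eval, hm₁.1, hx, hy, Op.eval]
        rw [if_pos (by omega)]
      have hc : test.cost m₁ = bitLen (i : ℤ) + bitLen (Y : ℤ) + bitLen 1 := by
        rw [← ev]; simp only [htest, Expr.cost, hm₁.1, hx, hy]
      obtain ⟨m₂, σ₂, t₂, e₂, r₂, b₂, ⟨q1, q2, q3⟩, c₂⟩ := hI i (by omega) σ₁ hI₁ hx hy hb₁ m₁ hm₁
      have e₃ := Exec.set m₂ x.idx (.op .add (.reg x.idx) (.const 1))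
      have hv : (Expr.op .add (.reg x.idx) (.const 1)).eval m₂ = ((i + 1 : ℕ) : ℤ) := by
        simp [Expr.eval, Op.eval, r₂.1, q1]
      have hc3 : (Expr.op .add (.reg x.idx) (.const 1)).cost m₂ =
          bitLen (i : ℤ) + bitLen 1 + bitLen ((i + 1 : ℕ) : ℤ) := by
        rw [← hv]; simp only [Expr.cost, r₂.1, q1]
      rw [hv] at e₃
      obtain ⟨m', σ', t, e₄, k1, k2, k3, k4⟩ := ih (i + 1) (by omega) _ _
        (b₂.set (x := x) (hcast (i + 1) (by omega))) (r₂.setReg x _) q3 (by simp)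
        (by simp [hxy.symm, q2])
      refine ⟨m', σ', _, Exec.whileTrue (by rw [ev]; norm_num) (e₂.seq e₃) e₄, k1, k2, k3, ?_⟩
      have := bi Y le_rfl
      have := bi i (by omega)
      have := bi (i + 1) (by omega)
      rw [hc, hc3, b1]
      nlinarith
  have e₀ := Exec.set m x.idx (.const 0)
  obtain ⟨m', σ', t, e₄, k1, k2, k3, k4⟩ := main Y 0 (by omega) _ _
    (hB.set (x := x) (z := 0) (by simp)) (hm.setReg x 0) h0 (by simp) (by simp [hxy.symm, hY])
  refine ⟨m', σ', _, e₀.seq e₄, k1, k2, k3, ?_⟩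
  simp only [Expr.cost, b0]
  nlinarith

end Rules

/-! ### Boolean and derived expressions -/

open Classical in
/-- The number `1` if the proposition holds, and `0` otherwise. -/
noncomputable def ind (P : Prop) : ℤ := if P then 1 else 0

@[simp] theorem ind_eq_zero {P : Prop} : ind P = 0 ↔ ¬ P := by simp [ind]

theorem ind_ne_zero {P : Prop} : ind P ≠ 0 ↔ P := by simp

theorem abs_ind_le (P : Prop) : |ind P| ≤ 1 := by unfold ind; split_ifs <;> simp

theorem sum_ind {n : ℕ} (P : ℕ → Prop) [DecidablePred P] :
    ∑ i ∈ Finset.range n, ind (P i) = ({i ∈ Finset.range n | P i}.card : ℤ) := by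
  rw [Finset.card_filter]
  push_cast
  exact Finset.sum_congr rfl fun i _ => by unfold ind; congr

/-- The least index below `n` with the property, or `n` if there is none. -/
noncomputable def firstIdx (n : ℕ) (P : ℕ → Prop) : ℕ := sInf {i | n ≤ i ∨ P i}

theorem firstIdx_le (n : ℕ) (P : ℕ → Prop) : firstIdx n P ≤ n := Nat.sInf_le (Or.inl le_rfl)

theorem not_of_lt_firstIdx {n : ℕ} {P : ℕ → Prop} {i : ℕ} (h : i < firstIdx n P) : ¬ P i :=
  fun hi => Nat.notMem_of_lt_sInf h (Or.inr hi)

theorem firstIdx_spec {n : ℕ} {P : ℕ → Prop} (h : firstIdx n P < n) : P (firstIdx n P) := by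
  have : firstIdx n P ∈ {i | n ≤ i ∨ P i} := Nat.sInf_mem ⟨n, Or.inl le_rfl⟩
  rcases this with h' | h'
  · omega
  · exact h'

theorem firstIdx_lt {n : ℕ} {P : ℕ → Prop} {i : ℕ} (hi : i < n) (h : P i) : firstIdx n P < n :=
  (Nat.sInf_le (Or.inr h)).trans_lt hi

/-- The indices `i < n` with no witness up to `i` are exactly those below the first witness, so
counting them performs a minimization. -/
theorem sum_ind_eq_firstIdx (n : ℕ) (P : ℕ → Prop) :
    ∑ i ∈ Finset.range n, ind (∀ j < n, j ≤ i → ¬ P j) = firstIdx n P := by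
  classical
  rw [sum_ind]
  have : {i ∈ Finset.range n | ∀ j < n, j ≤ i → ¬ P j} = Finset.range (firstIdx n P) := by
    ext i
    simp only [Finset.mem_filter, Finset.mem_range]
    constructor
    · rintro ⟨hi, h⟩
      by_contra hlt
      exact h (firstIdx n P) (by omega) (by omega) (firstIdx_spec (by omega))
    · intro hi
      exact ⟨hi.trans_le (firstIdx_le _ _), fun j _ hj => not_of_lt_firstIdx (lt_of_le_of_lt hj hi)⟩
  rw [this, Finset.card_range]

/-- This replaces the missing division by counting the positive multiples of `q` up to `x`. The `x`
terms of the sum are the source of the exponential cost of reading digits. -/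
theorem sum_ind_div (x q : ℕ) (hq : 0 < q) :
    ∑ i ∈ Finset.range x, ind (((i : ℤ) + 1) * q ≤ x) = ((x / q : ℕ) : ℤ) := by
  classical
  rw [sum_ind]
  have : {i ∈ Finset.range x | (((i : ℕ) : ℤ) + 1) * q ≤ x} = Finset.range (x / q) := by
    ext i
    simp only [Finset.mem_filter, Finset.mem_range]
    have : (((i : ℕ) : ℤ) + 1) * q ≤ x ↔ i < x / q := by
      rw [← Nat.succ_le_iff, Nat.le_div_iff_mul_le hq]
      exact_mod_cast Iff.rfl
    rw [this]
    exact ⟨fun h => h.2, fun h => ⟨h.trans_le (Nat.div_le_self _ _), h⟩⟩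
  rw [this, Finset.card_range]

namespace SExpr

def num (z : ℕ) : SExpr := const z
def add (e f : SExpr) : SExpr := op .add e f
def sub (e f : SExpr) : SExpr := op .sub e f
def mul (e f : SExpr) : SExpr := op .mul e f
def lt (e f : SExpr) : SExpr := op .lt e f
def eq (e f : SExpr) : SExpr := op .eq e f
def not (e : SExpr) : SExpr := eq e (num 0)
def le (e f : SExpr) : SExpr := not (lt f e)
def and (e f : SExpr) : SExpr := not (not (mul e f))
def or (e f : SExpr) : SExpr := not (and (not e) (not f))
/-- `e` holds for all values of `x` below `y`. -/
def all (x y : Var) (e : SExpr) : SExpr := not (sum x y (not e))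
/-- `e` holds for some value of `x` below `y`. -/
def ex (x y : Var) (e : SExpr) : SExpr := not (not (sum x y (not (not e))))
/-- The least value of `x` below `y` for which `e` holds, or `y`; uses the auxiliary variable
`x'`. -/
def first (x' x y : Var) (e : SExpr) : SExpr :=
  sum x' y (all x y (or (lt (var x') (var x)) (not e)))

variable (α : ℕ → ℕ → ℤ) (ρ : Var → ℤ) (e f : SExpr) (x y : Var)

@[simp] theorem eval_num (z : ℕ) : (num z).eval α ρ = z := rfl
@[simp] theorem eval_var : (var x).eval α ρ = ρ x := rfl
@[simp] theorem eval_load (a : ℕ) : (load a e).eval α ρ = α a (e.eval α ρ).toNat := rfl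
@[simp] theorem eval_sum : (sum x y e).eval α ρ =
  ∑ i ∈ Finset.range (ρ y).toNat, e.eval α (Function.update ρ x (i : ℤ)) := rfl
@[simp] theorem eval_add : (add e f).eval α ρ = e.eval α ρ + f.eval α ρ := rfl
@[simp] theorem eval_sub : (sub e f).eval α ρ = e.eval α ρ - f.eval α ρ := rfl
@[simp] theorem eval_mul : (mul e f).eval α ρ = e.eval α ρ * f.eval α ρ := rfl
@[simp] theorem eval_lt : (lt e f).eval α ρ = ind (e.eval α ρ < f.eval α ρ) := by
  simp [lt, eval, Op.eval, ind]
@[simp] theorem eval_eq : (eq e f).eval α ρ = ind (e.eval α ρ = f.eval α ρ) := by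
  simp [eq, eval, Op.eval, ind]
@[simp] theorem eval_not : (not e).eval α ρ = ind (e.eval α ρ = 0) := by simp [not]
@[simp] theorem eval_le : (le e f).eval α ρ = ind (e.eval α ρ ≤ f.eval α ρ) := by simp [le]
@[simp] theorem eval_and : (and e f).eval α ρ = ind (e.eval α ρ ≠ 0 ∧ f.eval α ρ ≠ 0) := by
  simp [and]
@[simp] theorem eval_or : (or e f).eval α ρ = ind (e.eval α ρ ≠ 0 ∨ f.eval α ρ ≠ 0) := by
  simp only [or, eval_not, eval_and, ne_eq, ind_eq_zero]
  congr 1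
  exact propext (by tauto)

theorem sum_ind_eq_zero {n : ℕ} {P : ℕ → Prop} :
    ∑ i ∈ Finset.range n, ind (P i) = 0 ↔ ∀ i < n, ¬ P i := by
  classical
  rw [sum_ind]
  simp [Finset.filter_eq_empty_iff]

@[simp] theorem eval_all : (all x y e).eval α ρ =
    ind (∀ i : ℕ, i < (ρ y).toNat → e.eval α (Function.update ρ x (i : ℤ)) ≠ 0) := by
  simp only [all, eval_not, eval_sum, sum_ind_eq_zero, ne_eq]

@[simp] theorem eval_ex : (ex x y e).eval α ρ =
    ind (∃ i : ℕ, i < (ρ y).toNat ∧ e.eval α (Function.update ρ x (i : ℤ)) ≠ 0) := by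
  simp only [ex, eval_not, eval_sum, sum_ind_eq_zero, ind_eq_zero, ne_eq]
  congr 1
  exact propext (by push Not; rfl)

theorem eval_first {x' x y : Var} (h1 : x' ≠ x) (h2 : x' ≠ y) (P : ℕ → Prop)
    (hP : ∀ i j : ℕ, e.eval α (Function.update (Function.update ρ x' (i : ℤ)) x (j : ℤ)) ≠ 0 ↔ P j) :
    (first x' x y e).eval α ρ = firstIdx (ρ y).toNat P := by
  rw [← sum_ind_eq_firstIdx]
  simp only [first, eval_sum, eval_all, eval_or, eval_lt, eval_not, eval_var,
    Function.update_self, Function.update_of_ne h1, Function.update_of_ne h2.symm, ind_ne_zero]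
  refine Finset.sum_congr rfl fun i _ => ?_
  congr 1
  refine propext (forall_congr' fun j => imp_congr_right fun _ => ?_)
  rw [← hP i j]
  constructor
  · rintro (h | h) hij
    · omega
    · exact fun h' => h' h
  · intro h
    by_cases hij : i < j
    · left; exact_mod_cast hij
    · right; by_contra h'; exact h (by omega) h'

end SExpr
end RAM

/-! ### Greedy colors for the classes, and extension by Hall's theorem. -/

namespace BudgetedColoring

open Finset RAM

open scoped Classical in
/-- Number of positions below `K` at which `g` takes the value `i`. -/
noncomputable def sz (K : ℕ) (g : ℕ → ℕ) (i : ℕ) : ℕ := #{a ∈ range K | g a = i}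

/-- Color `j` can be given to class `t` after the earlier classes got theirs. -/
def Cand (K : ℕ) (b : ℕ → ℤ) (g pk : ℕ → ℕ) (t j : ℕ) : Prop :=
  0 < sz K g t ∧ (sz K g t : ℤ) ≤ b j ∧ ∀ a < t, pk a ≠ j

/-- Among the candidates for class `t`, color `j` has the least budget. -/
def Best (c K : ℕ) (b : ℕ → ℤ) (g pk : ℕ → ℕ) (t j : ℕ) : Prop :=
  Cand K b g pk t j ∧ ∀ j' < c, Cand K b g pk t j' → b j ≤ b j'

/-- The classes get their colors greedily. -/
def Greedy (c K : ℕ) (b : ℕ → ℤ) (g pk : ℕ → ℕ) : Prop :=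
  ∀ t < K, pk t = firstIdx c (Best c K b g pk t)

open scoped Classical in
/-- The vertices outside the cover that have a neighbor in each class of `Z` and the vertices in the
classes outside `Z` fit into the colors not used for `Z`. -/
def Fits (n c K : ℕ) (adj : ℕ → ℕ → Prop) (b : ℕ → ℤ) (s g pk : ℕ → ℕ) (Z : ℕ → Prop) : Prop :=
  (#{v ∈ range n | (∀ a < K, s a ≠ v) ∧ ∀ j < K, Z j → ∃ a < K, g a = j ∧ adj v (s a)} : ℤ) +
    ∑ j ∈ range K, (if Z j then (if 0 < sz K g j then b (pk j) else 0) else (sz K g j : ℤ)) ≤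
      ∑ j ∈ range c, b j

structure Good (n c K : ℕ) (adj : ℕ → ℕ → Prop) (b : ℕ → ℤ) (s g pk : ℕ → ℕ) : Prop where
  proper : ∀ i < K, ∀ j < K, g i = g j → ¬ adj (s i) (s j)
  picked : ∀ i < K, 0 < sz K g i → pk i < c
  fits : ∀ Z : ℕ → Prop, Fits n c K adj b s g pk Z

open scoped Classical in
/-- The budgeted colorings of a graph on the vertices below `n`. -/
structure IsBudgetedColoring (n c : ℕ) (adj : ℕ → ℕ → Prop) (b : ℕ → ℤ) (φ : ℕ → ℕ) : Prop where
  lt : ∀ v < n, φ v < c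
  proper : ∀ u < n, ∀ v < n, adj u v → φ u ≠ φ v
  budget : ∀ j < c, (#{v ∈ range n | φ v = j} : ℤ) ≤ b j

variable {n c K : ℕ} {adj : ℕ → ℕ → Prop} {b : ℕ → ℤ} {s g pk : ℕ → ℕ}

theorem sz_pos {a : ℕ} (ha : a < K) : 0 < sz K g (g a) :=
  card_pos.2 ⟨a, by simp [ha]⟩

theorem exists_of_sz_pos {i : ℕ} (h : 0 < sz K g i) : ∃ a < K, g a = i := by
  obtain ⟨a, ha⟩ := card_pos.1 h
  simp only [mem_filter, mem_range] at ha
  exact ⟨a, ha⟩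

theorem sum_sz (hg : ∀ a < K, g a < K) (P : ℕ → Prop) [DecidablePred P] :
    ∑ i ∈ range K with P i, sz K g i = #{a ∈ range K | P (g a)} := by
  rw [card_eq_sum_card_fiberwise (f := g) (t := {i ∈ range K | P i})]
  · refine sum_congr rfl fun i hi => ?_
    rw [filter_filter]
    unfold sz
    congr 1
    ext a
    simp only [mem_filter, mem_range] at hi ⊢
    exact ⟨fun h => ⟨h.1, h.2 ▸ hi.2, h.2⟩, fun h => ⟨h.1, h.2.2⟩⟩
  · intro a ha
    simp only [coe_filter, mem_range, Set.mem_ofPred_eq] at ha ⊢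
    exact ⟨hg a ha.1, ha.2⟩

-- The form of the inequality used in both directions of the argument: the sizes of the classes
-- outside `Z` add up to the number of cover positions in these classes.
open scoped Classical in
theorem Fits.le (hg : ∀ a < K, g a < K) {Z : ℕ → Prop} :
    Fits n c K adj b s g pk Z ↔
      (#{v ∈ range n | (∀ a < K, s a ≠ v) ∧ ∀ j < K, Z j → ∃ a < K, g a = j ∧ adj v (s a)} : ℤ) +
        ∑ j ∈ range K with Z j ∧ 0 < sz K g j, b (pk j) + #{a ∈ range K | ¬ Z (g a)} ≤
          ∑ j ∈ range c, b j := by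
  unfold Fits
  rw [sum_ite, ← sum_filter, filter_filter, ← sum_sz hg fun i => ¬ Z i]
  push_cast
  rw [add_assoc]

theorem Greedy.best (h : Greedy c K b g pk) {t : ℕ} (ht : t < K) (hc : pk t < c) :
    Best c K b g pk t (pk t) := by
  rw [h t ht] at hc
  have := firstIdx_spec hc
  rwa [← h t ht] at this

/-- A color taken by an earlier class is no longer a candidate. The hypothesis `hic` excludes the
default `c`, which several classes without candidates may share. -/
theorem Greedy.injOn (h : Greedy c K b g pk) {i j : ℕ} (hi : i < K) (hj : j < K)
    (hic : pk i < c) (e : pk i = pk j) : i = j := by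
  rcases lt_trichotomy i j with hlt | heq | hlt
  · exact absurd e ((h.best hj (e ▸ hic)).1.2.2 i hlt)
  · exact heq
  · exact absurd e.symm ((h.best hi hic).1.2.2 j hlt)

open scoped Classical in
/-- If the checks succeed, Hall's theorem extends the coloring of the cover to all vertices. -/
theorem Good.exists_coloring (hsymm : ∀ u < n, ∀ v < n, adj u v → adj v u)
    (hb : ∀ j < c, 0 ≤ b j)
    (hcov : ∀ u < n, ∀ v < n, adj u v → (∃ a < K, s a = u) ∨ ∃ a < K, s a = v)
    (hg : ∀ a < K, g a < K) (hpk : Greedy c K b g pk) (h : Good n c K adj b s g pk) :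
    ∃ φ, IsBudgetedColoring n c adj b φ := by
  set u : ℕ → ℕ := fun j => #{a ∈ range K | pk (g a) = j} with hu
  have hub : ∀ j < c, (u j : ℤ) ≤ b j := by
    intro j hj
    rcases Nat.eq_zero_or_pos (u j) with h0 | h0
    · rw [h0]; exact hb j hj
    · obtain ⟨a, ha⟩ := card_pos.1 h0
      simp only [mem_filter, mem_range] at ha
      have hpc := h.picked (g a) (hg a ha.1) (sz_pos ha.1)
      have hB := (hpk.best (hg a ha.1) hpc).1.2.1
      rw [ha.2] at hB
      refine le_trans ?_ hB
      have : u j ≤ sz K g (g a) := by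
        refine card_le_card fun a' ha' => ?_
        simp only [mem_filter, mem_range] at ha' ⊢
        exact ⟨ha'.1, hpk.injOn (hg _ ha'.1) (hg _ ha.1) (by omega) (by omega)⟩
      exact_mod_cast this
  -- The slots of color `j` left over by the cover. By `hub` and nonnegativity of the budgets, the
  -- truncations do nothing for `j < c`.
  set r : ℕ → ℕ := fun j => (b j).toNat - u j with hr
  have hrb : ∀ j < c, (r j : ℤ) = b j - u j := by
    intro j hj
    have := hub j hj
    have := hb j hj
    simp only [hr]; omega
  set ok : ℕ → ℕ → Prop := fun v j => ∀ a < K, adj v (s a) → pk (g a) ≠ j with hok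
  let ι := {v : ℕ // v < n ∧ ∀ a < K, s a ≠ v}
  -- The bipartite graph for Hall's theorem joins a vertex outside the cover to all free slots `(j,
  -- k)` of the colors `j` that none of its cover neighbors has.
  let t : ι → Finset (Σ _ : ℕ, ℕ) := fun v =>
    ({j ∈ range c | ok v.1 j}).sigma fun j => range (r j)
  have hall : ∀ X : Finset ι, #X ≤ #(X.biUnion t) := by
    intro X
    rcases X.eq_empty_or_nonempty with rfl | ⟨v₀, hv₀⟩
    · simp
    set J : Finset ℕ := {j ∈ range c | ∃ v ∈ X, ok v.1 j} with hJ
    have hsub : J.sigma (fun j => range (r j)) ⊆ X.biUnion t := by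
      rintro ⟨j, k⟩ hjk
      simp only [hJ, mem_sigma, mem_filter, mem_range] at hjk
      obtain ⟨⟨hj, v, hv, hvj⟩, hk⟩ := hjk
      simp only [mem_biUnion, t, mem_sigma, mem_filter, mem_range]
      exact ⟨v, hv, ⟨hj, hvj⟩, hk⟩
    refine le_trans ?_ (card_le_card hsub)
    rw [card_sigma]
    simp only [card_range]
    -- The critical `Z` consists of the nonempty classes whose color is available to no vertex of
    -- `X`.
    obtain ⟨Z, hZ⟩ : ∃ Z : ℕ → Prop, ∀ i, Z i ↔ 0 < sz K g i ∧ pk i ∉ J := ⟨_, fun _ => Iff.rfl⟩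
    have hF := (Fits.le hg).1 (h.fits Z)
    set ZK : Finset ℕ := {j ∈ range K | Z j ∧ 0 < sz K g j} with hZK
    have hZK' : ∀ i, i ∈ ZK ↔ i < K ∧ 0 < sz K g i ∧ pk i ∉ J := by
      intro i; simp only [hZK, hZ, mem_filter, mem_range]; tauto
    -- A color outside `J` is forbidden for `v₀` in particular, hence is the color of some class.
    -- This is where `X` has to be nonempty.
    have hcompl : range c \ J = ZK.image pk := by
      ext j
      simp only [mem_sdiff, mem_range, mem_image, hZK']
      constructor
      · rintro ⟨hj, hjJ⟩
        have : ¬ ok v₀.1 j := fun hk => hjJ (by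
          simp only [hJ, mem_filter, mem_range]; exact ⟨hj, v₀, hv₀, hk⟩)
        simp only [hok] at this
        push Not at this
        obtain ⟨a, ha, hadj, e⟩ := this
        exact ⟨g a, ⟨hg a ha, sz_pos ha, by rwa [e]⟩, e⟩
      · rintro ⟨i, ⟨hi, hp, hiJ⟩, rfl⟩
        exact ⟨h.picked i hi hp, hiJ⟩
    have hsumZ : ∑ j ∈ range c \ J, b j = ∑ i ∈ ZK, b (pk i) := by
      rw [hcompl, sum_image]
      intro i hi i' hi' e
      have hi := (hZK' i).1 hi
      have hi' := (hZK' i').1 hi'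
      exact hpk.injOn hi.1 hi'.1 (h.picked i hi.1 hi.2.1) e
    have hJc : J ⊆ range c := filter_subset _ _
    have hsplit := sum_sdiff (f := b) hJc
    have hsumu : ∑ j ∈ J, u j = #{a ∈ range K | ¬ Z (g a)} := by
      have : ({a ∈ range K | ¬ Z (g a)} : Finset ℕ) = {a ∈ range K | pk (g a) ∈ J} := by
        refine filter_congr fun a ha => ?_
        have := sz_pos (g := g) (mem_range.1 ha)
        simp only [hZ]; tauto
      rw [this, card_eq_sum_card_fiberwise (f := fun a => pk (g a)) (t := J)]
      · refine sum_congr rfl fun j hj => ?_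
        rw [filter_filter]
        simp only [hu]
        congr 1
        refine filter_congr fun a _ => ?_
        exact ⟨fun e => ⟨e ▸ hj, e⟩, fun e => e.2⟩
      · intro a ha
        simp only [coe_filter, mem_range, Set.mem_ofPred_eq] at ha
        exact ha.2
    have hsumr : (∑ j ∈ J, r j : ℤ) = ∑ j ∈ J, b j - ∑ j ∈ J, (u j : ℤ) := by
      rw [← sum_sub_distrib]
      exact sum_congr rfl fun j hj => hrb j (mem_range.1 (hJc hj))
    -- For a class in `Z`, every vertex of `X` finds the color of the class forbidden, and as the
    -- colors of classes are distinct, it has a neighbor in that very class. So `X` is counted in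
    -- `Fits` for `Z`.
    have hX : #X ≤ #{v ∈ range n | (∀ a < K, s a ≠ v) ∧
        ∀ j < K, Z j → ∃ a < K, g a = j ∧ adj v (s a)} := by
      rw [← card_map (Function.Embedding.subtype _)]
      refine card_le_card fun v hv => ?_
      simp only [mem_map, Function.Embedding.coe_subtype] at hv
      obtain ⟨v, hvX, rfl⟩ := hv
      simp only [mem_filter, mem_range]
      refine ⟨v.2.1, v.2.2, fun j hj hjZ => ?_⟩
      rw [hZ] at hjZ
      have hjc := h.picked j hj hjZ.1
      have : ¬ ok v.1 (pk j) := fun hk => hjZ.2 (by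
        simp only [hJ, mem_filter, mem_range]; exact ⟨hjc, v, hvX, hk⟩)
      simp only [hok] at this
      push Not at this
      obtain ⟨a, ha, hadj, e⟩ := this
      exact ⟨a, ha, hpk.injOn (hg a ha) hj (by omega) e, hadj⟩
    have hsumu' : (∑ j ∈ J, (u j : ℤ)) = #{a ∈ range K | ¬ Z (g a)} := by exact_mod_cast hsumu
    have : (#X : ℤ) ≤ ∑ j ∈ J, (r j : ℤ) := by
      rw [hsumr, hsumu']
      have hX' : (#X : ℤ) ≤ _ := Nat.cast_le.2 hX
      linarith
    exact_mod_cast this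
  obtain ⟨f, hf, hft⟩ := (Finset.all_card_le_biUnion_card_iff_exists_injective t).1 hall
  have hft' : ∀ v : ι, (f v).1 < c ∧ ok v.1 (f v).1 ∧ (f v).2 < r (f v).1 := by
    intro v
    have := hft v
    simp only [t, mem_sigma, mem_filter, mem_range] at this
    exact ⟨this.1.1, this.1.2, this.2⟩
  have hex : ∀ v, (∃ a < K, s a = v) → ∃ a, a < K ∧ s a = v := fun v ⟨a, h1, h2⟩ => ⟨a, h1, h2⟩
  choose! idx hidx using hex
  have hnot : ∀ v, ¬ (∃ a < K, s a = v) → ∀ a < K, s a ≠ v := by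
    intro v hv a ha e; exact hv ⟨a, ha, e⟩
  set φ : ℕ → ℕ := fun v =>
    if hS : ∃ a < K, s a = v then pk (g (idx v))
    else if hv : v < n then (f ⟨v, hv, hnot v hS⟩).1 else 0 with hφ
  have φ_in : ∀ v, (∃ a < K, s a = v) → φ v = pk (g (idx v)) := fun v hv => by
    simp only [hφ, dif_pos hv]
  have φ_out : ∀ v (hv : v < n) (hS : ¬ ∃ a < K, s a = v), φ v = (f ⟨v, hv, hnot v hS⟩).1 := by
    intro v hv hS
    simp only [hφ, dif_neg hS, dif_pos hv]
  have pick_lt : ∀ v, (∃ a < K, s a = v) → pk (g (idx v)) < c := fun v hv =>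
    h.picked _ (hg _ (hidx v hv).1) (sz_pos (hidx v hv).1)
  have half : ∀ v < n, ∀ w < n, adj v w → (∃ a < K, s a = w) → φ v ≠ φ w := by
    intro v hv w hw hvw hwS
    rw [φ_in w hwS]
    have e := hidx w hwS
    by_cases hvS : ∃ a < K, s a = v
    · rw [φ_in v hvS]
      have e' := hidx v hvS
      intro heq
      refine h.proper _ e'.1 _ e.1
        (hpk.injOn (hg _ e'.1) (hg _ e.1) (pick_lt v hvS) heq) ?_
      rwa [e.2, e'.2]
    · rw [φ_out v hv hvS]
      exact fun heq => (hft' ⟨v, hv, hnot v hvS⟩).2.1 _ e.1 (by rwa [e.2]) heq.symm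
  refine ⟨φ, fun v hv => ?_, fun v hv w hw hvw => ?_, fun j hj => ?_⟩
  · by_cases hS : ∃ a < K, s a = v
    · rw [φ_in v hS]; exact pick_lt v hS
    · rw [φ_out v hv hS]; exact (hft' _).1
  · rcases hcov v hv w hw hvw with hS | hS
    · exact (half w hw v hv (hsymm v hv w hw hvw) hS).symm
    · exact half v hv w hw hvw hS
  · have h1 : #{v ∈ range n | φ v = j ∧ ∃ a < K, s a = v} ≤ u j := by
      refine card_le_card_of_injOn idx ?_ ?_
      · intro v hv
        simp only [coe_filter, mem_range, Set.mem_ofPred_eq] at hv ⊢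
        exact ⟨(hidx v hv.2.2).1, by rw [← φ_in v hv.2.2, hv.2.1]⟩
      · intro v hv w hw e
        simp only [coe_filter, mem_range, Set.mem_ofPred_eq] at hv hw
        rw [← (hidx v hv.2.2).2, e, (hidx w hw.2.2).2]
    -- Vertices outside the cover with the same color occupy different slots of it, because the
    -- matching is injective.
    have h2 : #{v ∈ range n | φ v = j ∧ ¬ ∃ a < K, s a = v} ≤ r j := by
      rw [← card_range (r j)]
      set sl : ℕ → ℕ := fun v => if hv : v < n ∧ ¬ ∃ a < K, s a = v then
        (f ⟨v, hv.1, hnot v hv.2⟩).2 else 0 with hsl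
      refine card_le_card_of_injOn sl ?_ ?_
      · intro v hv
        simp only [coe_filter, mem_range, Set.mem_ofPred_eq, coe_range, Set.mem_Iio] at hv ⊢
        have := (hft' ⟨v, hv.1, hnot v hv.2.2⟩).2.2
        have e := (φ_out v hv.1 hv.2.2).symm.trans hv.2.1
        rw [e] at this
        simp only [hsl, dif_pos (show v < n ∧ ¬ ∃ a < K, s a = v from ⟨hv.1, hv.2.2⟩)]
        exact this
      · intro v hv w hw e
        simp only [coe_filter, mem_range, Set.mem_ofPred_eq] at hv hw
        simp only [hsl, dif_pos (show v < n ∧ ¬ ∃ a < K, s a = v from ⟨hv.1, hv.2.2⟩),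
          dif_pos (show w < n ∧ ¬ ∃ a < K, s a = w from ⟨hw.1, hw.2.2⟩)] at e
        have e1 : (f ⟨v, hv.1, hnot v hv.2.2⟩).1 = (f ⟨w, hw.1, hnot w hw.2.2⟩).1 := by
          rw [← φ_out v hv.1 hv.2.2, ← φ_out w hw.1 hw.2.2, hv.2.1, hw.2.1]
        have := hf (Sigma.ext e1 (heq_of_eq e))
        exact congrArg Subtype.val this
    have h3 : #{v ∈ range n | φ v = j} = #{v ∈ range n | φ v = j ∧ ∃ a < K, s a = v} +
        #{v ∈ range n | φ v = j ∧ ¬ ∃ a < K, s a = v} := by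
      rw [← filter_filter, ← filter_filter, card_filter_add_card_filter_not]
    have := hrb j hj
    rw [h3]
    push_cast
    have h1' : (#{v ∈ range n | φ v = j ∧ ∃ a < K, s a = v} : ℤ) ≤ u j := by exact_mod_cast h1
    have h2' : (#{v ∈ range n | φ v = j ∧ ¬ ∃ a < K, s a = v} : ℤ) ≤ r j := by exact_mod_cast h2
    linarith

end BudgetedColoring

/-! ### A budgeted coloring yields classes that pass all checks; bounded search for a cover. -/

namespace BudgetedColoring

open Finset RAM

variable {n c K : ℕ} {adj : ℕ → ℕ → Prop} {b : ℕ → ℤ} {s : ℕ → ℕ}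

open scoped Classical in
/-- If there is a budgeted coloring, and the classes that it induces on the cover are ordered by the
budgets of their colors, then the checks succeed for the greedy choice. -/
theorem IsBudgetedColoring.exists_good {φ : ℕ → ℕ} (h : IsBudgetedColoring n c adj b φ)
    (hs : ∀ a < K, s a < n) (hinj : ∀ a < K, ∀ a' < K, s a = s a' → a = a') :
    ∃ g : ℕ → ℕ, (∀ a < K, g a < K) ∧ ∀ pk, Greedy c K b g pk → Good n c K adj b s g pk := by
  set U : Finset ℕ := (range K).image (fun a => φ (s a)) with hU
  have memU : ∀ a < K, φ (s a) ∈ U := fun a ha => mem_image.2 ⟨a, mem_range.2 ha, rfl⟩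
  -- Ties between budgets are broken by the index, just as the greedy rule takes the first best
  -- color.
  set κ : ℕ → ℤ ×ₗ ℕ := fun j => toLex (b j, j) with hκ
  set rank : ℕ → ℕ := fun j => #{j' ∈ U | κ j' < κ j} with hrank
  have rank_lt : ∀ j ∈ U, ∀ j', κ j < κ j' → rank j < rank j' := by
    intro j hj j' hlt
    refine card_lt_card ⟨fun x hx => ?_, fun hx => ?_⟩
    · simp only [mem_filter] at hx ⊢
      exact ⟨hx.1, hx.2.trans hlt⟩
    · have : j ∈ ({x ∈ U | κ x < κ j} : Finset ℕ) := hx (by simp [hj, hlt])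
      simp at this
  have κ_inj : ∀ j j', κ j = κ j' → j = j' := by
    intro j j' e
    have := congrArg (fun x => (ofLex x).2) e
    simpa [hκ] using this
  have rank_inj : ∀ j ∈ U, ∀ j' ∈ U, rank j = rank j' → j = j' := by
    intro j hj j' hj' e
    rcases lt_trichotomy (κ j) (κ j') with hlt | heq | hlt
    · exact absurd e (rank_lt j hj j' hlt).ne
    · exact κ_inj _ _ heq
    · exact absurd e (rank_lt j' hj' j hlt).ne'
  have κ_lt : ∀ j ∈ U, ∀ j' ∈ U, rank j < rank j' → κ j < κ j' := by
    intro j hj j' hj' e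
    rcases lt_trichotomy (κ j) (κ j') with hlt | heq | hlt
    · exact hlt
    · rw [κ_inj _ _ heq] at e; exact absurd e (lt_irrefl _)
    · exact absurd e (rank_lt j' hj' j hlt).le.not_gt
  have rank_K : ∀ j ∈ U, rank j < K := by
    intro j hj
    have h1 : rank j < #U :=
      card_lt_card ⟨filter_subset _ _, fun hx => by simpa using hx hj⟩
    have h2 : #U ≤ K := by simpa using card_image_le (s := range K) (f := fun a => φ (s a))
    omega
  -- The class number is the rank of the color among the colors that appear on the cover, so classes
  -- come in increasing order of `κ`.
  set g : ℕ → ℕ := fun a => rank (φ (s a)) with hg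
  have hgK : ∀ a < K, g a < K := fun a ha => rank_K _ (memU a ha)
  have g_eq : ∀ a < K, ∀ a' < K, g a = g a' → φ (s a) = φ (s a') := fun a ha a' ha' e =>
    rank_inj _ (memU a ha) _ (memU a' ha') e
  refine ⟨g, hgK, fun pk hpk => ?_⟩
  -- The exchange argument: the greedy color never comes after the original one in the order `κ`.
  have key : ∀ t, ∀ a < K, g a = t → pk t < c ∧ κ (pk t) ≤ κ (φ (s a)) := by
    intro t
    induction t using Nat.strong_induction_on with
    | _ t ih =>
      intro a ha hat
      have ht : t < K := hat ▸ hgK a ha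
      have hjc : φ (s a) < c := h.lt _ (hs a ha)
      -- The original color is large enough since it holds the class under `φ`. It is still free: by
      -- induction an earlier class has a color that is at most its own original color in the order
      -- `κ`, hence strictly below this one.
      have hcand : Cand K b g pk t (φ (s a)) := by
        refine ⟨hat ▸ sz_pos ha, ?_, fun a' ha' e => ?_⟩
        · refine le_trans ?_ (h.budget _ hjc)
          have : sz K g t ≤ #{v ∈ range n | φ v = φ (s a)} := by
            refine card_le_card_of_injOn s ?_ ?_
            · intro x hx
              simp only [coe_filter, mem_range, Set.mem_ofPred_eq] at hx ⊢
              exact ⟨hs x hx.1, g_eq _ hx.1 _ ha (by omega)⟩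
            · intro x hx y hy e
              simp only [coe_filter, mem_range, Set.mem_ofPred_eq] at hx hy
              exact hinj _ hx.1 _ hy.1 e
          exact_mod_cast this
        · have hB := (hpk.best (ha'.trans ht) (e ▸ hjc)).1.1
          obtain ⟨a'', ha'', e''⟩ := exists_of_sz_pos hB
          have h1 := (ih a' ha' a'' ha'' e'').2
          have h2 := κ_lt _ (memU a'' ha'') _ (memU a ha) (by simp only [hg] at *; omega)
          rw [e] at h1
          exact absurd (h1.trans_lt h2) (lt_irrefl _)
      obtain ⟨j₀, hj₀, hmin⟩ := exists_min_image ({j ∈ range c | Cand K b g pk t j}) b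
        ⟨φ (s a), by simp [hjc, hcand]⟩
      simp only [mem_filter, mem_range] at hj₀ hmin
      have hbest₀ : Best c K b g pk t j₀ := ⟨hj₀.2, fun j' h1 h2 => hmin j' ⟨h1, h2⟩⟩
      have hlt : pk t < c := by rw [hpk t ht]; exact firstIdx_lt hj₀.1 hbest₀
      have hbest := hpk.best ht hlt
      refine ⟨hlt, ?_⟩
      have hle := hbest.2 _ hjc hcand
      rcases hle.lt_or_eq with h1 | h1
      · exact le_of_lt (Prod.Lex.toLex_lt_toLex.2 (Or.inl h1))
      -- With equal budgets the original color is a best candidate too, so the first best candidate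
      -- does not lie beyond it.
      · refine Prod.Lex.toLex_le_toLex.2 (Or.inr ⟨h1, ?_⟩)
        by_contra hcon
        push Not at hcon
        have hb' : Best c K b g pk t (φ (s a)) :=
          ⟨hcand, fun j' h2 h3 => h1 ▸ hbest.2 j' h2 h3⟩
        rw [hpk t ht] at hcon
        exact not_of_lt_firstIdx hcon hb'
  have key_b : ∀ a < K, b (pk (g a)) ≤ b (φ (s a)) := by
    intro a ha
    rcases Prod.Lex.toLex_le_toLex.1 (key _ a ha rfl).2 with h1 | h1
    · exact h1.le
    · exact h1.1.le
  refine ⟨fun i hi j hj e hadj => ?_, fun i hi hpos => ?_, fun Z => ?_⟩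
  · exact h.proper _ (hs i hi) _ (hs j hj) hadj (g_eq i hi j hj e)
  · obtain ⟨a, ha, e⟩ := exists_of_sz_pos hpos
    exact (key i a ha e).1
  · rw [Fits.le hgK]
    set X : Finset ℕ := {v ∈ range n | (∀ a < K, s a ≠ v) ∧
      ∀ j < K, Z j → ∃ a < K, g a = j ∧ adj v (s a)} with hX
    set Y : Finset ℕ := {a ∈ range K | ¬ Z (g a)} with hY
    set T : Finset ℕ := ({a ∈ range K | Z (g a)} : Finset ℕ).image fun a => φ (s a) with hT
    have hTc : T ⊆ range c := by
      intro j hj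
      simp only [hT, mem_image, mem_filter, mem_range] at hj
      obtain ⟨a, ⟨ha, _⟩, rfl⟩ := hj
      exact mem_range.2 (h.lt _ (hs a ha))
    have hTU : ∀ j ∈ T, j ∈ U := by
      intro j hj
      simp only [hT, mem_image, mem_filter, mem_range] at hj
      obtain ⟨a, ⟨ha, _⟩, rfl⟩ := hj
      exact memU a ha
    have h1 : ∑ j ∈ range K with Z j ∧ 0 < sz K g j, b (pk j) ≤ ∑ j ∈ T, b j := by
      have : ({j ∈ range K | Z j ∧ 0 < sz K g j} : Finset ℕ) = T.image rank := by
        ext t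
        simp only [hT, mem_image, mem_filter, mem_range]
        constructor
        · rintro ⟨ht, hZ, hp⟩
          obtain ⟨a, ha, rfl⟩ := exists_of_sz_pos hp
          exact ⟨_, ⟨a, ⟨ha, hZ⟩, rfl⟩, rfl⟩
        · rintro ⟨_, ⟨a, ⟨ha, hZ⟩, rfl⟩, rfl⟩
          exact ⟨hgK a ha, hZ, sz_pos (g := g) ha⟩
      rw [this, sum_image fun j hj j' hj' e => rank_inj j (hTU j hj) j' (hTU j' hj') e]
      refine sum_le_sum fun j hj => ?_
      simp only [hT, mem_image, mem_filter, mem_range] at hj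
      obtain ⟨a, ⟨ha, _⟩, rfl⟩ := hj
      exact key_b a ha
    -- A vertex of `X` has a neighbor in each class of `Z` and thus avoids all colors in `T`. Cover
    -- vertices in classes outside `Z` avoid them because different classes have different colors
    -- under `φ`.
    have h2 : #X + #Y ≤ #{v ∈ range n | φ v ∉ T} := by
      have hYc : #Y = #(Y.image s) := by
        rw [card_image_of_injOn]
        intro a ha a' ha' e
        simp only [hY, coe_filter, mem_range, Set.mem_ofPred_eq] at ha ha'
        exact hinj a ha.1 a' ha'.1 e
      rw [hYc, ← card_union_of_disjoint]
      · refine card_le_card fun v hv => ?_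
        simp only [mem_union, hX, hY, mem_image, mem_filter, mem_range] at hv
        simp only [hT, mem_filter, mem_range, mem_image]
        rcases hv with ⟨hv, hvS, hvZ⟩ | ⟨a, ⟨ha, haZ⟩, rfl⟩
        · refine ⟨hv, ?_⟩
          rintro ⟨a, ⟨ha, haZ⟩, e⟩
          obtain ⟨a', ha', e', hadj⟩ := hvZ _ (hgK a ha) haZ
          exact h.proper v hv _ (hs a' ha') hadj (e ▸ (g_eq a' ha' a ha e').symm)
        · refine ⟨hs a ha, ?_⟩
          rintro ⟨a', ⟨ha', haZ'⟩, e⟩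
          have : g a' = g a := congrArg rank e
          exact haZ (this ▸ haZ')
      · rw [disjoint_left]
        intro v hv hv'
        simp only [hX, hY, mem_image, mem_filter, mem_range] at hv hv'
        obtain ⟨a, ⟨ha, _⟩, e⟩ := hv'
        exact hv.2.1 a ha e
    have h3 : #{v ∈ range n | φ v ∉ T} = ∑ j ∈ range c \ T, #{v ∈ range n | φ v = j} := by
      rw [card_eq_sum_card_fiberwise (f := φ) (t := range c \ T)]
      · refine sum_congr rfl fun j hj => ?_
        rw [filter_filter]
        congr 1
        refine filter_congr fun v _ => ⟨fun e => e.2, fun e => ⟨?_, e⟩⟩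
        rw [e]; exact (mem_sdiff.1 hj).2
      · intro v hv
        simp only [coe_filter, mem_range, Set.mem_ofPred_eq] at hv
        exact mem_sdiff.2 ⟨mem_range.2 (h.lt v hv.1), hv.2⟩
    have h4 : (∑ j ∈ range c \ T, #{v ∈ range n | φ v = j} : ℤ) ≤ ∑ j ∈ range c \ T, b j :=
      sum_le_sum fun j hj => h.budget j (mem_range.1 (mem_sdiff.1 hj).1)
    have h5 := sum_sdiff (f := b) hTc
    have h6 : (#X + #Y : ℤ) ≤ ∑ j ∈ range c \ T, b j := by
      refine le_trans ?_ h4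
      rw [h3] at h2
      exact_mod_cast h2
    linarith

/-! ### Bounded search for a vertex cover -/

def Covers (n : ℕ) (adj : ℕ → ℕ → Prop) (C : Finset ℕ) : Prop :=
  ∀ u < n, ∀ v < n, adj u v → u ∈ C ∨ v ∈ C

theorem Covers.mono {C D : Finset ℕ} (h : Covers n adj C) (hCD : C ⊆ D) : Covers n adj D :=
  fun u hu v hv e => (h u hu v hv e).imp (fun k => hCD k) fun k => hCD k

/-- The edge `uv` is not covered by `C`. -/
def Unc (adj : ℕ → ℕ → Prop) (C : Finset ℕ) (u v : ℕ) : Prop := adj u v ∧ u ∉ C ∧ v ∉ C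

noncomputable def firstU (n : ℕ) (adj : ℕ → ℕ → Prop) (C : Finset ℕ) : ℕ :=
  firstIdx n fun u => ∃ v < n, Unc adj C u v

noncomputable def firstV (n : ℕ) (adj : ℕ → ℕ → Prop) (C : Finset ℕ) : ℕ :=
  firstIdx n fun v => Unc adj C (firstU n adj C) v

theorem unc_first {C : Finset ℕ} (h : ¬ Covers n adj C) :
    firstU n adj C < n ∧ firstV n adj C < n ∧ Unc adj C (firstU n adj C) (firstV n adj C) := by
  unfold Covers at h
  push Not at h
  obtain ⟨u, hu, v, hv, e, h1, h2⟩ := h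
  have hU : firstU n adj C < n := firstIdx_lt hu ⟨v, hv, e, h1, h2⟩
  obtain ⟨v', hv', huv⟩ := firstIdx_spec hU
  have hV : firstV n adj C < n := firstIdx_lt hv' huv
  exact ⟨hU, hV, firstIdx_spec hV⟩

/-- The set after `t` steps of the search that takes the endpoint told by `bits`. -/
noncomputable def branch (n : ℕ) (adj : ℕ → ℕ → Prop) (bits : ℕ → ℕ) : ℕ → Finset ℕ
  | 0 => ∅
  | t + 1 => insert (if bits t = 0 then firstU n adj (branch n adj bits t)
      else firstV n adj (branch n adj bits t)) (branch n adj bits t)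

theorem branch_congr {bits bits' : ℕ → ℕ} : ∀ {t : ℕ}, (∀ i < t, bits i = bits' i) →
    branch n adj bits t = branch n adj bits' t
  | 0, _ => rfl
  | t + 1, h => by
    unfold branch
    rw [branch_congr fun i hi => h i (by omega), h t (by omega)]

/-- Let the bits be answered by `D`: at each uncovered edge take an endpoint in `D`. Until a cover
is reached, each step adds a new element of `D`, so after `#D` steps the set is a cover already or
equals `D`. Steps made after that only enlarge a cover, possibly by the default value `n`. -/
theorem exists_branch {D : Finset ℕ} (hD : Covers n adj D) :
    ∃ bits : ℕ → ℕ, (∀ i, bits i < 2) ∧ Covers n adj (branch n adj bits #D) := by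
  classical
  let o : ℕ → Finset ℕ := fun t => Nat.rec ∅ (fun _ C =>
    insert (if firstU n adj C ∈ D then firstU n adj C else firstV n adj C) C) t
  have o_succ : ∀ t, o (t + 1) = insert (if firstU n adj (o t) ∈ D then firstU n adj (o t)
    else firstV n adj (o t)) (o t) := fun _ => rfl
  let bits : ℕ → ℕ := fun t => if firstU n adj (o t) ∈ D then 0 else 1
  have hbits : ∀ t, branch n adj bits t = o t := by
    intro t
    induction t with
    | zero => rfl
    | succ t ih =>
      rw [branch, ih, o_succ]
      by_cases hm : firstU n adj (o t) ∈ D <;> simp [bits, hm]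
  have hinv : ∀ t, Covers n adj (o t) ∨ (o t ⊆ D ∧ #(o t) = t) := by
    intro t
    induction t with
    | zero => right; exact ⟨empty_subset _, rfl⟩
    | succ t ih =>
      by_cases hc : Covers n adj (o t)
      · left; rw [o_succ]; exact hc.mono (subset_insert _ _)
      · obtain ⟨h1, h2⟩ := ih.resolve_left hc
        obtain ⟨hu, hv, e, k1, k2⟩ := unc_first hc
        right
        rw [o_succ]
        split_ifs with hm
        · exact ⟨insert_subset hm h1, by rw [card_insert_of_notMem k1, h2]⟩
        · have := (hD _ hu _ hv e).resolve_left hm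
          exact ⟨insert_subset this h1, by rw [card_insert_of_notMem k2, h2]⟩
  refine ⟨bits, fun i => by simp only [bits]; split_ifs <;> omega, ?_⟩
  rw [hbits]
  rcases hinv #D with h | ⟨h1, h2⟩
  · exact h
  · rw [eq_of_subset_of_card_le h1 h2.ge]; exact hD

theorem exists_digits {q k : ℕ} (g : ℕ → ℕ) (hg : ∀ i < k, g i < q) :
    ∃ x < q ^ k, ∀ i < k, x / q ^ i % q = g i := by
  let f : Fin k → Fin q := fun i => ⟨g i, hg i i.2⟩
  refine ⟨finFunctionFinEquiv f, (finFunctionFinEquiv f).2, fun i hi => ?_⟩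
  have h1 := finFunctionFinEquiv_symm_apply_val (finFunctionFinEquiv f) ⟨i, hi⟩
  rw [Equiv.symm_apply_apply] at h1
  exact h1.symm

/-- A cover with as many positions as a smallest cover has elements lists distinct vertices. -/
theorem minimal_cover {S : ℕ → ℕ}
    (hmin : ∀ D : Finset ℕ, D ⊆ range n → Covers n adj D → K ≤ #D)
    (hS : Covers n adj ((range K).image S)) :
    (∀ a < K, S a < n) ∧ ∀ a < K, ∀ a' < K, S a = S a' → a = a' := by
  set A : Finset ℕ := {a ∈ range K | S a < n} with hA
  have hcov : Covers n adj (A.image S) := by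
    intro u hu v hv e
    simp only [hA, mem_image, mem_filter, mem_range]
    rcases hS u hu v hv e with h | h <;> simp only [mem_image, mem_range] at h <;>
      obtain ⟨a, ha, rfl⟩ := h
    · exact Or.inl ⟨a, ⟨ha, hu⟩, rfl⟩
    · exact Or.inr ⟨a, ⟨ha, hv⟩, rfl⟩
  have h1 := hmin (A.image S) (by
    intro v hv
    simp only [hA, mem_image, mem_filter, mem_range] at hv ⊢
    obtain ⟨a, ha, rfl⟩ := hv
    exact ha.2) hcov
  have h2 : #(A.image S) ≤ #A := card_image_le
  have h3 : #A ≤ #(range K) := card_le_card (filter_subset _ _)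
  rw [card_range] at h3
  -- Entries that are no vertices or are repeated could be dropped, giving a cover of fewer than `K`
  -- vertices. Equality throughout the chain of cardinalities excludes both.
  have hAK : A = range K := eq_of_subset_of_card_le (filter_subset _ _) (by rw [card_range]; omega)
  have hinj : Set.InjOn S A := card_image_iff.1 (by omega)
  have hall : ∀ a < K, a ∈ A := fun a ha => hAK ▸ mem_range.2 ha
  refine ⟨fun a ha => ?_, fun a ha a' ha' e => hinj (hall a ha) (hall a' ha') e⟩
  have := hall a ha
  simp only [hA, mem_filter] at this
  exact this.2

end BudgetedColoring

namespace BudgetedColoring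

open Finset RAM RAM.SExpr

/-! ### The program

Array `0` holds the input, array `1` the vertex cover, array `2` the class of each position of the
cover, array `3` the color of each class, and array `4` the digits of a counter. -/

def adjE (e f : SExpr) : SExpr := load 0 (add (num 2) (add (mul e (var .vn)) f))

def budE (e : SExpr) : SExpr := load 0 (add (add (num 2) (mul (var .vn) (var .vn))) e)

/-- The edge is covered by none of the first `t` positions. -/
def uncE (e f : SExpr) : SExpr :=
  and (adjE e f) (all .va .vt
    (and (not (eq (load 1 (var .va)) e)) (not (eq (load 1 (var .va)) f))))

def firstUE : SExpr := first .vb .vi .vn (ex .vj .vn (uncE (var .vi) (var .vj)))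

def firstVE : SExpr := first .vb .vj .vn (uncE (var .vfu) (var .vj))

def coversE : SExpr :=
  all .vi .vn (all .vj .vn (or (not (adjE (var .vi) (var .vj)))
    (ex .va .vkk (or (eq (load 1 (var .va)) (var .vi)) (eq (load 1 (var .va)) (var .vj))))))

def divE (q : Var) : SExpr :=
  sum .vi .vy (le (mul (add (var .vi) (num 1)) (var q)) (var .vy))

def szE (e : SExpr) : SExpr := sum .va .vK (eq (load 2 (var .va)) e)

def candE (j : Var) : SExpr :=
  and (lt (num 0) (szE (var .vt))) (and (le (szE (var .vt)) (budE (var j)))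
    (all .va .vt (not (eq (load 3 (var .va)) (var j)))))

def bestE : SExpr :=
  and (candE .vj) (all .vb .vc (or (not (candE .vb)) (le (budE (var .vj)) (budE (var .vb)))))

def pickE : SExpr := first .vi .vj .vc bestE

def properE : SExpr :=
  all .vi .vK (all .vj .vK (or (not (eq (load 2 (var .vi)) (load 2 (var .vj))))
    (not (adjE (load 1 (var .vi)) (load 1 (var .vj))))))

def pickedE : SExpr :=
  all .vi .vK (or (not (lt (num 0) (szE (var .vi)))) (lt (load 3 (var .vi)) (var .vc)))

def countE : SExpr :=
  sum .vi .vn (and (all .va .vK (not (eq (load 1 (var .va)) (var .vi))))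
    (all .vj .vK (or (not (load 4 (var .vj)))
      (ex .va .vK (and (eq (load 2 (var .va)) (var .vj)) (adjE (var .vi) (load 1 (var .va))))))))

def loadE : SExpr :=
  sum .vj .vK (add
    (mul (load 4 (var .vj)) (mul (lt (num 0) (szE (var .vj))) (budE (load 3 (var .vj)))))
    (mul (sub (num 1) (load 4 (var .vj))) (szE (var .vj))))

def fitsE : SExpr := le (add countE loadE) (sum .vj .vc (budE (var .vj)))

def nonnegE : SExpr := all .vj .vc (le (num 0) (budE (var .vj)))

/-- Write the digits of `src` in base `q` to the first `len` cells of the array. -/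
def digits (arr : ℕ) (src len q : Var) : Prog :=
  .seq (cset .vy (var src)) (cfor .vt len
    (.seq (cset .vdv (divE q)) (.seq
      (cstore arr (var .vt) (sub (var .vy) (mul (var .vdv) (var q)))) (cset .vy (var .vdv)))))

/-- Set `p` to `q ^ len`. -/
def power (p q len : Var) : Prog :=
  .seq (cset p (num 1)) (cfor .vt len (cset p (mul (var p) (var q))))

/-- With a digit `d` equal to `0` or `1`, the value `u + d * (v - u)` selects an endpoint without a
test. -/
def branchStep : Prog :=
  .seq (cset .vfu firstUE) (.seq (cset .vfv firstVE)
    (cstore 1 (var .vt)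
      (add (var .vfu) (mul (load 4 (var .vt)) (sub (var .vfv) (var .vfu))))))

def coverTry : Prog :=
  cif (not (var .vfnd))
    (.seq (digits 4 .vw .vkk .vtwo) (.seq (cfor .vt .vkk branchStep)
      (cif coversE (.seq (cset .vfnd (num 1)) (cset .vK (var .vkk))) .skip))) .skip

def coverSize : Prog :=
  cif (not (var .vfnd)) (.seq (power .vp .vtwo .vkk) (cfor .vw .vp coverTry)) .skip

/-- Find a smallest vertex cover. -/
def coverSearch : Prog := cfor .vkk .vn1 coverSize

def fitsTry : Prog := .seq (digits 4 .vz .vK .vtwo) (cset .vok (and (var .vok) fitsE))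

def classTry : Prog :=
  .seq (digits 2 .vx .vK .vK) (.seq (cfor .vt .vK (cstore 3 (var .vt) pickE))
    (.seq (cset .vok (and properE pickedE)) (.seq (cfor .vz .vp2 fitsTry)
      (cif (var .vok) (cset .vans (num 1)) .skip))))

def classSearch : Prog :=
  cif nonnegE (.seq (power .vp .vK .vK) (.seq (power .vp2 .vtwo .vK) (cfor .vx .vp classTry))) .skip

def solve : Prog :=
  .seq (cset .vn (load 0 (num 0))) (.seq (cset .vc (load 0 (num 1)))
    (.seq (cset .vn1 (add (var .vn) (num 1))) (.seq (cset .vtwo (num 2))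
      (.seq coverSearch classSearch))))

/-- The adjacency relation and the budgets in the input array. -/
def inAdj (inp : ℕ → ℤ) (n u v : ℕ) : Prop := inp (2 + (u * n + v)) ≠ 0

def inBud (inp : ℕ → ℤ) (n j : ℕ) : ℤ := inp (2 + n * n + j)

/-! ### The expressions compute the combinatorial notions. -/

section Eval

variable {α : ℕ → ℕ → ℤ} {ρ : Var → ℤ} {n c K t : ℕ}

theorem eval_adjE (hn : ρ .vn = n) {e f : SExpr} {u v : ℕ} (he : e.eval α ρ = u)
    (hf : f.eval α ρ = v) : (adjE e f).eval α ρ = α 0 (2 + (u * n + v)) := by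
  simp only [adjE, eval_load, eval_add, eval_num, eval_mul, eval_var, hn, he, hf]
  norm_cast

theorem eval_budE (hn : ρ .vn = n) {e : SExpr} {j : ℕ} (he : e.eval α ρ = j) :
    (budE e).eval α ρ = inBud (α 0) n j := by
  simp only [budE, eval_load, eval_add, eval_num, eval_mul, eval_var, hn, he, inBud]
  norm_cast

theorem eval_uncE (hn : ρ .vn = n) (ht : ρ .vt = t) {C : Finset ℕ}
    (hC : ∀ x : ℕ, x ∈ C ↔ ∃ i < t, α 1 i = x) {x y : Var} (hx : x ≠ .va) (hy : y ≠ .va) {u v : ℕ}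
    (hu : ρ x = u) (hv : ρ y = v) :
    (uncE (var x) (var y)).eval α ρ ≠ 0 ↔ Unc (inAdj (α 0) n) C u v := by
  have h0 := eval_adjE (α := α) (ρ := ρ) hn (e := var x) (f := var y) hu hv
  simp only [uncE, eval_and, ind_ne_zero, h0, Unc, inAdj, hC]
  refine and_congr_right fun _ => ?_
  simp only [eval_all, eval_and, eval_not, eval_eq, eval_load, eval_var, ht, Int.toNat_natCast,
    Function.update_self, Function.update_of_ne hx, Function.update_of_ne hy, hu, hv, ne_eq,
    ind_eq_zero, not_not]
  push Not
  exact ⟨fun h => ⟨fun i hi => (h i hi).1, fun i hi => (h i hi).2⟩, fun h i hi => ⟨h.1 i hi, h.2 i hi⟩⟩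

theorem eval_firstUE (hn : ρ .vn = n) (ht : ρ .vt = t) {C : Finset ℕ}
    (hC : ∀ x : ℕ, x ∈ C ↔ ∃ i < t, α 1 i = x) :
    firstUE.eval α ρ = firstU n (inAdj (α 0) n) C := by
  unfold firstUE firstU
  rw [eval_first (P := fun u => ∃ v < n, Unc (inAdj (α 0) n) C u v) (h1 := by decide)
    (h2 := by decide), hn, Int.toNat_natCast]
  intro i j
  simp only [eval_ex, ind_ne_zero]
  simp only [Function.update_apply, reduceCtorEq, if_false, hn, Int.toNat_natCast]
  refine exists_congr fun v => and_congr_right fun _ => ?_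
  exact eval_uncE (by simp [hn]) (by simp [ht]) hC (by decide) (by decide) (by simp) (by simp)

theorem eval_firstVE (hn : ρ .vn = n) (ht : ρ .vt = t) {C : Finset ℕ}
    (hC : ∀ x : ℕ, x ∈ C ↔ ∃ i < t, α 1 i = x) (hu : ρ .vfu = firstU n (inAdj (α 0) n) C) :
    firstVE.eval α ρ = firstV n (inAdj (α 0) n) C := by
  unfold firstVE firstV
  rw [eval_first (P := fun v => Unc (inAdj (α 0) n) C (firstU n (inAdj (α 0) n) C) v)
    (h1 := by decide) (h2 := by decide), hn, Int.toNat_natCast]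
  intro i j
  exact eval_uncE (by simp [hn]) (by simp [ht]) hC (by decide) (by decide) (by simp [hu]) (by simp)

theorem eval_coversE (hn : ρ .vn = n) (ht : ρ .vkk = t) {C : Finset ℕ}
    (hC : ∀ x : ℕ, x ∈ C ↔ ∃ i < t, α 1 i = x) :
    coversE.eval α ρ ≠ 0 ↔ Covers n (inAdj (α 0) n) C := by
  simp only [coversE, eval_all, ind_ne_zero, hn, Int.toNat_natCast, Covers, hC]
  refine forall₂_congr fun u _ => ?_
  simp only [Function.update_apply, reduceCtorEq, if_false, hn, Int.toNat_natCast]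
  refine forall₂_congr fun v _ => ?_
  simp only [eval_or, eval_not, ind_ne_zero, eval_ex, eval_eq, eval_load, eval_var,
    Function.update_apply, reduceCtorEq, if_false, if_true, ht, Int.toNat_natCast]
  rw [eval_adjE (n := n) (u := u) (v := v) (by simp [hn]) (by simp) (by simp)]
  unfold inAdj
  rw [← exists_or]
  simp only [← and_or_left]
  rw [or_iff_not_imp_left]

theorem eval_divE {q : Var} (hq : q ≠ .vi) {X Q : ℕ} (hy : ρ .vy = X) (hQ : ρ q = Q)
    (hQ0 : 0 < Q) : (divE q).eval α ρ = (X / Q : ℕ) := by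
  rw [← sum_ind_div X Q hQ0]
  simp [divE, hy, hQ, hq]

variable {s g pk : ℕ → ℕ}

theorem eval_szE (hK : ρ .vK = K) (hg : ∀ a < K, α 2 a = g a) {x : Var} (hx : x ≠ .va) {i : ℕ}
    (hi : ρ x = i) : (szE (var x)).eval α ρ = sz K g i := by
  simp only [szE, eval_sum, eval_eq, eval_load, eval_var, hK, Int.toNat_natCast,
    Function.update_self, Function.update_of_ne hx, hi, sz]
  rw [← sum_ind]
  refine sum_congr rfl fun a ha => ?_
  rw [hg a (mem_range.1 ha)]
  norm_cast

theorem eval_candE (hn : ρ .vn = n) (hK : ρ .vK = K) (ht : ρ .vt = t)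
    (hg : ∀ a < K, α 2 a = g a) (hpk : ∀ a < t, α 3 a = pk a) {x : Var} (hx : x ≠ .va) {j : ℕ}
    (hj : ρ x = j) :
    (candE x).eval α ρ ≠ 0 ↔ Cand K (inBud (α 0) n) g pk t j := by
  have h1 := eval_szE (α := α) hK hg (x := .vt) (by decide) ht
  have h2 := eval_budE (α := α) hn (e := var x) hj
  simp only [candE, eval_and, eval_lt, eval_le, eval_all, eval_not, eval_eq, eval_load, eval_var,
    ind_ne_zero, ind_eq_zero, h1, h2, eval_num, ht, Int.toNat_natCast, Function.update_self,
    Function.update_of_ne hx, hj, Cand]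
  refine and_congr (by norm_cast) (and_congr_right fun _ => forall₂_congr fun a ha => ?_)
  rw [hpk a ha]; norm_cast

theorem eval_pickE (hn : ρ .vn = n) (hc : ρ .vc = c) (hK : ρ .vK = K) (ht : ρ .vt = t)
    (hg : ∀ a < K, α 2 a = g a) (hpk : ∀ a < t, α 3 a = pk a) :
    pickE.eval α ρ = firstIdx c (Best c K (inBud (α 0) n) g pk t) := by
  unfold pickE
  rw [eval_first (P := Best c K (inBud (α 0) n) g pk t) (h1 := by decide) (h2 := by decide), hc,
    Int.toNat_natCast]
  intro i j
  simp only [bestE, eval_and, ind_ne_zero, eval_all, eval_or, eval_not, eval_le]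
  unfold Best
  refine and_congr ?_ ?_
  · exact eval_candE (by simp [hn]) (by simp [hK]) (by simp [ht]) hg hpk (by decide) (by simp)
  · simp only [Function.update_apply, reduceCtorEq, if_false, hc, Int.toNat_natCast]
    refine forall₂_congr fun j' _ => ?_
    rw [eval_budE (n := n) (j := j) (by simp [hn]) (by simp),
      eval_budE (n := n) (j := j') (by simp [hn]) (by simp),
      ← eval_candE (K := K) (t := t) (pk := pk) (j := j') (x := .vb) (α := α)
        (ρ := Function.update (Function.update (Function.update ρ .vi (i : ℤ)) .vj (j : ℤ)) .vb
          (j' : ℤ)) (by simp [hn]) (by simp [hK]) (by simp [ht]) hg hpk (by decide) (by simp)]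
    tauto

theorem eval_properE (hn : ρ .vn = n) (hK : ρ .vK = K) (hs : ∀ a < K, α 1 a = s a)
    (hg : ∀ a < K, α 2 a = g a) :
    properE.eval α ρ ≠ 0 ↔ ∀ i < K, ∀ j < K, g i = g j → ¬ inAdj (α 0) n (s i) (s j) := by
  simp only [properE, eval_all, ind_ne_zero, hK, Int.toNat_natCast]
  refine forall₂_congr fun i hi => ?_
  simp only [Function.update_apply, reduceCtorEq, if_false, hK, Int.toNat_natCast]
  refine forall₂_congr fun j hj => ?_
  simp only [eval_or, eval_not, ind_ne_zero]
  rw [eval_adjE (n := n) (u := s i) (v := s j) (by simp [hn]) (by simp [hs i hi])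
    (by simp [hs j hj])]
  simp only [eval_eq, eval_load, eval_var, Function.update_apply, reduceCtorEq, if_false, if_true,
    Int.toNat_natCast, hg i hi, hg j hj, ind_eq_zero, inAdj]
  norm_cast
  tauto

theorem eval_pickedE (hc : ρ .vc = c) (hK : ρ .vK = K)
    (hg : ∀ a < K, α 2 a = g a) (hpk : ∀ a < K, α 3 a = pk a) :
    pickedE.eval α ρ ≠ 0 ↔ ∀ i < K, 0 < sz K g i → pk i < c := by
  simp only [pickedE, eval_all, ind_ne_zero, hK, Int.toNat_natCast]
  refine forall₂_congr fun i hi => ?_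
  simp only [eval_or, eval_not, eval_lt, ind_ne_zero, ind_eq_zero]
  rw [eval_szE (K := K) (g := g) (i := i) (by simp [hK]) hg (by decide) (by simp)]
  simp only [eval_num, eval_load, eval_var, Function.update_apply, reduceCtorEq, if_false, if_true,
    Int.toNat_natCast, hpk i hi, hc]
  norm_cast
  tauto

open scoped Classical in
theorem eval_fitsE (hn : ρ .vn = n) (hc : ρ .vc = c) (hK : ρ .vK = K)
    (hs : ∀ a < K, α 1 a = s a) (hg : ∀ a < K, α 2 a = g a) (hpk : ∀ a < K, α 3 a = pk a)
    {Z : ℕ → Prop} (hZ : ∀ a < K, α 4 a = ind (Z a)) :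
    fitsE.eval α ρ ≠ 0 ↔ Fits n c K (inAdj (α 0) n) (inBud (α 0) n) s g pk Z := by
  have h1 : countE.eval α ρ = #{v ∈ range n | (∀ a < K, s a ≠ v) ∧
      ∀ j < K, Z j → ∃ a < K, g a = j ∧ inAdj (α 0) n v (s a)} := by
    rw [← sum_ind]
    simp only [countE, eval_sum, hn, Int.toNat_natCast, eval_and, ind_ne_zero, eval_all]
    refine sum_congr rfl fun v _ => ?_
    congr 1
    simp only [Function.update_apply, reduceCtorEq, if_false, hK, Int.toNat_natCast, eval_not,
      eval_eq, eval_load, eval_var, ind_eq_zero, ne_eq, if_true, eval_or, eval_ex, eval_and]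
    refine propext (and_congr (forall₂_congr fun a ha => ?_) (forall₂_congr fun j hj => ?_))
    · rw [hs a ha]; norm_cast; tauto
    · have h : ∀ a, a < K → (adjE (var .vi) (load 1 (var .va))).eval α (Function.update
          (Function.update (Function.update ρ .vi (v : ℤ)) .vj (j : ℤ)) .va (a : ℤ)) =
          α 0 (2 + (v * n + s a)) := fun a ha =>
        eval_adjE (by simp [hn]) (by simp) (by simp [hs a ha])
      rw [hZ j hj]
      simp only [ind_eq_zero, not_not]
      rw [← imp_iff_not_or]
      refine imp_congr_right fun _ => exists_congr fun a => and_congr_right fun ha => ?_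
      rw [hg a ha, h a ha]
      exact and_congr (by norm_cast) Iff.rfl
  have h2 : loadE.eval α ρ = ∑ j ∈ range K, (if Z j then
      (if 0 < sz K g j then inBud (α 0) n (pk j) else 0) else (sz K g j : ℤ)) := by
    simp only [loadE, eval_sum, hK, Int.toNat_natCast, eval_add, eval_mul, eval_lt, eval_sub]
    refine sum_congr rfl fun j hj => ?_
    have hj := mem_range.1 hj
    rw [eval_szE (K := K) (g := g) (i := j) (by simp [hK]) hg (by decide) (by simp),
      eval_budE (n := n) (j := pk j) (by simp [hn]) (by simp [hpk j hj])]
    simp only [eval_num, eval_load, eval_var, Function.update_self, Int.toNat_natCast, hZ j hj, ind]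
    split_ifs <;> simp_all
  have h3 : (sum .vj .vc (budE (var .vj))).eval α ρ = ∑ j ∈ range c, inBud (α 0) n j := by
    simp only [eval_sum, hc, Int.toNat_natCast]
    exact sum_congr rfl fun j _ => eval_budE (by simp [hn]) (by simp)
  simp only [fitsE, eval_le, eval_add, h1, h2, h3, ind_ne_zero]
  rfl

theorem eval_nonnegE (hn : ρ .vn = n) (hc : ρ .vc = c) :
    nonnegE.eval α ρ ≠ 0 ↔ ∀ j < c, 0 ≤ inBud (α 0) n j := by
  simp only [nonnegE, eval_all, ind_ne_zero, hc, Int.toNat_natCast, eval_le]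
  refine forall₂_congr fun j _ => ?_
  rw [eval_budE (n := n) (j := j) (by simp [hn]) (by simp)]
  simp

end Eval

end BudgetedColoring

namespace BudgetedColoring

open Finset RAM RAM.SExpr

/-! ### Correctness and cost of the program -/

/-- Bound for the cost of every expression of the program that has sums of at most `N` terms. -/
def W (N : ℕ) : ℕ := 20000 * (N + 1) ^ 4

theorem le_W (N : ℕ) : 20000 * (N + 1) ≤ W N := by
  unfold W
  exact Nat.mul_le_mul_left _ (Nat.le_self_pow (by norm_num) _)

/-- The bound has room for the overhead of assignments and tests, and of stores, which evaluate two
expressions. Depth `4` is reached by `firstUE` and `pickE`. -/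
theorem tm_le_W {e : SExpr} (N : ℕ) (hA : e.wt ≤ 9000) (hB : e.dep ≤ 4) :
    2 * e.tm N + 7 ≤ W N := by
  have h1 := e.tm_le N hA hB
  have h2 : 1 ≤ (N + 1) ^ 4 := Nat.one_le_pow _ _ (by omega)
  unfold W
  omega

/-- The variables that bound sums of polynomial length. -/
def limVars : List Var := [.vn, .vc, .vK, .vkk, .vt]

def Lim (N : ℕ) (σ : St) : Prop := ∀ y ∈ limVars, (σ.ρ y).toNat ≤ N

section Rules

variable {l N T : ℕ} {σ : St} {Q : St → Prop} {p q : Prog}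

theorem Runs.set_W (hl : 1 ≤ l) {x : Var} {e : SExpr} {v : ℤ} (hA : e.wt ≤ 9000) (hB : e.dep ≤ 4)
    (he : ∀ y ∈ e.bds, y ∈ limVars) (hN : Lim N σ) (hv : e.eval σ.α σ.ρ = v) (hb : |v| ≤ 2 ^ l)
    (hQ : Q (σ.set x v)) : Runs l (cset x e) σ (W N) Q :=
  (Runs.set hl (fun y hy => hN y (he y hy)) hv hb hQ).mono
    (by have := tm_le_W N hA hB; omega) fun _ h => h

theorem Runs.store_W (hl : 1 ≤ l) {a : ℕ} {i e : SExpr} {k : ℕ} {v : ℤ} (hA' : i.wt ≤ 9000)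
    (hB' : i.dep ≤ 4) (hA : e.wt ≤ 9000) (hB : e.dep ≤ 4)
    (hNi : ∀ y ∈ i.bds, y ∈ limVars) (hNe : ∀ y ∈ e.bds, y ∈ limVars) (hN : Lim N σ)
    (hi : i.eval σ.α σ.ρ = k) (hk : (k : ℤ) ≤ 2 ^ l)
    (hv : e.eval σ.α σ.ρ = v) (hb : |v| ≤ 2 ^ l)
    (hQ : Q (σ.store a k v)) : Runs l (cstore a i e) σ (W N) Q :=
  (Runs.store hl (fun y hy => hN y (hNi y hy)) (fun y hy => hN y (hNe y hy)) hi hk hv hb hQ).mono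
    (by have := tm_le_W N hA hB; have := tm_le_W N hA' hB'; omega) fun _ h => h

theorem Runs.cond_W (hl : 1 ≤ l) {e : SExpr} (hA : e.wt ≤ 9000) (hB : e.dep ≤ 4)
    (he : ∀ y ∈ e.bds, y ∈ limVars) (hN : Lim N σ)
    (h1 : e.eval σ.α σ.ρ ≠ 0 → Runs l p σ T Q) (h2 : e.eval σ.α σ.ρ = 0 → Runs l q σ T Q) :
    Runs l (cif e p q) σ (W N + T) Q :=
  (Runs.cond hl (fun y hy => hN y (he y hy)) h1 h2).mono
    (by have := tm_le_W N hA hB; omega) fun _ h => h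

theorem abs_nat_le {a : ℕ} (h : (a : ℤ) ≤ 2 ^ l) : |(a : ℤ)| ≤ 2 ^ l := by
  rwa [abs_of_nonneg (by omega)]

theorem abs_ind_le_pow (P : Prop) : |ind P| ≤ 2 ^ l :=
  (abs_ind_le P).trans (one_le_pow₀ (by norm_num))

/-- After `i` rounds the variable `vy` holds `X / Q ^ i`, and the next digit is its remainder. Each
round divides by counting, over up to `X` terms, hence the factor `X + 1`. A zero base is allowed
when there are no digits, which occurs for an empty cover. -/
theorem runs_digits (hl : 1 ≤ l) {arr : ℕ} {src len q : Var} (hlen : len ∉ [Var.vy, .vdv, .vt])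
    (hq : q ∉ [Var.vy, .vdv, .vt, .vi]) {X k Q : ℕ} (hX : σ.ρ src = X)
    (hk : σ.ρ len = k) (hQ : σ.ρ q = Q) (hQ0 : 0 < k → 0 < Q) (hXl : (X : ℤ) ≤ 2 ^ l)
    (hkl : (k : ℤ) ≤ 2 ^ l) {R : St → Prop}
    (hR : ∀ σ', St.Same [.vy, .vdv, .vt] [arr] σ σ' → σ'.ρ .vt = k →
      (∀ i < k, σ'.α arr i = (X / Q ^ i % Q : ℕ)) → R σ') :
    Runs l (digits arr src len q) σ (400 * (k + 1) * (X + 1)) R := by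
  simp only [List.mem_cons, List.not_mem_nil, not_or, or_false] at hlen hq
  have hdl : ∀ i, ((X / i : ℕ) : ℤ) ≤ 2 ^ l := fun i =>
    le_trans (by exact_mod_cast Nat.div_le_self X i) hXl
  refine Runs.mono (Runs.seq (Runs.set (N := 0) hl (by simp [bds]) hX (abs_nat_le hXl)
    -- The numbers are the costs of the three commands of the body: `194`, `5`, `47`, `5` are
    -- weights of their expressions and `4`, `7`, `4` the overheads of the rules.
    (Runs.loop (T := 194 * (X + 1) + 4 + (5 + 47 + 7 + (5 + 4))) hl (Ne.symm hlen.2.2) (Y := k)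
      (by simp [hlen, hk])
      (fun i σ' => St.Same [.vy, .vdv, .vt] [arr] σ σ' ∧ σ'.ρ .vy = (X / Q ^ i : ℕ) ∧
        ∀ j < i, σ'.α arr j = (X / Q ^ j % Q : ℕ)) ?_ ?_ ?_))) ?_ fun _ h => h
  · refine ⟨((St.Same.refl _ _ σ).set _ (by decide)).set _ (by decide), by simp, by simp⟩
  · rintro i hi σ' ⟨hS, hy, hd⟩ ht hlen'
    have hQ' : σ'.ρ q = Q := by rw [hS.1 q (by simp [hq]), hQ]
    have hQpos := hQ0 (by omega)
    have hle : X / Q ^ i ≤ X := Nat.div_le_self _ _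
    refine Runs.mono (Runs.seq (Runs.set (N := X) hl ?_
      (eval_divE hq.2.2.2 hy hQ' hQpos) (abs_nat_le ?_)
      (Runs.seq (Runs.store (N := 0) (k := i) (v := (X / Q ^ i % Q : ℕ)) hl (by simp [bds])
        (by simp [bds, sub, mul]) (by simp [ht]) (by omega) ?_ (abs_nat_le ?_)
        (Runs.set (N := 0) (v := (X / Q ^ (i + 1) : ℕ)) hl (by simp [bds]) ?_ (abs_nat_le (hdl _))
          ?_))))) ?_ fun _ h => h
    · intro y hy'
      have : y = .vy := by simpa [bds, divE, le, lt, mul, add, SExpr.not, eq, num] using hy'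
      subst this
      rw [hy, Int.toNat_natCast]; exact hle
    · exact le_trans (by exact_mod_cast (Nat.div_le_self _ _).trans hle) hXl
    · simp only [eval_sub, eval_var, eval_mul, St.set_ρ, if_true, reduceCtorEq, if_false, hy,
        if_neg hq.2.1, hQ']
      have := Nat.div_add_mod (X / Q ^ i) Q
      rw [mul_comm] at this
      have h2 : ((X / Q ^ i / Q * Q + X / Q ^ i % Q : ℕ) : ℤ) = (X / Q ^ i : ℕ) := by rw [this]
      push_cast at h2 ⊢
      linarith
    · exact le_trans (by exact_mod_cast (Nat.mod_le _ _).trans hle) hXl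
    · simp [Nat.div_div_eq_div_mul, pow_succ]
    · refine ⟨by simp [ht], by simp [hlen, hlen'], ?_, by simp, ?_⟩
      · exact (((hS.set _ (by decide)).store _ _ (by simp)).set _ (by decide)).set _ (by decide)
      · intro j hj
        simp only [St.set_α, St.store_α, true_and]
        split_ifs with hji
        · rw [hji]
        · exact hd j (by omega)
    · have h1 : (divE q).tm X = 194 * (X + 1) := by
        change 194 * (X + 1) ^ 1 = _; rw [pow_one]
      have h2 : (var .vt).tm 0 = 5 := rfl
      have h3 : (sub (var .vy) (mul (var .vdv) (var q))).tm 0 = 47 := rfl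
      have h4 : (var .vdv).tm 0 = 5 := rfl
      omega
  · rintro σ' ⟨hS, hy, hd⟩ ht hlen'
    exact hR σ' hS ht hd
  · have h2 : (var src).tm 0 = 5 := rfl
    rw [h2]
    nlinarith [Nat.zero_le (k * X)]

theorem runs_power (hl : 1 ≤ l) {p q len : Var} (hp : p ∉ [q, len, Var.vt]) (hqt : q ≠ .vt)
    (hlen : len ≠ .vt) {k Q : ℕ} (hk : σ.ρ len = k) (hQ : σ.ρ q = Q)
    (hb : ∀ i ≤ k, ((Q ^ i : ℕ) : ℤ) ≤ 2 ^ l) {R : St → Prop}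
    (hR : ∀ σ', St.Same [p, .vt] [] σ σ' → σ'.ρ .vt = k → σ'.ρ p = (Q ^ k : ℕ) → R σ') :
    Runs l (power p q len) σ (100 * (k + 1)) R := by
  simp only [List.mem_cons, List.not_mem_nil, not_or, or_false] at hp
  refine Runs.mono (Runs.seq (Runs.set (N := 0) (v := 1) hl (by simp [bds, num]) rfl ?_
    (Runs.loop (T := 24 + 4) hl (Ne.symm hlen) (Y := k) (by simp [Ne.symm hp.2.1, hk])
      (fun i σ' => St.Same [p, .vt] [] σ σ' ∧ σ'.ρ p = (Q ^ i : ℕ)) ?_ ?_ ?_))) ?_ fun _ h => h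
  · simpa using hb 0 (by omega)
  · exact ⟨((St.Same.refl _ _ σ).set _ (by simp)).set _ (by simp), by simp [hp.2.2]⟩
  · rintro i hi σ' ⟨hS, hpi⟩ ht hlen'
    have hQ' : σ'.ρ q = Q := by rw [hS.1 q (by simp [Ne.symm hp.1, hqt]), hQ]
    refine Runs.set (N := 0) (v := (Q ^ (i + 1) : ℕ)) hl (by simp [bds, mul]) ?_
      (abs_nat_le (hb _ (by omega))) ?_
    · simp [hpi, hQ', pow_succ]
    · refine ⟨by simp [ht, Ne.symm hp.2.2], by simp [hlen', Ne.symm hp.2.1], ?_, by simp [hp.2.2]⟩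
      exact (hS.set _ (by simp)).set _ (by simp)
  · rintro σ' ⟨hS, h⟩ ht _
    exact hR σ' hS ht h
  · have h2 : (num 1).tm 0 = 6 := rfl
    rw [h2]; omega

end Rules

/-- The variables that hold the input parameters. -/
structure Ctx (n c : ℕ) (inp : ℕ → ℤ) (σ : St) : Prop where
  hn : σ.ρ .vn = n
  hc : σ.ρ .vc = c
  hn1 : σ.ρ .vn1 = (n + 1 : ℕ)
  htwo : σ.ρ .vtwo = (2 : ℕ)
  hinp : σ.α 0 = inp

theorem Ctx.same {n c : ℕ} {inp : ℕ → ℤ} {σ σ' : St} {X : List Var} {A : List ℕ}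
    (h : Ctx n c inp σ) (hS : St.Same X A σ σ')
    (hX : ∀ x ∈ [Var.vn, .vc, .vn1, .vtwo], x ∉ X) (hA : 0 ∉ A) : Ctx n c inp σ' where
  hn := (hS.1 _ (hX _ (by decide))).trans h.hn
  hc := (hS.1 _ (hX _ (by decide))).trans h.hc
  hn1 := (hS.1 _ (hX _ (by decide))).trans h.hn1
  htwo := (hS.1 _ (hX _ (by decide))).trans h.htwo
  hinp := (hS.2 _ hA).trans h.hinp

theorem Ctx.lim {n c N K k t : ℕ} {inp : ℕ → ℤ} {σ : St} (h : Ctx n c inp σ) (hn : n ≤ N)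
    (hc : c ≤ N) (hK : σ.ρ .vK = K) (hKN : K ≤ N) (hk : σ.ρ .vkk = k) (hkN : k ≤ N)
    (ht : σ.ρ .vt = t) (htN : t ≤ N) : Lim N σ := by
  intro y hy
  simp only [limVars, List.mem_cons, List.not_mem_nil, or_false] at hy
  rcases hy with rfl | rfl | rfl | rfl | rfl
  · rw [h.hn]; simpa
  · rw [h.hc]; simpa
  · rw [hK]; simpa
  · rw [hk]; simpa
  · rw [ht]; simpa

end BudgetedColoring

namespace BudgetedColoring

open Finset RAM RAM.SExpr

/-! ### The search for a smallest vertex cover -/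

section Cover

variable {l N n c : ℕ} {inp : ℕ → ℤ} {σ : St}

/-- The digits of `w` in base `2`. -/
def bits (w i : ℕ) : ℕ := w / 2 ^ i % 2

theorem runs_branchLoop (hl : 1 ≤ l) (hnN : n + 1 ≤ N) (hcN : c ≤ N) (hNl : (N : ℤ) ≤ 2 ^ l)
    (hσ : Ctx n c inp σ) {k w K : ℕ} (hk : σ.ρ .vkk = k) (hkN : k ≤ N) (hK : σ.ρ .vK = K)
    (hKN : K ≤ N) (hbits : ∀ i < k, σ.α 4 i = bits w i) {R : St → Prop}
    (hR : ∀ σ', St.Same [.vfu, .vfv, .vt] [1] σ σ' → σ'.ρ .vt = k →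
      (∃ S : ℕ → ℕ, (∀ i < k, σ'.α 1 i = S i) ∧
        (range k).image S = branch n (inAdj inp n) (bits w) k) → R σ') :
    Runs l (cfor .vt .vkk branchStep) σ (k * (3 * W N + 18) + 11) R := by
  refine Runs.loop (Y := k) hl (by decide) hk (fun i σ' => St.Same [.vfu, .vfv, .vt] [1] σ σ' ∧
    ∃ S : ℕ → ℕ, (∀ j < i, σ'.α 1 j = S j) ∧
      (range i).image S = branch n (inAdj inp n) (bits w) i) ?_ ?_ ?_
  · exact ⟨(St.Same.refl _ _ σ).set _ (by decide), fun _ => 0, by simp, by simp [branch]⟩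
  · rintro t ht σ' ⟨hS, S, hSα, hSC⟩ hσt hσk
    have hctx := hσ.same hS (by decide) (by decide)
    have hK' : σ'.ρ .vK = K := (hS.1 _ (by decide)).trans hK
    have hlim := hctx.lim (by omega) hcN hK' hKN hσk hkN hσt (by omega)
    set C := branch n (inAdj inp n) (bits w) t with hC
    have hmem : ∀ x : ℕ, x ∈ C ↔ ∃ i < t, σ'.α 1 i = x := by
      intro x
      rw [← hSC]
      simp only [mem_image, mem_range]
      refine exists_congr fun i => and_congr_right fun hi => ?_
      rw [hSα i hi]; norm_cast
    have hU : firstU n (inAdj inp n) C ≤ n := firstIdx_le _ _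
    have hV : firstV n (inAdj inp n) C ≤ n := firstIdx_le _ _
    have hb : σ'.α 4 t = bits w t := by rw [hS.2 4 (by decide), hbits t ht]
    refine Runs.mono (Runs.seq (Runs.set_W (N := N) (v := firstU n (inAdj inp n) C) hl (by decide)
      (by decide) (by decide) hlim ?_ (abs_nat_le (by omega))
      (Runs.seq (Runs.set_W (N := N) (v := firstV n (inAdj inp n) C) hl (by decide) (by decide)
        (by decide) ?_ ?_ (abs_nat_le (by omega))
        (Runs.store_W (N := N) (k := t) (v := ((if bits w t = 0 then firstU n (inAdj inp n) C else
          firstV n (inAdj inp n) C : ℕ) : ℤ)) hl (by decide) (by decide) (by decide) (by decide)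
          (by decide) (by decide) ?_ ?_ (by omega) ?_ (abs_nat_le ?_) ?_))))) ?_ fun _ h => h
    · rw [← hctx.hinp]
      exact eval_firstUE hctx.hn hσt hmem
    · exact (hctx.same ((St.Same.refl [.vfu] [] _).set _ (by decide)) (by decide) (by decide)).lim
        (by omega) hcN (by simpa using hK') hKN (by simpa using hσk) hkN (by simpa using hσt)
        (by omega)
    · have := eval_firstVE (α := σ'.α) (ρ := (σ'.set .vfu (firstU n (inAdj inp n) C)).ρ) (n := n)
        (t := t) (C := C) (by simp [hctx.hn]) (by simp [hσt]) hmem (by simp [hctx.hinp])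
      rw [hctx.hinp] at this
      exact this
    · exact (hctx.same (((St.Same.refl [.vfu, .vfv] [] _).set _ (by decide)).set _ (by decide))
        (by decide) (by decide)).lim
        (by omega) hcN (by simpa using hK') hKN (by simpa using hσk) hkN (by simpa using hσt)
        (by omega)
    · simp [hσt]
    · simp only [eval_add, eval_var, St.set_ρ, reduceCtorEq, if_false, if_true, eval_mul, eval_load,
        St.set_α, eval_sub, hσt, Int.toNat_natCast, hb]
      have : bits w t < 2 := Nat.mod_lt _ (by norm_num)
      interval_cases hbt : bits w t <;> simp
    · split_ifs <;> omega
    · refine ⟨by simp [hσt], by simp [hσk], ?_, ?_⟩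
      · exact ((((hS.set _ (by decide)).set _ (by decide)).store _ _ (by decide)).set _ (by decide))
      · set v := if bits w t = 0 then firstU n (inAdj inp n) C else firstV n (inAdj inp n) C with hv
        refine ⟨Function.update S t v, ?_, ?_⟩
        · intro j hj
          simp only [St.set_α, St.store_α, true_and, Function.update_apply]
          split_ifs with hjt
          · rfl
          · exact hSα j (by omega)
        · rw [range_add_one, image_insert, branch, Function.update_self, ← hC, ← hv, ← hSC]
          congr 1
          refine image_congr fun j hj => ?_
          have : j ≠ t := by have := mem_range.1 hj; omega
          simp [this]
    · omega
  · rintro σ' ⟨hS, h⟩ ht _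
    exact hR σ' hS ht h

/-- A vertex cover has been found. -/
def Found (n : ℕ) (adj : ℕ → ℕ → Prop) (k : ℕ) (σ : St) : Prop :=
  σ.ρ .vfnd = 1 ∧ σ.ρ .vK = k ∧
    ∃ S : ℕ → ℕ, (∀ i < k, σ.α 1 i = S i) ∧ Covers n adj ((range k).image S)

theorem Found.same {adj : ℕ → ℕ → Prop} {k : ℕ} {σ' : St} {X : List Var} {A : List ℕ}
    (h : Found n adj k σ) (hS : St.Same X A σ σ') (h1 : Var.vfnd ∉ X) (h2 : Var.vK ∉ X)
    (h3 : 1 ∉ A) : Found n adj k σ' := by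
  unfold Found
  rw [hS.1 _ h1, hS.1 _ h2, hS.2 _ h3]
  exact h

/-- State of the search for a vertex cover of size `k` after `w` attempts. -/
def Searched (n : ℕ) (adj : ℕ → ℕ → Prop) (k w : ℕ) (σ : St) : Prop :=
  (σ.ρ .vfnd = 0 ∧ (∃ K : ℕ, K ≤ n ∧ σ.ρ .vK = K) ∧
    ∀ w' < w, ¬ Covers n adj (branch n adj (bits w') k)) ∨ Found n adj k σ

theorem Searched.exists_K {adj : ℕ → ℕ → Prop} {k w : ℕ} (h : Searched n adj k w σ) (hk : k ≤ n) :
    ∃ K : ℕ, K ≤ n ∧ σ.ρ .vK = K := by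
  rcases h with h | h
  · exact h.2.1
  · exact ⟨k, hk, h.2.1⟩

def coverVars : List Var := [.vy, .vdv, .vt, .vfu, .vfv, .vfnd, .vK]

/-- All steps are polynomial except the extraction of the bits of `w < 2 ^ k`, which brings the
factor `2 ^ k`. Over all `2 ^ k` attempts the search for one size costs about `4 ^ k`. -/
theorem runs_coverTry (hl : 1 ≤ l) (hnN : n + 1 ≤ N) (hcN : c ≤ N) (hNl : (N : ℤ) ≤ 2 ^ l)
    (hσ : Ctx n c inp σ) {k w : ℕ} (hk : σ.ρ .vkk = k) (hkn : k ≤ n)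
    (hw : σ.ρ .vw = w) (hwk : w < 2 ^ k) (hwl : ((2 ^ k : ℕ) : ℤ) ≤ 2 ^ l) {t : ℕ}
    (ht : σ.ρ .vt = t) (htN : t ≤ N)
    (hJ : Searched n (inAdj inp n) k w σ) {R : St → Prop}
    (hR : ∀ σ', St.Same coverVars [1, 4] σ σ' → (∃ t : ℕ, t ≤ N ∧ σ'.ρ .vt = t) →
      Searched n (inAdj inp n) k (w + 1) σ' → R σ') :
    Runs l coverTry σ (10 * W N * (N + 1) * 2 ^ k) R := by
  obtain ⟨K, hKn, hK⟩ := hJ.exists_K hkn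
  have hlim := hσ.lim (by omega) hcN hK (by omega) hk (by omega) ht htN
  have hP : 1 ≤ 2 ^ k := Nat.one_le_two_pow
  have hWN := le_W N
  refine Runs.mono (Runs.cond_W (N := N)
    (T := 400 * (k + 1) * (w + 1) + ((k * (3 * W N + 18) + 11) + (W N + (W N + W N)))) hl
    (by decide) (by decide) (by decide) hlim ?_ ?_) ?_ fun _ h => h
  · intro h0
    have hf : σ.ρ .vfnd = 0 := by simpa using h0
    have hJ' := hJ.resolve_right fun h => by rw [h.1] at hf; norm_num at hf
    refine Runs.seq (runs_digits hl (by decide) (by decide) hw hk hσ.htwo (by omega) (by omega)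
      (by omega) fun σ₁ hS₁ _ hd => ?_)
    have hctx₁ := hσ.same hS₁ (by decide) (by decide)
    have hk₁ : σ₁.ρ .vkk = k := (hS₁.1 _ (by decide)).trans hk
    have hK₁ : σ₁.ρ .vK = K := (hS₁.1 _ (by decide)).trans hK
    refine Runs.seq (runs_branchLoop hl hnN hcN hNl hctx₁ hk₁ (by omega) hK₁ (by omega)
      (w := w) hd fun σ₂ hS₂ ht₂ hS => ?_)
    have hctx₂ := hctx₁.same hS₂ (by decide) (by decide)
    have hk₂ : σ₂.ρ .vkk = k := (hS₂.1 _ (by decide)).trans hk₁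
    have hK₂ : σ₂.ρ .vK = K := (hS₂.1 _ (by decide)).trans hK₁
    have hlim₂ := hctx₂.lim (by omega) hcN hK₂ (by omega) hk₂ (by omega) ht₂ (by omega)
    have hS₁₂ : St.Same coverVars [1, 4] σ σ₂ :=
      (hS₁.mono (by decide) (by decide)).trans (hS₂.mono (by decide) (by decide))
    obtain ⟨S, hSα, hSC⟩ := hS
    have hcov := eval_coversE (α := σ₂.α) hctx₂.hn hk₂ (C := branch n (inAdj inp n) (bits w) k) (by
      intro x
      rw [← hSC]
      simp only [mem_image, mem_range]
      refine exists_congr fun i => and_congr_right fun hi => ?_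
      rw [hSα i hi]; norm_cast)
    rw [hctx₂.hinp] at hcov
    refine Runs.cond_W hl (by decide) (by decide) (by decide) hlim₂ (fun h1 => ?_) (fun h1 => ?_)
    · refine Runs.seq (Runs.set_W (v := 1) hl (by decide) (by decide) (by decide) hlim₂ rfl
        (abs_nat_le (a := 1) (by omega)) (Runs.set_W (v := k) hl (by decide) (by decide) (by decide)
        ?_ (by simpa using hk₂) (abs_nat_le (by omega)) ?_))
      · exact (hctx₂.same ((St.Same.refl [.vfnd] [] _).set _ (by decide)) (by decide)
          (by decide)).lim (by omega) hcN (by simpa using hK₂) (by omega) (by simpa using hk₂)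
          (by omega) (by simpa using ht₂) (by omega)
      · refine hR _ ((hS₁₂.set _ (by decide)).set _ (by decide))
          ⟨k, by omega, by simpa using ht₂⟩ (Or.inr ⟨by simp, by simp, S, by simpa using hSα, ?_⟩)
        rw [hSC]; exact hcov.1 h1
    · refine (Runs.skip hl (hR _ hS₁₂ ⟨k, by omega, ht₂⟩ (Or.inl ⟨?_, ⟨K, hKn, hK₂⟩, ?_⟩))).mono
        (by omega) fun _ h => h
      · rw [hS₂.1 _ (by decide), hS₁.1 _ (by decide), hf]
      · intro w' hw'
        rcases Nat.lt_succ_iff_lt_or_eq.1 hw' with h | rfl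
        · exact hJ'.2.2 w' h
        · exact fun h => hcov.2 h h1
  · intro h0
    refine (Runs.skip hl (hR _ (St.Same.refl _ _ _) ⟨t, htN, ht⟩ (Or.inr ?_))).mono
      (by omega) fun _ h => h
    refine hJ.resolve_left fun h => ?_
    simp [h.1] at h0
  · have h1 : 400 * (k + 1) * (w + 1) ≤ W N * 2 ^ k := by
      refine Nat.mul_le_mul ?_ (by omega)
      exact le_trans (by omega) hWN
    have h2 : k * (3 * W N + 18) + 11 ≤ 4 * W N * (N + 1) := by
      have : k * (3 * W N + 18) ≤ N * (4 * W N) := Nat.mul_le_mul (by omega) (by omega)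
      nlinarith
    have h3 : W N * 2 ^ k ≤ W N * (N + 1) * 2 ^ k :=
      Nat.mul_le_mul_right _ (Nat.le_mul_of_pos_right _ (by omega))
    have h4 : W N * (N + 1) ≤ W N * (N + 1) * 2 ^ k := Nat.le_mul_of_pos_right _ hP
    have h5 : W N ≤ W N * (N + 1) := Nat.le_mul_of_pos_right _ (by omega)
    calc _ ≤ W N * (N + 1) * 2 ^ k + 8 * (W N * (N + 1) * 2 ^ k) := by nlinarith
      _ ≤ _ := by nlinarith

def sizeVars : List Var := .vp :: .vw :: coverVars

theorem runs_coverSize (hl : 1 ≤ l) (hnN : n + 1 ≤ N) (hcN : c ≤ N) (hNl : (N : ℤ) ≤ 2 ^ l)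
    (hσ : Ctx n c inp σ) {k K : ℕ} (hk : σ.ρ .vkk = k) (hkn : k ≤ n) (hK : σ.ρ .vK = K)
    (hKn : K ≤ n) (hkl : ∀ i ≤ k, ((2 ^ i : ℕ) : ℤ) ≤ 2 ^ l) {t : ℕ}
    (ht : σ.ρ .vt = t) (htN : t ≤ N) (hf : σ.ρ .vfnd = 0) {R : St → Prop}
    (hR : ∀ σ', St.Same sizeVars [1, 4] σ σ' → (∃ t : ℕ, t ≤ N ∧ σ'.ρ .vt = t) →
      Searched n (inAdj inp n) k (2 ^ k) σ' → R σ') :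
    Runs l coverSize σ (14 * W N * (N + 1) * 4 ^ k) R := by
  have hlim := hσ.lim (by omega) hcN hK (by omega) hk (by omega) ht htN
  have hP : 1 ≤ 2 ^ k := Nat.one_le_two_pow
  have hWN := le_W N
  refine Runs.mono (Runs.cond_W (N := N)
    (T := 100 * (k + 1) + (2 ^ k * (10 * W N * (N + 1) * 2 ^ k + 18) + 11)) hl
    (by decide) (by decide) (by decide) hlim (fun _ => ?_) ?_) ?_ fun _ h => h
  · refine Runs.seq (runs_power hl (by decide) (by decide) (by decide) hk hσ.htwo hkl
      fun σ₁ hS₁ ht₁ hp => ?_)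
    have hctx₁ := hσ.same hS₁ (by decide) (by decide)
    refine Runs.loop (Y := 2 ^ k) hl (by decide) hp (fun w σ' => St.Same sizeVars [1, 4] σ σ' ∧
      (∃ t : ℕ, t ≤ N ∧ σ'.ρ .vt = t) ∧ Searched n (inAdj inp n) k w σ') ?_ ?_ ?_
    · refine ⟨(hS₁.mono (by decide) (by decide)).set _ (by decide), ⟨k, by omega, by simpa using ht₁⟩,
        Or.inl ⟨?_, ⟨K, hKn, ?_⟩, by simp⟩⟩
      · simp [hS₁.1 .vfnd (by decide), hf]
      · simp [hS₁.1 .vK (by decide), hK]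
    · rintro w hw σ' ⟨hS, ⟨t', ht'N, ht'⟩, hJ⟩ hσw hσp
      refine runs_coverTry hl hnN hcN hNl (hσ.same hS (by decide) (by decide))
        ((hS.1 _ (by decide)).trans hk) hkn hσw hw (hkl k le_rfl) ht' ht'N hJ
        fun σ'' hS' ht'' hJ' => ?_
      refine ⟨(hS'.1 _ (by decide)).trans hσw, (hS'.1 _ (by decide)).trans hσp,
        (hS.trans (hS'.mono (by decide) (by decide))).set _ (by decide), by simpa using ht'', ?_⟩
      rcases hJ' with ⟨h1, h2, h3⟩ | h
      · exact Or.inl ⟨by simpa using h1, by simpa using h2, h3⟩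
      · exact Or.inr (h.same ((St.Same.refl [.vw] [] _).set _ (by decide)) (by decide) (by decide)
          (by decide))
    · rintro σ' ⟨hS, ht', hJ⟩ _ _
      exact hR σ' hS ht' hJ
  · intro h0
    simp [hf] at h0
  · have h4 : (4 : ℕ) ^ k = 2 ^ k * 2 ^ k := by rw [← mul_pow]; norm_num
    rw [h4]
    have h1 : 100 * (k + 1) ≤ W N := by omega
    have h2 : W N * 1 ≤ W N * ((N + 1) * (2 ^ k * 2 ^ k)) :=
      Nat.mul_le_mul_left _ (Nat.mul_pos (by omega) (Nat.mul_pos hP hP))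
    have h3 : 2 ^ k * 1 ≤ 2 ^ k * (W N * ((N + 1) * 2 ^ k)) :=
      Nat.mul_le_mul_left _ (Nat.mul_pos (by omega) (Nat.mul_pos (by omega) hP))
    have h5 : 18 * 2 ^ k + 11 ≤ W N * ((N + 1) * (2 ^ k * 2 ^ k)) := by
      have : 2 ^ k * 20000 ≤ W N * ((N + 1) * (2 ^ k * 2 ^ k)) := by
        calc 2 ^ k * 20000 ≤ 2 ^ k * (W N * ((N + 1) * 2 ^ k)) := by
              refine Nat.mul_le_mul_left _ ?_
              exact (show 20000 ≤ W N by omega).trans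
                (Nat.le_mul_of_pos_right _ (Nat.mul_pos (by omega) hP))
          _ = _ := by ring
      omega
    nlinarith

/-- The search ends with a vertex cover of size `τ`, the minimum. -/
theorem runs_coverSearch (hl : 1 ≤ l) (hnN : n + 1 ≤ N) (hcN : c ≤ N) (hNl : (N : ℤ) ≤ 2 ^ l)
    (hσ : Ctx n c inp σ) {K t τ : ℕ} (hK : σ.ρ .vK = K) (hKn : K ≤ n)
    (hf : σ.ρ .vfnd = 0) (ht : σ.ρ .vt = t) (htN : t ≤ N) (hτn : τ ≤ n)
    (hτl : ∀ i ≤ τ, ((2 ^ i : ℕ) : ℤ) ≤ 2 ^ l)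
    (hτ1 : ∃ D : Finset ℕ, Covers n (inAdj inp n) D ∧ #D = τ)
    (hτ2 : ∀ D : Finset ℕ, D ⊆ range n → Covers n (inAdj inp n) D → τ ≤ #D) {R : St → Prop}
    (hR : ∀ σ', St.Same (.vkk :: sizeVars) [1, 4] σ σ' → (∃ t : ℕ, t ≤ N ∧ σ'.ρ .vt = t) →
      (∃ k : ℕ, k ≤ N ∧ σ'.ρ .vkk = k) → Found n (inAdj inp n) τ σ' → R σ') :
    Runs l coverSearch σ (16 * W N * (N + 1) ^ 2 * 4 ^ τ) R := by
  have hWN := le_W N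
  -- No success below the minimum: a list of `k` entries that covers contains a cover with at most
  -- `k` vertices.
  have hfound : ∀ k ≤ τ, ∀ σ', Found n (inAdj inp n) k σ' → k = τ := by
    rintro k hk σ' ⟨_, _, S, _, hS⟩
    have h1 := hτ2 (((range k).image S).filter (· < n)) (by
      intro x hx
      simp only [mem_filter] at hx
      exact mem_range.2 hx.2) (by
      intro u hu v hv e
      rcases hS u hu v hv e with h | h
      · exact Or.inl (mem_filter.2 ⟨h, hu⟩)
      · exact Or.inr (mem_filter.2 ⟨h, hv⟩))
    have h2 := card_le_card (filter_subset (· < n) ((range k).image S))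
    have h3 := card_image_le (s := range k) (f := S)
    rw [card_range] at h3
    omega
  -- No failure at the minimum: the bits given by a smallest cover are the binary digits of some `w
  -- < 2 ^ τ`.
  have hall : ¬ ∀ w < 2 ^ τ, ¬ Covers n (inAdj inp n) (branch n (inAdj inp n) (bits w) τ) := by
    intro h
    obtain ⟨D, hD, rfl⟩ := hτ1
    obtain ⟨g, hg, hc⟩ := exists_branch hD
    obtain ⟨w, hw, hwg⟩ := exists_digits (k := #D) g fun i _ => hg i
    exact h w hw (by rwa [branch_congr (bits := bits w) (bits' := g) hwg])
  refine Runs.mono (Runs.loop (Y := n + 1) (T := 14 * W N * (N + 1) * 4 ^ τ + W N + 1) hl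
    (by decide) hσ.hn1
    (fun k σ' => St.Same (.vkk :: sizeVars) [1, 4] σ σ' ∧ (∃ t : ℕ, t ≤ N ∧ σ'.ρ .vt = t) ∧
      ((σ'.ρ .vfnd = 0 ∧ k ≤ τ ∧ ∃ K : ℕ, K ≤ n ∧ σ'.ρ .vK = K) ∨
        Found n (inAdj inp n) τ σ')) ?_ ?_ ?_) ?_ fun _ h => h
  · exact ⟨(St.Same.refl _ _ _).set _ (by decide), ⟨t, htN, by simpa using ht⟩,
      Or.inl ⟨by simpa using hf, by omega, K, hKn, by simpa using hK⟩⟩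
  · rintro k hk σ' ⟨hS, ⟨t', ht'N, ht'⟩, hJ⟩ hσk hσn
    have hctx := hσ.same hS (by decide) (by decide)
    rcases hJ with ⟨hf', hkτ, K', hK'n, hK'⟩ | hF
    · refine (runs_coverSize hl hnN hcN hNl hctx hσk (by omega) hK' hK'n
        (fun i hi => hτl i (by omega)) ht' ht'N hf' fun σ'' hS' ht'' hJ' => ?_).mono ?_ fun _ h => h
      · refine ⟨(hS'.1 _ (by decide)).trans hσk, (hS'.1 _ (by decide)).trans hσn,
          (hS.trans (hS'.mono (by decide) (by decide))).set _ (by decide), by simpa using ht'', ?_⟩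
        rcases hJ' with ⟨h1, h2, h3⟩ | h
        · have : k ≠ τ := fun e => hall (e ▸ h3)
          exact Or.inl ⟨by simpa using h1, by omega, by simpa using h2⟩
        · obtain rfl := hfound k hkτ _ h
          exact Or.inr (h.same ((St.Same.refl [.vkk] [] _).set _ (by decide)) (by decide)
            (by decide) (by decide))
      · have : 14 * W N * (N + 1) * 4 ^ k ≤ 14 * W N * (N + 1) * 4 ^ τ :=
          Nat.mul_le_mul_left _ (Nat.pow_le_pow_right (by norm_num) hkτ)
        omega
    · have hlim := hctx.lim (by omega) hcN hF.2.1 (by omega) hσk (by omega) ht' ht'N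
      refine (Runs.cond_W hl (by decide) (by decide) (by decide) hlim (fun h0 => ?_)
        fun _ => Runs.skip hl ?_).mono (by omega) fun _ h => h
      · simp [hF.1] at h0
      · exact ⟨hσk, hσn, hS.set _ (by decide), ⟨t', ht'N, by simpa using ht'⟩,
          Or.inr (hF.same ((St.Same.refl [.vkk] [] _).set _ (by decide)) (by decide) (by decide)
            (by decide))⟩
  · rintro σ' ⟨hS, ht', hJ⟩ hσk _
    refine hR σ' hS ht' ⟨n + 1, hnN, hσk⟩ (hJ.resolve_left fun h => ?_)
    -- The loop ends with the counter at `n + 1 > τ`, so the alternative "not found and counter at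
    -- most `τ`" is impossible.
    omega
  · have hP : 1 ≤ 4 ^ τ := Nat.one_le_pow _ _ (by norm_num)
    have h1 : W N * 1 ≤ W N * ((N + 1) * 4 ^ τ) :=
      Nat.mul_le_mul_left _ (Nat.mul_pos (by omega) hP)
    have h2 : (n + 1) * (14 * W N * (N + 1) * 4 ^ τ + W N + 1 + 18) ≤
        N * (14 * W N * (N + 1) * 4 ^ τ + W N + 1 + 18) := Nat.mul_le_mul_right _ hnN
    have h3 : 14 * W N * (N + 1) * 4 ^ τ + W N + 1 + 18 ≤ 16 * W N * (N + 1) * 4 ^ τ := by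
      nlinarith
    have h4 := Nat.mul_le_mul_left N h3
    have h5 : 11 ≤ 16 * W N * (N + 1) * 4 ^ τ := by omega
    calc _ ≤ N * (16 * W N * (N + 1) * 4 ^ τ) + 16 * W N * (N + 1) * 4 ^ τ := by omega
      _ = _ := by ring

end Cover
end BudgetedColoring

namespace BudgetedColoring

open Finset RAM RAM.SExpr

/-! ### The search for the classes -/

section Congr

variable {n c K : ℕ} {adj : ℕ → ℕ → Prop} {b : ℕ → ℤ} {s g g' pk pk' : ℕ → ℕ}

theorem best_congr {t : ℕ} (h : ∀ a < t, pk a = pk' a) (j : ℕ) :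
    Best c K b g pk t j ↔ Best c K b g pk' t j := by
  have : ∀ j, Cand K b g pk t j ↔ Cand K b g pk' t j := fun j => by
    unfold Cand
    refine and_congr_right fun _ => and_congr_right fun _ => forall₂_congr fun a ha => ?_
    rw [h a ha]
  unfold Best
  simp only [this]

theorem sz_congr (h : ∀ a < K, g a = g' a) : sz K g = sz K g' := by
  funext i
  unfold sz
  congr 1
  exact filter_congr fun a ha => by rw [h a (mem_range.1 ha)]

theorem Greedy.congr (h : ∀ a < K, g a = g' a) (hp : Greedy c K b g pk) :
    Greedy c K b g' pk := by
  unfold Greedy Best Cand at *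
  rwa [← sz_congr h]

theorem Good.congr (h : ∀ a < K, g a = g' a) (hG : Good n c K adj b s g pk) :
    Good n c K adj b s g' pk where
  proper i hi j hj e := hG.proper i hi j hj (by rwa [h i hi, h j hj])
  picked := by rw [← sz_congr h]; exact hG.picked
  fits Z := by
    classical
    have := hG.fits Z
    unfold Fits at *
    rw [← sz_congr h]
    convert this using 3
    congr 1
    refine filter_congr fun v _ => and_congr_right fun _ => forall₂_congr fun j _ =>
      imp_congr_right fun _ => exists_congr fun a => and_congr_right fun ha => ?_
    rw [h a ha]

theorem fits_congr {Z Z' : ℕ → Prop} (h : ∀ j < K, Z j ↔ Z' j)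
    (hF : Fits n c K adj b s g pk Z) : Fits n c K adj b s g pk Z' := by
  classical
  unfold Fits at *
  convert hF using 2
  · congr 2
    refine filter_congr fun v _ => and_congr_right fun _ => forall₂_congr fun j hj => ?_
    rw [h j hj]
  · refine sum_congr rfl fun j hj => ?_
    simp only [h j (mem_range.1 hj)]

/-- The inequality for `Z` depends only on the values of `Z` below `K`, so the `2 ^ K` bit masks
exhaust all cases. -/
theorem good_iff : Good n c K adj b s g pk ↔
    ((∀ i < K, ∀ j < K, g i = g j → ¬ adj (s i) (s j)) ∧ ∀ i < K, 0 < sz K g i → pk i < c) ∧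
      ∀ z < 2 ^ K, Fits n c K adj b s g pk fun j => bits z j = 1 := by
  classical
  refine ⟨fun h => ⟨⟨h.proper, h.picked⟩, fun z _ => h.fits _⟩, fun h => ⟨h.1.1, h.1.2, fun Z => ?_⟩⟩
  obtain ⟨z, hz, hzZ⟩ := exists_digits (q := 2) (k := K) (fun j => if Z j then 1 else 0)
    fun i _ => by split_ifs <;> omega
  refine fits_congr (fun j hj => ?_) (h.2 z hz)
  rw [bits, hzZ j hj]
  simp

end Congr

/-- The `2 ^ k` masks, each decoded at cost about `2 ^ k`, stay within the budget `k ^ k` of one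
round. The factor `4` is needed for small `k`. -/
theorem four_pow_le (k : ℕ) : 4 ^ k ≤ 4 * k ^ k := by
  rcases lt_or_ge k 4 with h | h
  · interval_cases k <;> norm_num
  · exact (Nat.pow_le_pow_left h k).trans (by omega)

theorem one_le_self_pow (k : ℕ) : 1 ≤ k ^ k := by
  rcases Nat.eq_zero_or_pos k with rfl | h
  · simp
  · exact Nat.one_le_pow _ _ h

/-- The input parameters and the vertex cover. -/
structure Core (n c K k : ℕ) (inp : ℕ → ℤ) (s : ℕ → ℕ) (σ : St) : Prop where
  ctx : Ctx n c inp σ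
  hK : σ.ρ .vK = K
  hkk : σ.ρ .vkk = k
  hs : ∀ i < K, σ.α 1 i = s i

theorem Core.same {n c K k : ℕ} {inp : ℕ → ℤ} {s : ℕ → ℕ} {σ σ' : St} {X : List Var} {A : List ℕ}
    (h : Core n c K k inp s σ) (hS : St.Same X A σ σ')
    (hX : ∀ x ∈ [Var.vn, .vc, .vn1, .vtwo, .vK, .vkk], x ∉ X) (hA : 0 ∉ A ∧ 1 ∉ A) :
    Core n c K k inp s σ' where
  ctx := h.ctx.same hS (fun x hx => hX x (by
    simp only [List.mem_cons, List.not_mem_nil, or_false] at hx ⊢; tauto)) hA.1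
  hK := (hS.1 _ (hX _ (by decide))).trans h.hK
  hkk := (hS.1 _ (hX _ (by decide))).trans h.hkk
  hs i hi := by rw [hS.2 _ hA.2]; exact h.hs i hi

section Classes

variable {l N n c K k : ℕ} {inp : ℕ → ℤ} {s : ℕ → ℕ} {σ : St}

/-- The digits of `x` in base `K`. -/
def cls (K x i : ℕ) : ℕ := x / K ^ i % K

theorem Core.lim (h : Core n c K k inp s σ) (hn : n ≤ N) (hc : c ≤ N) (hK : K ≤ N) (hk : k ≤ N)
    {t : ℕ} (ht : σ.ρ .vt = t) (htN : t ≤ N) : Lim N σ :=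
  h.ctx.lim hn hc h.hK hK h.hkk hk ht htN

theorem runs_picks (hl : 1 ≤ l) (hnN : n ≤ N) (hcN : c ≤ N) (hKN : K ≤ N) (hkN : k ≤ N)
    (hNl : (N : ℤ) ≤ 2 ^ l) (hσ : Core n c K k inp s σ) {g : ℕ → ℕ}
    (hg : ∀ i < K, σ.α 2 i = g i) {R : St → Prop}
    (hR : ∀ σ', St.Same [.vt] [3] σ σ' → σ'.ρ .vt = K → ∀ pk : ℕ → ℕ,
      (∀ i < K, σ'.α 3 i = pk i) → Greedy c K (inBud inp n) g pk → R σ') :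
    Runs l (cfor .vt .vK (cstore 3 (var .vt) pickE)) σ (K * (W N + 18) + 11) R := by
  refine Runs.loop (Y := K) hl (by decide) hσ.hK (fun t σ' => St.Same [.vt] [3] σ σ' ∧
    ∃ pk : ℕ → ℕ, (∀ i < t, σ'.α 3 i = pk i) ∧
      ∀ i < t, pk i = firstIdx c (Best c K (inBud inp n) g pk i)) ?_ ?_ ?_
  · exact ⟨(St.Same.refl _ _ σ).set _ (by decide), fun _ => 0, by simp, by simp⟩
  · rintro t ht σ' ⟨hS, pk, hpk, hgr⟩ hσt hσK
    have hcore := hσ.same hS (by decide) (by decide)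
    have hv : firstIdx c (Best c K (inBud inp n) g pk t) ≤ c := firstIdx_le _ _
    refine Runs.store_W (k := t) (v := firstIdx c (Best c K (inBud inp n) g pk t)) hl (by decide)
      (by decide) (by decide) (by decide) (by decide) (by decide)
      (hcore.lim hnN hcN hKN hkN hσt (by omega)) hσt (by omega) ?_ (abs_nat_le (by omega)) ?_
    · rw [← hcore.ctx.hinp]
      exact eval_pickE hcore.ctx.hn hcore.ctx.hc hσK hσt
        (fun a ha => by rw [hS.2 2 (by decide), hg a ha]) hpk
    · refine ⟨by simpa using hσt, by simpa using hσK, (hS.store _ _ (by decide)).set _ (by decide),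
        Function.update pk t (firstIdx c (Best c K (inBud inp n) g pk t)), ?_, ?_⟩
      · intro i hi
        simp only [St.set_α, St.store_α, true_and, Function.update_apply]
        split_ifs with hit
        · rfl
        · exact hpk i (by omega)
      · intro i hi
        have : Best c K (inBud inp n) g (Function.update pk t
            (firstIdx c (Best c K (inBud inp n) g pk t))) i = Best c K (inBud inp n) g pk i := by
          funext j
          refine propext (best_congr (fun a ha => ?_) j)
          rw [Function.update_of_ne (by omega)]
        rw [this, Function.update_apply]
        split_ifs with hit
        · rw [hit]
        · exact hgr i (by omega)
  · rintro σ' ⟨hS, pk, hpk, hgr⟩ hσt _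
    exact hR σ' hS hσt pk hpk hgr

theorem runs_fitsTry (hl : 1 ≤ l) (hnN : n ≤ N) (hcN : c ≤ N) (hKN : K ≤ N) (hkN : k ≤ N)
    (hNl : (N : ℤ) ≤ 2 ^ l) (hσ : Core n c K k inp s σ) {g pk : ℕ → ℕ}
    (hg : ∀ i < K, σ.α 2 i = g i) (hpk : ∀ i < K, σ.α 3 i = pk i) {z : ℕ} (hz : σ.ρ .vz = z)
    (hzK : z < 2 ^ K) (hKl : ((2 ^ K : ℕ) : ℤ) ≤ 2 ^ l) {P : Prop} (hok : σ.ρ .vok = ind P)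
    {R : St → Prop}
    (hR : ∀ σ', St.Same [.vy, .vdv, .vt, .vok] [4] σ σ' → σ'.ρ .vt = K →
      σ'.ρ .vok = ind (P ∧ Fits n c K (inAdj inp n) (inBud inp n) s g pk fun j => bits z j = 1) →
      R σ') :
    Runs l fitsTry σ (2 * W N * 2 ^ K) R := by
  have hWN := le_W N
  refine Runs.mono (Runs.seq (runs_digits hl (by decide) (by decide) hz hσ.hK hσ.ctx.htwo (by omega)
    (by omega) (by omega) fun σ₁ hS₁ ht₁ hd => ?_)) (T := 400 * (K + 1) * (z + 1) + W N) ?_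
    fun _ h => h
  · have hcore := hσ.same hS₁ (by decide) (by decide)
    have hfit := eval_fitsE (α := σ₁.α) (Z := fun j => bits z j = 1) hcore.ctx.hn hcore.ctx.hc
      hcore.hK hcore.hs (fun a ha => by rw [hS₁.2 2 (by decide), hg a ha])
      (fun a ha => by rw [hS₁.2 3 (by decide), hpk a ha]) (fun a ha => by
        rw [hd a ha]
        have : bits z a < 2 := Nat.mod_lt _ (by norm_num)
        change ((bits z a : ℕ) : ℤ) = _
        interval_cases bits z a <;> simp [ind])
    rw [hcore.ctx.hinp] at hfit
    refine Runs.set_W hl (by decide) (by decide) (by decide)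
      (hcore.lim hnN hcN hKN hkN ht₁ hKN) ?_ (abs_ind_le_pow _)
      (hR _ ((hS₁.mono (by decide) (by decide)).set _ (by decide)) (by simpa using ht₁)
        (by simp; rfl))
    rw [eval_and, hfit, eval_var, hS₁.1 .vok (by decide), hok, ind_ne_zero]
  · have h1 : 400 * (K + 1) * (z + 1) ≤ W N * 2 ^ K :=
      Nat.mul_le_mul (le_trans (by omega) hWN) (by omega)
    have h2 : W N ≤ W N * 2 ^ K := Nat.le_mul_of_pos_right _ Nat.one_le_two_pow
    nlinarith

def tryVars : List Var := [.vy, .vdv, .vt, .vok, .vz, .vans]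

/-- Decoding `x < K ^ K` in base `K` costs about `K ^ K`, the loop over the masks about `4 ^ K`, and
the rest is polynomial. -/
theorem runs_classTry (hl : 1 ≤ l) (hnN : n ≤ N) (hcN : c ≤ N) (hKN : K ≤ N) (hkN : k ≤ N)
    (hNl : (N : ℤ) ≤ 2 ^ l) (hσ : Core n c K k inp s σ) {x : ℕ} (hx : σ.ρ .vx = x)
    (hxK : x < K ^ K) (hKl : ((K ^ K : ℕ) : ℤ) ≤ 2 ^ l) (hp2 : σ.ρ .vp2 = (2 ^ K : ℕ))
    (h2l : ((2 ^ K : ℕ) : ℤ) ≤ 2 ^ l) {R : St → Prop}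
    (hR : ∀ σ', St.Same tryVars [2, 3, 4] σ σ' → (∃ t : ℕ, t ≤ N ∧ σ'.ρ .vt = t) →
      ∀ pk, Greedy c K (inBud inp n) (cls K x) pk →
      (Good n c K (inAdj inp n) (inBud inp n) s (cls K x) pk → σ'.ρ .vans = 1) →
      (¬ Good n c K (inAdj inp n) (inBud inp n) s (cls K x) pk → σ'.ρ .vans = σ.ρ .vans) →
      R σ') :
    Runs l classTry σ (60 * W N * (N + 1) * K ^ K) R := by
  have hWN := le_W N
  refine Runs.mono (T := 400 * (K + 1) * (x + 1) + ((K * (W N + 18) + 11) + (W N +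
    ((2 ^ K * (2 * W N * 2 ^ K + 18) + 11) + (W N + W N)))))
    (Runs.seq (runs_digits hl (by decide) (by decide) hx hσ.hK hσ.hK (by omega)
    (by omega) (by omega) fun σ₁ hS₁ ht₁ hd => ?_)) ?_ fun _ h => h
  · have hcore₁ := hσ.same hS₁ (by decide) (by decide)
    refine Runs.seq (runs_picks hl hnN hcN hKN hkN hNl hcore₁ (g := cls K x) hd
      fun σ₂ hS₂ ht₂ pk hpk hgr => ?_)
    have hcore₂ := hcore₁.same hS₂ (by decide) (by decide)
    have hg₂ : ∀ i < K, σ₂.α 2 i = cls K x i := fun i hi => by rw [hS₂.2 2 (by decide)]; exact hd i hi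
    have hS₁₂ : St.Same tryVars [2, 3, 4] σ σ₂ :=
      (hS₁.mono (by decide) (by decide)).trans (hS₂.mono (by decide) (by decide))
    have hprop := eval_properE (α := σ₂.α) hcore₂.ctx.hn hcore₂.hK hcore₂.hs hg₂
    have hpick := eval_pickedE (α := σ₂.α) hcore₂.ctx.hc hcore₂.hK hg₂ hpk
    rw [hcore₂.ctx.hinp] at hprop
    set P := (∀ i < K, ∀ j < K, cls K x i = cls K x j → ¬ inAdj inp n (s i) (s j)) ∧
      ∀ i < K, 0 < sz K (cls K x) i → pk i < c with hP
    refine Runs.seq (Runs.set_W (v := ind P) hl (by decide) (by decide) (by decide)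
      (hcore₂.lim hnN hcN hKN hkN ht₂ hKN) (by rw [eval_and, hprop, hpick])
      (abs_ind_le_pow _) ?_)
    refine Runs.seq (Runs.loop (Y := 2 ^ K) hl (by decide) ?_ (fun z σ' =>
      St.Same [.vy, .vdv, .vt, .vok, .vz] [4] σ₂ σ' ∧ (∃ t : ℕ, t ≤ N ∧ σ'.ρ .vt = t) ∧
      σ'.ρ .vok = ind (P ∧ ∀ z' < z, Fits n c K (inAdj inp n) (inBud inp n) s (cls K x) pk
        fun j => bits z' j = 1)) ?_ ?_ ?_)
    · simp [hS₁₂.1 .vp2 (by decide), hp2]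
    · exact ⟨((St.Same.refl _ _ _).set _ (by decide)).set _ (by decide),
        ⟨K, hKN, by simpa using ht₂⟩, by simp⟩
    · rintro z hz σ' ⟨hS, _, hok⟩ hσz hσp
      refine runs_fitsTry hl hnN hcN hKN hkN hNl (hcore₂.same hS (by decide) (by decide))
        (g := cls K x) (pk := pk) (fun i hi => by rw [hS.2 2 (by decide), hg₂ i hi])
        (fun i hi => by rw [hS.2 3 (by decide), hpk i hi]) hσz hz h2l hok
        fun σ'' hS' ht' hok' => ?_
      refine ⟨(hS'.1 _ (by decide)).trans hσz, (hS'.1 _ (by decide)).trans hσp,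
        (hS.trans (hS'.mono (by decide) (by decide))).set _ (by decide),
        ⟨K, hKN, by simpa using ht'⟩, ?_⟩
      simp only [St.set_ρ, reduceCtorEq, if_false]
      rw [hok', and_assoc, Nat.forall_lt_succ_right]
    · rintro σ' ⟨hS, ⟨t, htN, ht⟩, hok⟩ _ _
      rw [and_comm] at hok
      have hS₀ : St.Same tryVars [2, 3, 4] σ σ' := hS₁₂.trans (hS.mono (by decide) (by decide))
      have hcore := hσ.same hS₀ (by decide) (by decide)
      have hlim := hcore.lim hnN hcN hKN hkN ht htN
      have hgood : σ'.ρ .vok ≠ 0 ↔ Good n c K (inAdj inp n) (inBud inp n) s (cls K x) pk := by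
        rw [hok, ind_ne_zero, and_comm, good_iff]
      have hans : σ'.ρ .vans = σ.ρ .vans := by
        rw [hS.1 _ (by decide), hS₂.1 _ (by decide), hS₁.1 _ (by decide)]
      refine Runs.cond_W hl (by decide) (by decide) (by decide) hlim (fun h1 => ?_) fun h1 => ?_
      · refine Runs.set_W (v := 1) hl (by decide) (by decide) (by decide) hlim rfl
          (abs_nat_le (a := 1) (by omega)) ?_
        exact hR _ (hS₀.set _ (by decide)) ⟨t, htN, by simpa using ht⟩ pk hgr (by simp)
          fun h => absurd (hgood.1 h1) h
      · exact (Runs.skip hl (hR _ hS₀ ⟨t, htN, ht⟩ pk hgr (fun h => absurd h1 (hgood.2 h))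
          fun _ => hans)).mono (by omega) fun _ h => h
  · have h4 := four_pow_le K
    have h4' : (4 : ℕ) ^ K = 2 ^ K * 2 ^ K := by rw [← mul_pow]; norm_num
    have hE := one_le_self_pow K
    have hP : 1 ≤ 2 ^ K := Nat.one_le_two_pow
    have hPP : 2 ^ K ≤ 2 ^ K * 2 ^ K := Nat.le_mul_of_pos_right _ hP
    rw [h4'] at h4
    have h1 : 400 * (K + 1) * (x + 1) ≤ W N * K ^ K :=
      Nat.mul_le_mul (le_trans (by omega) hWN) (by omega)
    have h2 : K * (W N + 18) + 11 ≤ 3 * W N * (N + 1) := by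
      have : K * (W N + 18) ≤ N * (2 * W N) := Nat.mul_le_mul hKN (by omega)
      nlinarith
    have h3 : 2 ^ K * (2 * W N * 2 ^ K + 18) + 11 ≤ 3 * W N * (4 * K ^ K) := by
      have : 2 ^ K * (2 * W N * 2 ^ K + 18) + 11 ≤ 3 * W N * (2 ^ K * 2 ^ K) := by nlinarith
      exact this.trans (Nat.mul_le_mul_left _ h4)
    have h5 : W N * K ^ K ≤ W N * (N + 1) * K ^ K :=
      Nat.mul_le_mul_right _ (Nat.le_mul_of_pos_right _ (by omega))
    have h6 : W N * (N + 1) ≤ W N * (N + 1) * K ^ K := Nat.le_mul_of_pos_right _ hE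
    have h7 : W N ≤ W N * (N + 1) := Nat.le_mul_of_pos_right _ (by omega)
    nlinarith

theorem runs_classSearch (hl : 1 ≤ l) (hnN : n ≤ N) (hcN : c ≤ N) (hKN : K ≤ N) (hkN : k ≤ N)
    (hNl : (N : ℤ) ≤ 2 ^ l) (hσ : Core n c K k inp s σ)
    (hKl : ∀ i ≤ K, ((K ^ i : ℕ) : ℤ) ≤ 2 ^ l) (h2l : ∀ i ≤ K, ((2 ^ i : ℕ) : ℤ) ≤ 2 ^ l) {t : ℕ}
    (ht : σ.ρ .vt = t) (htN : t ≤ N) (hans : σ.ρ .vans = 0)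
    (hsymm : ∀ u < n, ∀ v < n, inAdj inp n u v → inAdj inp n v u)
    (hs : ∀ a < K, s a < n) (hinj : ∀ a < K, ∀ a' < K, s a = s a' → a = a')
    (hcov : Covers n (inAdj inp n) ((range K).image s)) :
    Runs l classSearch σ (70 * W N * (N + 1) * (K ^ K * K ^ K)) fun σ' =>
      ((∃ φ, IsBudgetedColoring n c (inAdj inp n) (inBud inp n) φ) → σ'.ρ .vans = 1) ∧
      ((¬ ∃ φ, IsBudgetedColoring n c (inAdj inp n) (inBud inp n) φ) → σ'.ρ .vans = 0) := by
  have hWN := le_W N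
  have hE := one_le_self_pow K
  have hlim := hσ.lim hnN hcN hKN hkN ht htN
  have hnn := eval_nonnegE (α := σ.α) hσ.ctx.hn hσ.ctx.hc
  rw [hσ.ctx.hinp] at hnn
  refine Runs.mono (Runs.cond_W (N := N) (T := 100 * (K + 1) + (100 * (K + 1) +
    (K ^ K * (60 * W N * (N + 1) * K ^ K + 18) + 11))) hl (by decide) (by decide) (by decide) hlim
    (fun h1 => ?_) fun h1 => ?_) ?_ fun _ h => h
  · have hb := hnn.1 h1
    refine Runs.seq (runs_power hl (by decide) (by decide) (by decide) hσ.hK hσ.hK hKl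
      fun σ₁ hS₁ ht₁ hp₁ => ?_)
    have hcore₁ := hσ.same hS₁ (by decide) (by decide)
    refine Runs.seq (runs_power hl (by decide) (by decide) (by decide) hcore₁.hK hcore₁.ctx.htwo h2l
      fun σ₂ hS₂ ht₂ hp₂ => ?_)
    have hp₁' : σ₂.ρ .vp = (K ^ K : ℕ) := (hS₂.1 _ (by decide)).trans hp₁
    have hans₂ : σ₂.ρ .vans = 0 := by rw [hS₂.1 _ (by decide), hS₁.1 _ (by decide), hans]
    have hcore₂ := hcore₁.same hS₂ (by decide) (by decide)
    -- Either the answer is `1` and a coloring exists by Hall's theorem, or it is `0` and every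
    -- earlier partition fails the checks with its greedy colors.
    refine Runs.loop (Y := K ^ K) hl (by decide) hp₁' (fun x σ' =>
      St.Same (.vx :: tryVars) [2, 3, 4] σ₂ σ' ∧ (∃ t : ℕ, t ≤ N ∧ σ'.ρ .vt = t) ∧
      ((σ'.ρ .vans = 1 ∧ ∃ φ, IsBudgetedColoring n c (inAdj inp n) (inBud inp n) φ) ∨
        (σ'.ρ .vans = 0 ∧ ∀ x' < x, ∃ pk, Greedy c K (inBud inp n) (cls K x') pk ∧
          ¬ Good n c K (inAdj inp n) (inBud inp n) s (cls K x') pk))) ?_ ?_ ?_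
    · exact ⟨(St.Same.refl _ _ _).set _ (by decide), ⟨K, hKN, by simpa using ht₂⟩,
        Or.inr ⟨by simpa using hans₂, by simp⟩⟩
    · rintro x hx σ' ⟨hS, ⟨t', ht'N, ht'⟩, hJ⟩ hσx hσp
      refine runs_classTry hl hnN hcN hKN hkN hNl (hcore₂.same hS (by decide) (by decide)) hσx hx
        (hKl K le_rfl) ((hS.1 _ (by decide)).trans hp₂) (h2l K le_rfl)
        fun σ'' hS' ht'' pk hgr hyes hno => ?_
      refine ⟨(hS'.1 _ (by decide)).trans hσx, (hS'.1 _ (by decide)).trans hσp,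
        (hS.trans (hS'.mono (by decide) (by decide))).set _ (by decide), by simpa using ht'', ?_⟩
      simp only [St.set_ρ, reduceCtorEq, if_false]
      by_cases hG : Good n c K (inAdj inp n) (inBud inp n) s (cls K x) pk
      · refine Or.inl ⟨hyes hG, hG.exists_coloring hsymm hb ?_ ?_ hgr⟩
        · intro u hu v hv e
          simpa only [mem_image, mem_range] using hcov u hu v hv e
        · exact fun a ha => Nat.mod_lt _ (by omega)
      · rw [hno hG]
        rcases hJ with h | ⟨h2, h3⟩
        · exact Or.inl h
        · refine Or.inr ⟨h2, fun x' hx' => ?_⟩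
          rcases Nat.lt_succ_iff_lt_or_eq.1 hx' with h | rfl
          · exact h3 x' h
          · exact ⟨pk, hgr, hG⟩
    · rintro σ' ⟨_, _, hJ⟩ _ _
      rcases hJ with ⟨h2, h3⟩ | ⟨h2, h3⟩
      · exact ⟨fun _ => h2, fun h => absurd h3 h⟩
      · refine ⟨?_, fun _ => h2⟩
        rintro ⟨φ, hφ⟩
        obtain ⟨g, hgK, hg⟩ := hφ.exists_good hs hinj
        obtain ⟨x, hx, hxg⟩ := exists_digits g hgK
        obtain ⟨pk, hgr, hbad⟩ := h3 x hx
        -- The partition induced by a coloring is one of the enumerated ones, and it passes the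
        -- checks for any greedy choice, including the one computed.
        exact absurd ((hg pk (hgr.congr (g := cls K x) hxg)).congr fun a ha => (hxg a ha).symm) hbad
  · refine (Runs.skip hl ⟨?_, fun _ => hans⟩).mono (by omega) fun _ h => h
    rintro ⟨φ, hφ⟩
    -- A negative budget rules out all colorings, even if its color is not used.
    refine absurd h1 (hnn.2 fun j hj => le_trans (by positivity) (hφ.budget j hj))
  · have h1 : W N * 1 ≤ W N * ((N + 1) * (K ^ K * K ^ K)) :=
      Nat.mul_le_mul_left _ (Nat.mul_pos (by omega) (Nat.mul_pos hE hE))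
    have h2 : K ^ K * 1 ≤ K ^ K * K ^ K := Nat.mul_le_mul_left _ hE
    have h3 : 20000 * (K ^ K * K ^ K) ≤ W N * ((N + 1) * (K ^ K * K ^ K)) :=
      Nat.mul_le_mul (by omega) (Nat.le_mul_of_pos_left _ (by omega))
    nlinarith

end Classes

/-! ### The whole program. -/

section Solve

variable {l N n c : ℕ} {inp : ℕ → ℤ}

theorem runs_solve (hl : 1 ≤ l) (hnN : n + 1 ≤ N) (hcN : c ≤ N) (hN2 : 2 ≤ N)
    (hNl : (N : ℤ) ≤ 2 ^ l) {σ : St} (hρ : ∀ x, σ.ρ x = 0) (hα : σ.α 0 = inp)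
    (h0 : inp 0 = n) (h1 : inp 1 = c) {τ : ℕ} (hτn : τ ≤ n)
    (hKl : ∀ i ≤ τ, ((τ ^ i : ℕ) : ℤ) ≤ 2 ^ l) (h2l : ∀ i ≤ τ, ((2 ^ i : ℕ) : ℤ) ≤ 2 ^ l)
    (hsymm : ∀ u < n, ∀ v < n, inAdj inp n u v → inAdj inp n v u)
    (hτ1 : ∃ D : Finset ℕ, Covers n (inAdj inp n) D ∧ #D = τ)
    (hτ2 : ∀ D : Finset ℕ, D ⊆ range n → Covers n (inAdj inp n) D → τ ≤ #D) :
    Runs l solve σ (140 * W N * (N + 1) ^ 2 * (τ ^ τ * τ ^ τ)) fun σ' =>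
      ((∃ φ, IsBudgetedColoring n c (inAdj inp n) (inBud inp n) φ) → σ'.ρ .vans = 1) ∧
      ((¬ ∃ φ, IsBudgetedColoring n c (inAdj inp n) (inBud inp n) φ) → σ'.ρ .vans = 0) := by
  have hWN := le_W N
  have hlim : ∀ σ' : St, (∀ x, (σ'.ρ x).toNat ≤ N) → Lim N σ' := fun σ' h y _ => h y
  refine Runs.mono (Runs.seq (Runs.set_W (N := N) (v := n) hl (by decide) (by decide) (by decide)
    (hlim _ fun x => by simp [hρ]) (by simpa [hα] using h0) (abs_nat_le (by omega))
    (Runs.seq (Runs.set_W (N := N) (v := c) hl (by decide) (by decide) (by decide)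
    (hlim _ fun x => ?_) (by simpa [hα] using h1) (abs_nat_le (by omega))
    (Runs.seq (Runs.set_W (N := N) (v := (n + 1 : ℕ)) hl (by decide) (by decide) (by decide)
    (hlim _ fun x => ?_) (by simp) (abs_nat_le (by omega))
    (Runs.seq (Runs.set_W (N := N) (v := (2 : ℕ)) hl (by decide) (by decide) (by decide)
    (hlim _ fun x => ?_) rfl (abs_nat_le (by omega))
    (Runs.seq (runs_coverSearch (N := N) (n := n) (c := c) (inp := inp) (K := 0) (t := 0) hl hnN hcN
      hNl ⟨by simp, by simp, by simp, by simp, by simpa using hα⟩ (by simp [hρ]) (by omega)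
      (by simp [hρ]) (by simp [hρ]) (by omega) hτn h2l hτ1 hτ2
      fun σ' hS ht hk hF => ?_)))))))))) (T := W N + (W N + (W N + (W N +
        (16 * W N * (N + 1) ^ 2 * 4 ^ τ + 70 * W N * (N + 1) * (τ ^ τ * τ ^ τ)))))) ?_ fun _ h => h
  · simp only [St.set_ρ, hρ]; split_ifs <;> omega
  · simp only [St.set_ρ, hρ]; split_ifs <;> omega
  · simp only [St.set_ρ, hρ]; split_ifs <;> omega
  · obtain ⟨t, htN, ht⟩ := ht
    obtain ⟨k, hkN, hk⟩ := hk
    obtain ⟨_, hK, s, hs, hcov⟩ := hF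
    obtain ⟨hsn, hinj⟩ := minimal_cover hτ2 hcov
    have hctx : Ctx n c inp σ' := Ctx.same (X := .vkk :: sizeVars) (A := [1, 4])
      ⟨by simp, by simp, by simp, by simp, by simpa using hα⟩ hS (by decide) (by decide)
    exact runs_classSearch hl (by omega) hcN (by omega) hkN hNl ⟨hctx, hK, hk, hs⟩ hKl h2l ht htN
      ((hS.1 _ (by decide)).trans (by simp [hρ])) hsymm hsn hinj hcov
  · have h4 := four_pow_le τ
    have hE := one_le_self_pow τ
    have hEE : τ ^ τ ≤ τ ^ τ * τ ^ τ := Nat.le_mul_of_pos_right _ hE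
    have e1 : 16 * W N * (N + 1) ^ 2 * 4 ^ τ ≤ 16 * W N * (N + 1) ^ 2 * (4 * (τ ^ τ * τ ^ τ)) :=
      Nat.mul_le_mul_left _ (by omega)
    have e2 : W N * (N + 1) * (τ ^ τ * τ ^ τ) ≤ W N * (N + 1) ^ 2 * (τ ^ τ * τ ^ τ) :=
      Nat.mul_le_mul_right _ (Nat.mul_le_mul_left _ (Nat.le_self_pow (by norm_num) _))
    have e3 : W N * 1 ≤ W N * ((N + 1) ^ 2 * (τ ^ τ * τ ^ τ)) :=
      Nat.mul_le_mul_left _ (Nat.mul_pos (by positivity) (Nat.mul_pos hE hE))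
    have e4 : 16 * W N * (N + 1) ^ 2 * (4 * (τ ^ τ * τ ^ τ)) =
        64 * (W N * (N + 1) ^ 2 * (τ ^ τ * τ ^ τ)) := by ring
    have e5 : 70 * W N * (N + 1) * (τ ^ τ * τ ^ τ) = 70 * (W N * (N + 1) * (τ ^ τ * τ ^ τ)) := by
      ring
    have e6 : 140 * W N * (N + 1) ^ 2 * (τ ^ τ * τ ^ τ) =
        140 * (W N * (N + 1) ^ 2 * (τ ^ τ * τ ^ τ)) := by ring
    rw [mul_one, ← mul_assoc] at e3
    rw [e4] at e1
    rw [e5, e6]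
    generalize W N * (N + 1) ^ 2 * (τ ^ τ * τ ^ τ) = A at *
    generalize W N * (N + 1) * (τ ^ τ * τ ^ τ) = B at *
    generalize 16 * W N * (N + 1) ^ 2 * 4 ^ τ = D at *
    omega

end Solve

end BudgetedColoring

namespace BudgetedColoring

open Finset RAM RAM.SExpr

/-! ### The encoding of instances -/

theorem getD_flatMap {α β : Type*} (f : α → List β) {n : ℕ} (d : β) (h : ∀ a, (f a).length = n) :
    ∀ (L : List α) (u v : ℕ) (hu : u < L.length), v < n →
      (L.flatMap f).getD (u * n + v) d = (f L[u]).getD v d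
  | [], u, v, hu, _ => absurd hu (by simp)
  | a :: L, 0, v, _, hv => by
    rw [List.flatMap_cons, List.getD_append _ _ _ _ (by rw [h]; omega)]
    simp
  | a :: L, u + 1, v, hu, hv => by
    rw [List.flatMap_cons, List.getD_append_right _ _ _ _ (by rw [h]; nlinarith), h]
    have : (u + 1) * n + v - n = u * n + v := by rw [add_mul, one_mul]; omega
    rw [this, getD_flatMap f d h L u v (by simpa using hu) hv]
    simp

theorem length_le_inputSize (w : List ℤ) : w.length ≤ inputSize w := by
  have := List.card_nsmul_le_sum (w.map bitLen) 1 (by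
    intro x hx
    obtain ⟨z, _, rfl⟩ := List.mem_map.1 hx
    simp [bitLen])
  simpa [inputSize] using this

theorem abs_getD_le (w : List ℤ) (i : ℕ) : |w.getD i 0| ≤ 2 ^ inputSize w := by
  by_cases hi : i < w.length
  · have hmem : w.getD i 0 ∈ w := by
      rw [List.getD_eq_getElem _ _ hi]; exact List.getElem_mem hi
    have h1 : bitLen (w.getD i 0) ≤ inputSize w :=
      List.single_le_sum (by simp) _ (List.mem_map_of_mem hmem)
    have h2 : (w.getD i 0).natAbs < 2 ^ Nat.size (w.getD i 0).natAbs := Nat.lt_size_self _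
    have h3 : 2 ^ Nat.size (w.getD i 0).natAbs ≤ 2 ^ inputSize w :=
      Nat.pow_le_pow_right (by norm_num) (by unfold bitLen at h1; omega)
    rw [Int.abs_eq_natAbs]
    exact_mod_cast (h2.le.trans h3)
  · rw [List.getD_eq_default _ _ (by omega)]; simp

section Instance

variable (I : BCPInstance)

/-- The input array of the machine. -/
noncomputable def input (i : ℕ) : ℤ := I.encode.getD i 0

open scoped Classical in
theorem row_length (u : Fin I.n) :
    ((List.finRange I.n).map fun v => if I.G.Adj u v then (1 : ℤ) else 0).length = I.n := by simp

open scoped Classical in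
theorem matrix_length : ((List.finRange I.n).flatMap fun u =>
    (List.finRange I.n).map fun v => if I.G.Adj u v then (1 : ℤ) else 0).length = I.n * I.n := by
  simp [List.length_flatMap]

theorem encode_length : I.encode.length = 2 + I.n * I.n + I.c := by
  simp only [BCPInstance.encode, List.length_append, matrix_length, List.length_ofFn,
    List.length_cons, List.length_nil]

theorem input_zero : input I 0 = I.n := rfl

theorem input_one : input I 1 = I.c := rfl

theorem inAdj_iff {u v : ℕ} (hu : u < I.n) (hv : v < I.n) :
    inAdj (input I) I.n u v ↔ I.G.Adj ⟨u, hu⟩ ⟨v, hv⟩ := by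
  classical
  have hlt : u * I.n + v < I.n * I.n := by
    have : (u + 1) * I.n ≤ I.n * I.n := Nat.mul_le_mul_right _ hu
    rw [add_mul, one_mul] at this
    omega
  have : input I (2 + (u * I.n + v)) = if I.G.Adj ⟨u, hu⟩ ⟨v, hv⟩ then 1 else 0 := by
    unfold input BCPInstance.encode
    rw [List.append_assoc, List.getD_append_right _ _ _ _ (by simp), List.getD_append _ _ _ _ (by
      rw [matrix_length]; simpa using hlt)]
    have h2 : 2 + (u * I.n + v) - ([(I.n : ℤ), (I.c : ℤ)]).length = u * I.n + v := by simp
    rw [h2, getD_flatMap _ 0 (row_length I) _ u v (by simpa using hu) hv,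
      List.getD_eq_getElem _ _ (by simpa using hv)]
    simp
  rw [inAdj, this]
  simp

theorem inBud_eq {j : ℕ} (hj : j < I.c) : inBud (input I) I.n j = I.b ⟨j, hj⟩ := by
  classical
  unfold inBud input BCPInstance.encode
  rw [List.getD_append_right _ _ _ _ (by
    rw [List.length_append, matrix_length]; simp), List.length_append, matrix_length]
  have : 2 + I.n * I.n + j - (([(I.n : ℤ), (I.c : ℤ)]).length + I.n * I.n) = j := by simp
  rw [this, List.getD_eq_getElem _ _ (by simpa using hj)]
  simp

theorem hasBudgetedColoring_iff : I.HasBudgetedColoring ↔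
    ∃ φ, IsBudgetedColoring I.n I.c (inAdj (input I) I.n) (inBud (input I) I.n) φ := by
  classical
  have hcard : ∀ (φ : ℕ → ℕ) (ψ : Fin I.n → Fin I.c) (j : Fin I.c), (∀ v : Fin I.n, φ v = ψ v) →
      #{v ∈ range I.n | φ v = j} = (ψ ⁻¹' {j}).ncard := by
    intro φ ψ j h
    have : (({v ∈ range I.n | φ v = j} : Finset ℕ) : Set ℕ) = Fin.val '' (ψ ⁻¹' {j}) := by
      ext v
      simp only [coe_filter, mem_range, Set.mem_ofPred_eq, Set.mem_image, Set.mem_preimage,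
        Set.mem_singleton_iff]
      constructor
      · rintro ⟨hv, e⟩
        exact ⟨⟨v, hv⟩, Fin.ext ((h ⟨v, hv⟩).symm.trans e), rfl⟩
      · rintro ⟨w, e, rfl⟩
        exact ⟨w.2, by rw [h w, e]⟩
    rw [← Set.ncard_coe_finset, this, Set.ncard_image_of_injective _ Fin.val_injective]
  constructor
  · rintro ⟨ψ, hψ⟩
    set φ : ℕ → ℕ := fun v => if hv : v < I.n then ψ ⟨v, hv⟩ else 0 with hφ
    have hφψ : ∀ v : Fin I.n, φ v = ψ v := fun v => by simp [hφ]
    refine ⟨φ, fun v hv => ?_, fun u hu v hv e h => ?_, fun j hj => ?_⟩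
    · rw [hφψ ⟨v, hv⟩]; exact (ψ ⟨v, hv⟩).2
    · rw [hφψ ⟨u, hu⟩, hφψ ⟨v, hv⟩] at h
      exact ψ.valid ((inAdj_iff I hu hv).1 e) (Fin.ext h)
    · rw [inBud_eq I hj, hcard φ ψ ⟨j, hj⟩ hφψ]
      exact hψ ⟨j, hj⟩
  · rintro ⟨φ, hφ⟩
    refine ⟨SimpleGraph.Coloring.mk (fun v => ⟨φ v, hφ.lt v v.2⟩) fun {u v} e h => ?_, fun j => ?_⟩
    · exact hφ.proper u u.2 v v.2 ((inAdj_iff I u.2 v.2).2 e) (congrArg Fin.val h)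
    · have h1 := hφ.budget j j.2
      rw [inBud_eq I j.2, hcard φ (fun v => ⟨φ v, hφ.lt v v.2⟩) j fun _ => rfl] at h1
      exact h1

theorem covers_iff {D : Finset ℕ} : Covers I.n (inAdj (input I) I.n) D ↔
    I.G.IsVertexCover {v | (v : ℕ) ∈ D} := by
  constructor
  · intro h u v e
    exact h u u.2 v v.2 ((inAdj_iff I u.2 v.2).2 e)
  · intro h u hu v hv e
    exact h ((inAdj_iff I hu hv).1 e)

theorem vertexCoverNum_eq : I.G.vertexCoverNum = I.vertexCoverSize :=
  (ENat.natCast_toNat SimpleGraph.vertexCoverNum_ne_top_of_finite).symm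

theorem exists_covers : ∃ D : Finset ℕ, D ⊆ range I.n ∧ Covers I.n (inAdj (input I) I.n) D ∧
    #D = I.vertexCoverSize := by
  classical
  obtain ⟨s, hs, hcov⟩ := SimpleGraph.vertexCoverNum_exists I.G
  refine ⟨s.toFinset.map Fin.valEmbedding, ?_, ?_, ?_⟩
  · intro v hv
    simp only [mem_map, Fin.valEmbedding_apply] at hv
    obtain ⟨w, _, rfl⟩ := hv
    exact mem_range.2 w.2
  · rw [covers_iff]
    convert hcov using 1
    ext v
    simp [Fin.val_inj]
  · rw [card_map]
    rw [vertexCoverNum_eq, Set.encard_eq_coe_toFinset_card] at hs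
    exact_mod_cast hs

theorem vertexCoverSize_le {D : Finset ℕ} (h : Covers I.n (inAdj (input I) I.n) D) :
    I.vertexCoverSize ≤ #D := by
  have h1 := ((covers_iff I).1 h).vertexCoverNum_le
  rw [vertexCoverNum_eq] at h1
  have h2 : ({v | (v : ℕ) ∈ D} : Set (Fin I.n)).encard ≤ (D : Set ℕ).encard := by
    rw [← Fin.val_injective.encard_image]
    refine Set.encard_le_encard ?_
    rintro _ ⟨v, hv, rfl⟩
    exact hv
  rw [Set.encard_coe_eq_coe_finsetCard] at h2
  exact_mod_cast h1.trans h2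

theorem vertexCoverSize_le_n : I.vertexCoverSize ≤ I.n := by
  have := vertexCoverSize_le I (D := range I.n) fun u hu _ _ _ => Or.inl (mem_range.2 hu)
  simpa using this

end Instance

/-! ### The final running time. -/

theorem solvable : BCPByVertexCover.SolvableInOStar fun k => ((k ^ (2 * k) : ℕ) : ℝ) := by
  refine ⟨solve, 140 * 20000 * 64, 8, fun (I : BCPInstance) => ?_⟩
  change ∃ m t, Exec solve (init I.encode) m t ∧ (I.HasBudgetedColoring → m.reg 0 = 1) ∧
    (¬ I.HasBudgetedColoring → m.reg 0 = 0) ∧ (t : ℝ) ≤ (140 * 20000 * 64 : ℕ) *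
      ((I.vertexCoverSize ^ (2 * I.vertexCoverSize) : ℕ) : ℝ) * (inputSize I.encode : ℝ) ^ 8
  set s := inputSize I.encode with hs
  set τ := I.vertexCoverSize with hτ
  have hlen := length_le_inputSize I.encode
  rw [encode_length, ← hs] at hlen
  have hnn : I.n ≤ I.n * I.n := Nat.le_mul_self _
  have hτn : τ ≤ I.n := vertexCoverSize_le_n I
  have hss : s ≤ s * s := Nat.le_mul_self _
  have hpow : ∀ i : ℕ, i ≤ s → ∀ q : ℕ, q ≤ 2 ^ s → ((q ^ i : ℕ) : ℤ) ≤ 2 ^ (s * s) := by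
    intro i hi q hq
    have : q ^ i ≤ 2 ^ (s * s) := by
      calc q ^ i ≤ (2 ^ s) ^ i := Nat.pow_le_pow_left hq i
        _ ≤ (2 ^ s) ^ s := Nat.pow_le_pow_right (by positivity) hi
        _ = 2 ^ (s * s) := by rw [pow_mul]
    exact_mod_cast this
  have hs2 : s < 2 ^ s := Nat.lt_two_pow_self
  have hsl : (s : ℤ) ≤ 2 ^ (s * s) := by
    have := hpow 1 (by omega) s hs2.le
    simpa using this
  obtain ⟨D, hDn, hDc, hDτ⟩ := exists_covers I
  -- The input length bounds `n + 1` and `c`, so `N = s` works. The counters go up to `τ ^ τ ≤ (2 ^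
  -- s) ^ s`, so `s * s` bits suffice for all stored values.
  have hrun := runs_solve (l := s * s) (N := s) (n := I.n) (c := I.c) (inp := input I)
    (by omega) (by omega) (by omega) (by omega) hsl
    (σ := ⟨fun _ => 0, (init I.encode).arr⟩) (fun _ => rfl)
    (by funext i; simp [init, input]) (input_zero I) (input_one I) hτn
    (fun i hi => hpow i (by omega) τ (by omega))
    (fun i hi => hpow i (by omega) 2 (by omega))
    (fun u hu v hv e => (inAdj_iff I hv hu).2 ((inAdj_iff I hu hv).1 e).symm)
    ⟨D, hDc, hDτ⟩ (fun D _ hD => vertexCoverSize_le I hD)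
  obtain ⟨m, σ', t, hex, hrel, _, ⟨hyes, hno⟩, ht⟩ := hrun ⟨fun x => by simp, fun a i => by
      simp only [init]
      split_ifs
      · exact (abs_getD_le _ _).trans (pow_le_pow_right₀ (by norm_num) hss)
      · simp⟩ (init I.encode) ⟨fun x => rfl, rfl⟩
  have hans : m.reg 0 = σ'.ρ .vans := hrel.1 .vans
  refine ⟨m, t, hex, fun h => ?_, fun h => ?_, ?_⟩
  · rw [hans]; exact hyes ((hasBudgetedColoring_iff I).1 h)
  · rw [hans]; exact hno fun h' => h ((hasBudgetedColoring_iff I).2 h')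
  · have h1 : t ≤ 140 * 20000 * 64 * τ ^ (2 * τ) * s ^ 8 := by
      refine ht.trans ?_
      -- Four factors `s + 1` come from `W` and two from the loops, and the factor `s * s` is `l`.
      -- This gives the exponent `8`, and `2 ^ 6 = 64` enters the constant.
      have e1 : (s + 1) ^ 6 ≤ (2 * s) ^ 6 := Nat.pow_le_pow_left (by omega) 6
      have e2 : τ ^ τ * τ ^ τ = τ ^ (2 * τ) := by rw [← pow_add]; congr 1; omega
      unfold W
      rw [e2]
      calc _ = 140 * 20000 * τ ^ (2 * τ) * (s * s) * (s + 1) ^ 6 := by ring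
        _ ≤ 140 * 20000 * τ ^ (2 * τ) * (s * s) * (2 * s) ^ 6 := Nat.mul_le_mul_left _ e1
        _ = _ := by ring
    exact_mod_cast h1

/-- For `k = 0` both sides are `1`, by the conventions for `Real.logb 2 0` and `0 ^ 0`. -/
theorem two_rpow_eq (k : ℕ) :
    (2 : ℝ) ^ (2 * (k : ℝ) * Real.logb 2 (k : ℝ)) = ((k ^ (2 * k) : ℕ) : ℝ) := by
  rcases Nat.eq_zero_or_pos k with rfl | hk
  · simp
  · have hk' : (0 : ℝ) < k := by exact_mod_cast hk
    rw [mul_comm, Real.rpow_mul (by norm_num), Real.rpow_logb (by norm_num) (by norm_num) hk']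
    rw [show (2 * (k : ℝ)) = ((2 * k : ℕ) : ℝ) by push_cast; ring, Real.rpow_natCast]
    push_cast; rfl

theorem computable_pow : Computable fun k : ℕ => k ^ (2 * k) := by
  have hp : Primrec₂ fun a b : ℕ => a ^ b := Primrec₂.unpaired'.1 Nat.Primrec.pow
  exact (hp.comp Primrec.id (Primrec.nat_mul.comp (Primrec.const 2) Primrec.id)).to_comp

end BudgetedColoring

theorem mainTheorem1 :
    BCPByVertexCover.IsFPT ∧
      BCPByVertexCover.SolvableInOStar
        (fun k : ℕ => (2 : ℝ) ^ (2 * (k : ℝ) * Real.logb 2 (k : ℝ))) := by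
  refine ⟨⟨fun k => k ^ (2 * k), BudgetedColoring.computable_pow, BudgetedColoring.solvable⟩, ?_⟩
  simp only [BudgetedColoring.two_rpow_eq]
  exact BudgetedColoring.solvable
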